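/- **Setting.** Let $A_0,A_1,\dots$ be i.i.d. random elements of a measurable space $\mathbb A$, and let $V_{ij}=V_{ji}$ ($i\ne j$) be real random variables, i.i.d. over unordered pairs with a Lebesgue density $f_V$, the family $(V_{ij})$ being independent of the family $(A_i)$. Put $W_{ij}=W(A_i,A_j,V_{ij})$, where $W$ is measurable, symmetric in its first two arguments, and strictly increasing and continuously differentiable with nonvanishing derivative in the third. Write $$f_{W|AA}(s|a,b)=f_V(W^{-1}(a,b,s))\,\Big|\tfrac{\partial W}{\partial v}(a,b,W^{-1}(a,b,s))\Big|^{-1}$$ (and $0$ if $s$ is not in the range of $W(a,b,\cdot)$), $f_{W|A}(w|a)=\mathbb E f_{W|AA}(w|a,A_j)$ and $f_W(w)=\mathbb E f_{W|AA}(w|A_i,A_j)$ for $i\neq j$. Let $w\in\mathbb R$ be such that, for some $\delta>0$ and $M<\infty$ and all $a,b\in\mathbb A$, $f_{W|AA}(\cdot|a,b)$ is $C^2$ on $(w-\delta,w+\delta)$, and it and its second derivative are bounded there by $M$. Let $K:\mathbb R\to\mathbb R$ be bounded, measurable, symmetric, zero outside a bounded interval, with $\int K=1$. For $N$ nodes put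 $n=\binom N2$ and let the bandwidths $h=h_N>0$ satisfy $h\to0$. Define $$K_{ij}=\tfrac1hK\Big(\tfrac{w-W_{ij}}h\Big),\quad \hat f_W(w)=\tfrac1n\sum_{i<j}K_{ij},\quad \Omega_1(w)=\mathbb V\big(f_{W|A}(w|A_i)\big),\quad \Omega_2(w)=f_W(w)\int K(u)^2\,du,$$ $$T_1=\tfrac1n\sum_{i<j}\big(K_{ij}-\mathbb E[K_{ij}|A_i,A_j]\big),\qquad T_3=\tfrac2N\sum_{i}\big(\mathbb E[K_{ij}|A_i]-\mathbb E[K_{ij}]\big)\ \ (j\ne i),$$ $$T_2=\tfrac1n\sum_{i<j}\mathbb E[K_{ij}|A_i,A_j]-\big(\mathbb E[K_{ij}]+T_3\big),\qquad T_4=\mathbb E[K_{ij}]-f_W(w),\qquad \sigma_N^2=\mathbb E\big[(T_1+T_3)^2\big],$$ where sums run over the $N$ sampled nodes and all these quantities depend on $N$. The law $\mathcal N(0,0)$ is the point mass at $0$. **Theorem.** Suppose $Nh\ge C_0>0$ for all large $N$ and $Nh^4\to0$. Then, as $N\to\infty$: 1. $\hat f_W(w)-f_W(w)=T_1+T_2+T_3+T_4$,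 with $\mathbb E[T_2^2]=O(1/n)$ and $T_4=O(h^2)$, and $$\sigma_N^2=\frac{\Omega_2(w)}{nh}+\frac{4\Omega_1(w)}N+O\Big(\frac1n\Big)+O\Big(\frac{h^2}N\Big).$$ 2. If $\Omega_1(w)>0$ or $\Omega_2(w)>0$, then $(T_1+T_3)/\sigma_N\xrightarrow{D}\mathcal N(0,1)$ and $T_2/\sigma_N\xrightarrow{p}0$. 3. If $\Omega_1(w)>0$, or if $\Omega_2(w)>0$ and $nh^5\to0$, then $T_4/\sigma_N\to0$ and $(\hat f_W(w)-f_W(w))/\sigma_N\xrightarrow{D}\mathcal N(0,1)$. 4. If $Nh\to\infty$ and $\Omega_1(w)>0$, then $N\sigma_N^2\to4\Omega_1(w)$ and $\sqrt N(\hat f_W(w)-f_W(w))\xrightarrow{D}\mathcal N(0,4\Omega_1(w))$. 5. If $Nh\to C$ with $0<C<\infty$, then $N\sigma_N^2\to4\Omega_1(w)+2C^{-1}\Omega_2(w)$ and $\sqrt N(\hat f_W(w)-f_W(w))\xrightarrow{D}\mathcal N(0,4\Omega_1(w)+2C^{-1}\Omega_2(w))$. 6. If $\Omega_1(w)=0$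 and $nh^5\to0$, then $\sqrt{nh}\,(\hat f_W(w)-f_W(w))\xrightarrow{D}\mathcal N(0,\Omega_2(w))$. -/

import Mathlib

open MeasureTheory ProbabilityTheory Filter Topology Asymptotics

noncomputable section

namespace DyadicKDE

/-- The undirected dyadic data generating process `W_ij = W(A_i, A_j, V_ij)` on a probability
space `(Ω, μ)`: i.i.d. node attributes `A_i` with values in an arbitrary measurable space `𝔸`,
i.i.d. dyad errors `V_ij = V_ji` (one for each unordered pair `i ≠ j`) with Lebesgue density `fV`,
independent of the attributes, and a measurable function `W`, symmetric in its first two arguments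
and strictly increasing and continuously differentiable, with nonzero derivative, in the third. -/
structure Model {Ω : Type*} [MeasurableSpace Ω] (μ : Measure Ω)
    (𝔸 : Type*) [MeasurableSpace 𝔸] where
  /-- node attributes -/
  A : ℕ → Ω → 𝔸
  /-- dyad errors -/
  V : ℕ → ℕ → Ω → ℝ
  /-- the outcome function -/
  W : 𝔸 → 𝔸 → ℝ → ℝ
  /-- the density of the errors -/
  fV : ℝ → ℝ
  measurable_A : ∀ i, Measurable (A i)
  identDistrib_A : ∀ i, IdentDistrib (A i) (A 0) μ μ
  iIndepFun_A : iIndepFun A μ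
  measurable_V : ∀ i j, i ≠ j → Measurable (V i j)
  V_symm : ∀ i j, V i j = V j i
  measurable_fV : Measurable fV
  fV_nonneg : ∀ v, 0 ≤ fV v
  law_V : ∀ i j, i ≠ j → μ.map (V i j) = volume.withDensity (fun v => ENNReal.ofReal (fV v))
  iIndepFun_V : iIndepFun (fun p : {p : ℕ × ℕ // p.1 < p.2} => V p.1.1 p.1.2) μ
  indepFun_A_V : IndepFun (fun ω i => A i ω)
    (fun ω (p : {p : ℕ × ℕ // p.1 < p.2}) => V p.1.1 p.1.2 ω) μ
  measurable_W : Measurable (fun x : 𝔸 × 𝔸 × ℝ => W x.1 x.2.1 x.2.2)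
  W_symm : ∀ a b v, W a b v = W b a v
  strictMono_W : ∀ a b, StrictMono (W a b)
  contDiff_W : ∀ a b, ContDiff ℝ 1 (W a b)
  deriv_W_ne_zero : ∀ a b v, deriv (W a b) v ≠ 0

/-- A kernel function: bounded, symmetric, zero outside a bounded interval, integrating to one. -/
structure IsKernel (K : ℝ → ℝ) : Prop where
  measurable : Measurable K
  bounded : ∃ Kbar : ℝ, ∀ u, |K u| ≤ Kbar
  symm : ∀ u, K (-u) = K u
  support : ∃ ubar : ℝ, ∀ u, ubar < |u| → K u = 0
  integral_eq_one : ∫ u, K u = 1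

/-- The number `n = N (N - 1) / 2` of dyads among `N` nodes. -/
def numDyads (N : ℕ) : ℝ := (N.choose 2 : ℝ)

/-- `∑_{i < j}` over the pairs of the `N` sampled nodes `0, …, N - 1`. -/
def dyadSum (N : ℕ) (x : ℕ → ℕ → ℝ) : ℝ :=
  ∑ i ∈ Finset.range N, ∑ j ∈ Finset.Ioo i N, x i j

namespace Model

variable {Ω : Type*} [MeasurableSpace Ω] {μ : Measure Ω} {𝔸 : Type*} [MeasurableSpace 𝔸]

/-- The outcome `W_ij`. -/
def outcome (D : Model μ 𝔸) (i j : ℕ) (ω : Ω) : ℝ := D.W (D.A i ω) (D.A j ω) (D.V i j ω)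

/-- The conditional density `f_{W|AA}(s | a, b) = f_V(W⁻¹(a,b,s)) |∂W/∂v(a,b,W⁻¹(a,b,s))|⁻¹` of
`W_ij` given `A_i = a`, `A_j = b`; it vanishes outside the range of `W(a,b,·)`. -/
def densityAA (D : Model μ 𝔸) (a b : 𝔸) (s : ℝ) : ℝ :=
  (Set.range (D.W a b)).indicator
    (fun s => D.fV (Function.invFun (D.W a b) s) *
      |deriv (D.W a b) (Function.invFun (D.W a b) s)|⁻¹) s

/-- `f_{W|A}(w | a) = E[f_{W|AA}(w | a, A_j)]`. -/
def densityA (D : Model μ 𝔸) (w : ℝ) (a : 𝔸) : ℝ := ∫ ω, D.densityAA a (D.A 1 ω) w ∂μ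

/-- The marginal density `f_W(w) = E[f_{W|AA}(w | A_i, A_j)]`. -/
def density (D : Model μ 𝔸) (w : ℝ) : ℝ := ∫ ω, D.densityAA (D.A 0 ω) (D.A 1 ω) w ∂μ

/-- The conditional densities `f_{W|AA}(· | a, b)` are bounded and twice continuously
differentiable with bounded second derivative near `w`, uniformly in `a` and `b`. -/
def SmoothAt (D : Model μ 𝔸) (w : ℝ) : Prop :=
  ∃ δ > 0, ∃ M : ℝ, ∀ a b : 𝔸,
    ContDiffOn ℝ 2 (D.densityAA a b) (Metric.ball w δ) ∧
    ∀ s ∈ Metric.ball w δ,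
      |D.densityAA a b s| ≤ M ∧ |iteratedDeriv 2 (D.densityAA a b) s| ≤ M

/-- `Ω₁(w) = Var(f_{W|A}(w | A_i))`. -/
def Omega1 (D : Model μ 𝔸) (w : ℝ) : ℝ := Var[fun ω => D.densityA w (D.A 0 ω); μ]

/-- `Ω₂(w) = f_W(w) ∫ K(u)² du`. -/
def Omega2 (D : Model μ 𝔸) (K : ℝ → ℝ) (w : ℝ) : ℝ := D.density w * ∫ u, K u ^ 2

/-- `K_ij = h⁻¹ K((w - W_ij) / h)`. -/
def kern (D : Model μ 𝔸) (K : ℝ → ℝ) (w h : ℝ) (i j : ℕ) (ω : Ω) : ℝ :=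
  1 / h * K ((w - D.outcome i j ω) / h)

/-- The dyadic kernel density estimator based on `N` nodes and bandwidth `h`. -/
def fHat (D : Model μ 𝔸) (K : ℝ → ℝ) (w h : ℝ) (N : ℕ) (ω : Ω) : ℝ :=
  1 / numDyads N * dyadSum N (fun i j => D.kern K w h i j ω)

/-- `E[K_ij]`. -/
def meanKern (D : Model μ 𝔸) (K : ℝ → ℝ) (w h : ℝ) : ℝ := ∫ ω, D.kern K w h 0 1 ω ∂μ

/-- The σ-algebra generated by `A_i`. -/
abbrev sigmaA (D : Model μ 𝔸) (i : ℕ) : MeasurableSpace Ω := MeasurableSpace.comap (D.A i) inferInstance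

/-- `E[K_ij | A_i]`. -/
def condKern1 (D : Model μ 𝔸) (K : ℝ → ℝ) (w h : ℝ) (i j : ℕ) : Ω → ℝ :=
  μ[D.kern K w h i j | D.sigmaA i]

/-- `E[K_ij | A_i, A_j]`. -/
def condKern2 (D : Model μ 𝔸) (K : ℝ → ℝ) (w h : ℝ) (i j : ℕ) : Ω → ℝ :=
  μ[D.kern K w h i j | D.sigmaA i ⊔ D.sigmaA j]

/-- `T₁ = n⁻¹ ∑_{i<j} (K_ij - E[K_ij | A_i, A_j])`. -/
def T1 (D : Model μ 𝔸) (K : ℝ → ℝ) (w h : ℝ) (N : ℕ) (ω : Ω) : ℝ :=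
  1 / numDyads N * dyadSum N (fun i j => D.kern K w h i j ω - D.condKern2 K w h i j ω)

/-- The centered Hájek projection `T₃ = (2/N) ∑_i (E[K_ij | A_i] - E[K_ij])`, where the partner
`j ≠ i` of node `i` is its cyclic successor among the `N` nodes (the choice does not matter, up to
null sets). -/
def T3 (D : Model μ 𝔸) (K : ℝ → ℝ) (w h : ℝ) (N : ℕ) (ω : Ω) : ℝ :=
  2 / (N : ℝ) * ∑ i ∈ Finset.range N,
    (D.condKern1 K w h i ((i + 1) % N) ω - D.meanKern K w h)

/-- `T₂ = n⁻¹ ∑_{i<j} E[K_ij | A_i, A_j] - (E[K_ij] + (2/N) ∑_i (E[K_ij | A_i] - E[K_ij]))`. -/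
def T2 (D : Model μ 𝔸) (K : ℝ → ℝ) (w h : ℝ) (N : ℕ) (ω : Ω) : ℝ :=
  1 / numDyads N * dyadSum N (fun i j => D.condKern2 K w h i j ω)
    - (D.meanKern K w h + D.T3 K w h N ω)

/-- The bias `T₄ = E[K_ij] - f_W(w)`. -/
def T4 (D : Model μ 𝔸) (K : ℝ → ℝ) (w h : ℝ) : ℝ := D.meanKern K w h - D.density w

/-- `σ_N² = E[(T₁ + T₃)²]`. -/
def sigmaSq (D : Model μ 𝔸) (K : ℝ → ℝ) (w h : ℝ) (N : ℕ) : ℝ :=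
  ∫ ω, (D.T1 K w h N ω + D.T3 K w h N ω) ^ 2 ∂μ

/-- `σ_N`. -/
def sigma (D : Model μ 𝔸) (K : ℝ → ℝ) (w h : ℝ) (N : ℕ) : ℝ := Real.sqrt (D.sigmaSq K w h N)

end Model

/-- `X_N` converges in distribution to the centered normal law `𝒩(0, v)` (a point mass at `0` if
`v = 0`). -/
def TendstoNormal {Ω : Type*} [MeasurableSpace Ω] (μ : Measure Ω) [IsProbabilityMeasure μ]
    (X : ℕ → Ω → ℝ) (v : ℝ) : Prop :=
  TendstoInDistribution X atTop (id : ℝ → ℝ) (fun _ => μ) (gaussianReal 0 v.toNNReal)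

end DyadicKDE

end

/-!
The estimation error of the dyadic kernel density estimator is split by projecting `K_ij` on the
attributes. With `g(a, b) = E[K_ij | A_i = a, A_j = b]`, `G(a) = E g(a, A_j)` and
`m = E[K_ij]`, almost surely `T₁ = n⁻¹ ∑_{i<j} (K_ij - g(A_i, A_j))`,
`T₃ = (2/N) ∑_i (G(A_i) - m)`, and `T₂` is the completely degenerate U-statistic with kernel
`g(a, b) - G(a) - G(b) + m`.

*Moments.* A change of variables turns `g(a, b)` into `∫ K(u) f_{W|AA}(w - h u | a, b) du`. Since
`K` is symmetric, Taylor's formula gives `g(a, b) = f_{W|AA}(w | a, b) + O(h²)` uniformly in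
`a, b`, and the same argument for `K²` gives the conditional second moment of `K_ij` up to `O(h)`
(`Model.exists_pair_expansion`, `Model.exists_moment_expansion`). In particular
`f_{W|AA}(w | ·, ·)` is a limit of measurable functions. The terms of `T₁` are orthogonal to each
other and to `T₃`, so that `σ_N² = E Var(K_ij | A_i, A_j) / n + 4 Var(G(A_i)) / N` exactly
(`Model.sigmaSq_eq`), and degeneracy yields `E[T₂²] = O(1/n)`
(`integral_sq_degenerate_sum_le`).

*Normal approximation.* No martingale central limit theorem is needed. Conditionally on all
attributes, `T₁` is a sum of independent centered bounded terms. Its conditional characteristic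
function is therefore close to `exp(-t² S / 2)`, where `S` is the conditional variance of `T₁`,
itself a U-statistic of the attributes that concentrates around its mean. So the conditional
characteristic function is nearly deterministic, and that of `T₁ + T₃` nearly factorizes into a
Gaussian one and that of the i.i.d. sum `T₃`. This gives an explicit bound
(`Model.norm_charFun_combination_sub_le`) which tends to zero for every normalization `a_N` with
`a_N² = O(n h)` such that `a_N² σ_N²` converges (`Model.tendstoNormal_leading`); a zero limit is
allowed. For such `a_N`, also `a_N T₂ → 0` in probability, and the limit theorem passes to the
estimator as soon as `a_N² h⁴ → 0` (`Model.tendstoNormal_estimator`). All the limit laws are the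
cases `a_N = 1 / σ_N`, `√N` and `√(n h)`; the first is admissible because `n h σ_N²` is bounded
away from zero when `Ω₁ > 0` or `Ω₂ > 0` (`Model.exists_sigmaSq_lower_bound`).
-/

namespace DyadicKDE

/-! ### Second-order expansion of characteristic functions -/

/-- The constant `4` is not optimal: for `|x| ≤ 1` the exponential series gives it, and for
`|x| > 1` every term of the expansion is at most `|x| ^ 3`. -/
lemma norm_cexp_sub_taylor_two_le (x : ℝ) :
    ‖Complex.exp (Complex.I * x) - (1 + Complex.I * x - (x : ℂ) ^ 2 / 2)‖ ≤ 4 * |x| ^ 3 := by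
  rcases le_or_gt |x| 1 with hx | hx
  · have h := Complex.exp_bound (x := Complex.I * x) (by simpa using hx) (n := 3) (by norm_num)
    have e : ∑ m ∈ Finset.range 3, (Complex.I * (x : ℂ)) ^ m / (m.factorial : ℂ)
        = 1 + Complex.I * x - (x : ℂ) ^ 2 / 2 := by
      simp [Finset.sum_range_succ, mul_pow, Nat.factorial]
      ring
    rw [e] at h
    refine h.trans ?_
    simp only [norm_mul, Complex.norm_I, one_mul, Complex.norm_real, Real.norm_eq_abs]
    rw [mul_comm]
    gcongr
    norm_num [Nat.factorial]
  · have h1 : ‖Complex.exp (Complex.I * x)‖ = 1 := by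
      rw [mul_comm]; exact Complex.norm_exp_ofReal_mul_I x
    have h2 : ‖(1 + Complex.I * x - (x : ℂ) ^ 2 / 2)‖ ≤ 1 + |x| + |x| ^ 2 / 2 := by
      refine (norm_sub_le _ _).trans (add_le_add ((norm_add_le _ _).trans ?_) ?_)
      · simp
      · simp
    refine (norm_sub_le _ _).trans ?_
    rw [h1]
    have : |x| ≤ |x| ^ 3 := le_self_pow₀ hx.le (by norm_num)
    have : |x| ^ 2 ≤ |x| ^ 3 := pow_le_pow_right₀ hx.le (by norm_num)
    have : 1 ≤ |x| ^ 3 := one_le_pow₀ hx.le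
    linarith

lemma abs_exp_neg_sub_one_add_le {y : ℝ} (hy : 0 ≤ y) : |Real.exp (-y) - (1 - y)| ≤ y ^ 2 := by
  have h1 : 1 - y ≤ Real.exp (-y) := Real.one_sub_le_exp_neg y
  rw [abs_of_nonneg (by linarith)]
  rcases le_or_gt y 1 with h | h
  · have := Real.abs_exp_sub_one_sub_id_le (x := -y) (by rwa [abs_neg, abs_of_nonneg hy])
    have := (abs_le.1 this).2
    nlinarith
  · have : Real.exp (-y) ≤ 1 := Real.exp_le_one_iff.2 (by linarith)
    nlinarith

/-- The characteristic function of a bounded centered random variable is close to that of the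
centered normal law with the same variance. -/
lemma norm_integral_cexp_sub_exp_le {S : Type*} [MeasurableSpace S] (ν : Measure S)
    [IsProbabilityMeasure ν] {X : S → ℝ} (hX : Measurable X) {B : ℝ} (hB : ∀ x, |X x| ≤ B)
    (h0 : ∫ x, X x ∂ν = 0) (s : ℝ) :
    ‖∫ x, Complex.exp (Complex.I * ((s * X x : ℝ) : ℂ)) ∂ν
      - (Real.exp (-(s ^ 2 * (∫ x, X x ^ 2 ∂ν) / 2)) : ℂ)‖
      ≤ 4 * |s| ^ 3 * B * (∫ x, X x ^ 2 ∂ν) + s ^ 4 * (∫ x, X x ^ 2 ∂ν) ^ 2 := by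
  set v := ∫ x, X x ^ 2 ∂ν with hv
  have hv0 : 0 ≤ v := integral_nonneg fun x => sq_nonneg _
  have hiX : Integrable X ν :=
    Integrable.of_bound hX.aestronglyMeasurable B (ae_of_all _ fun x => by simpa using hB x)
  have hiX2 : Integrable (fun x => X x ^ 2) ν :=
    Integrable.of_bound (by fun_prop) (B ^ 2) (ae_of_all _ fun x => by
      simpa using pow_le_pow_left₀ (abs_nonneg _) (hB x) 2)
  have hie : Integrable (fun x => Complex.exp (Complex.I * ((s * X x : ℝ) : ℂ))) ν :=
    Integrable.of_bound (by fun_prop) 1 (ae_of_all _ fun x => by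
      rw [mul_comm, Complex.norm_exp_ofReal_mul_I])
  have hit : Integrable (fun x => (1 : ℂ) + Complex.I * ((s * X x : ℝ) : ℂ)
      - ((s * X x : ℝ) : ℂ) ^ 2 / 2) ν := by
    refine ((integrable_const _).add ((hiX.const_mul s).ofReal.const_mul _)).sub ?_
    have : Integrable (fun x => ((s ^ 2 / 2 * X x ^ 2 : ℝ) : ℂ)) ν := (hiX2.const_mul _).ofReal
    refine this.congr (ae_of_all _ fun x => ?_)
    push_cast; ring
  have hI : ∫ x, ((1 : ℂ) + Complex.I * ((s * X x : ℝ) : ℂ) - ((s * X x : ℝ) : ℂ) ^ 2 / 2) ∂ν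
      = ((1 - s ^ 2 * v / 2 : ℝ) : ℂ) := by
    have e : ∀ x, (1 : ℂ) + Complex.I * ((s * X x : ℝ) : ℂ) - ((s * X x : ℝ) : ℂ) ^ 2 / 2
        = ((1 - s ^ 2 / 2 * X x ^ 2 : ℝ) : ℂ) + Complex.I * ((s * X x : ℝ) : ℂ) := by
      intro x; push_cast; ring
    simp_rw [e]
    rw [integral_add, integral_const_mul, integral_complex_ofReal, integral_complex_ofReal,
      integral_const_mul, h0, integral_sub (integrable_const _) (hiX2.const_mul _),
      integral_const_mul, ← hv]
    · simp; ring
    · exact ((integrable_const _).sub (hiX2.const_mul _)).ofReal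
    · exact ((hiX.const_mul s).ofReal.const_mul _)
  have h1 : ‖∫ x, Complex.exp (Complex.I * ((s * X x : ℝ) : ℂ)) ∂ν
      - ((1 - s ^ 2 * v / 2 : ℝ) : ℂ)‖ ≤ 4 * |s| ^ 3 * B * v := by
    rw [← hI, ← integral_sub hie hit]
    calc _ ≤ ∫ x, 4 * |s| ^ 3 * B * X x ^ 2 ∂ν := by
          refine norm_integral_le_of_norm_le (hiX2.const_mul _) (ae_of_all _ fun x => ?_)
          refine (norm_cexp_sub_taylor_two_le (s * X x)).trans ?_
          rw [abs_mul, mul_pow, ← sq_abs (X x)]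
          have := hB x
          have h3 : |X x| ^ 3 ≤ B * |X x| ^ 2 := by
            rw [pow_succ']; gcongr
          calc 4 * (|s| ^ 3 * |X x| ^ 3) ≤ 4 * (|s| ^ 3 * (B * |X x| ^ 2)) := by gcongr
            _ = _ := by ring
      _ = _ := by rw [integral_const_mul]
  have h2 : ‖((1 - s ^ 2 * v / 2 : ℝ) : ℂ) - (Real.exp (-(s ^ 2 * v / 2)) : ℂ)‖
      ≤ s ^ 4 * v ^ 2 := by
    rw [← Complex.ofReal_sub, Complex.norm_real, norm_sub_rev]
    refine (abs_exp_neg_sub_one_add_le (by positivity)).trans ?_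
    have : 0 ≤ s ^ 4 * v ^ 2 := by positivity
    nlinarith
  calc _ ≤ _ := norm_sub_le_norm_sub_add_norm_sub _ ((1 - s ^ 2 * v / 2 : ℝ) : ℂ) _
    _ ≤ _ := add_le_add h1 h2

lemma norm_prod_sub_prod_le_sum {ι : Type*} (s : Finset ι) (f g : ι → ℂ)
    (hf : ∀ i ∈ s, ‖f i‖ ≤ 1) (hg : ∀ i ∈ s, ‖g i‖ ≤ 1) :
    ‖∏ i ∈ s, f i - ∏ i ∈ s, g i‖ ≤ ∑ i ∈ s, ‖f i - g i‖ := by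
  classical
  induction s using Finset.induction_on with
  | empty => simp
  | insert a s ha ih =>
    rw [Finset.prod_insert ha, Finset.prod_insert ha, Finset.sum_insert ha]
    have e : f a * ∏ i ∈ s, f i - g a * ∏ i ∈ s, g i
        = (f a - g a) * ∏ i ∈ s, f i + g a * (∏ i ∈ s, f i - ∏ i ∈ s, g i) := by ring
    rw [e]
    refine (norm_add_le _ _).trans (add_le_add ?_ ?_)
    · rw [norm_mul, norm_prod]
      refine mul_le_of_le_one_right (norm_nonneg _) (Finset.prod_le_one (fun _ _ => norm_nonneg _)
        fun i hi => hf i (Finset.mem_insert_of_mem hi))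
    · rw [norm_mul]
      refine (mul_le_of_le_one_left (norm_nonneg _) (hg a (Finset.mem_insert_self _ _))).trans
        (ih (fun i hi => hf i (Finset.mem_insert_of_mem hi))
          fun i hi => hg i (Finset.mem_insert_of_mem hi))

lemma abs_exp_neg_sub_exp_neg_le {x y : ℝ} (hx : 0 ≤ x) (hy : 0 ≤ y) :
    |Real.exp (-x) - Real.exp (-y)| ≤ |x - y| := by
  wlog hxy : x ≤ y generalizing x y
  · rw [abs_sub_comm, abs_sub_comm x y]; exact this hy hx (le_of_not_ge hxy)
  have h1 : Real.exp (-y) = Real.exp (-x) * Real.exp (-(y - x)) := by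
    rw [← Real.exp_add]; ring_nf
  have h2 : Real.exp (-x) ≤ 1 := Real.exp_le_one_iff.2 (by linarith)
  have h3 := Real.one_sub_le_exp_neg (y - x)
  have h4 : Real.exp (-y) ≤ Real.exp (-x) := Real.exp_le_exp.2 (by linarith)
  rw [abs_of_nonneg (by linarith), abs_sub_comm, abs_of_nonneg (by linarith), h1]
  have h5 : Real.exp (-(y - x)) ≤ 1 := Real.exp_le_one_iff.2 (by linarith)
  nlinarith [Real.exp_pos (-x)]

/-! ### Sums over dyads -/

/-- An unordered pair of distinct nodes, encoded by its increasing enumeration. -/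
abbrev Dyad := {p : ℕ × ℕ // p.1 < p.2}

/-- The dyads among the nodes `0, …, N - 1`. -/
def dyads (N : ℕ) : Finset Dyad :=
  (Finset.range N ×ˢ Finset.range N).subtype (fun p => p.1 < p.2)

lemma dyadSum_eq_sum_dyads (N : ℕ) (x : ℕ → ℕ → ℝ) :
    dyadSum N x = ∑ p ∈ dyads N, x p.1.1 p.1.2 := by
  unfold dyadSum dyads
  rw [Finset.sum_subtype_eq_sum_filter (p := fun p : ℕ × ℕ => p.1 < p.2)
    (fun p : ℕ × ℕ => x p.1 p.2), Finset.sum_filter, Finset.sum_product]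
  refine Finset.sum_congr rfl fun i _ => ?_
  rw [← Finset.sum_filter]
  refine Finset.sum_congr ?_ fun _ _ => rfl
  ext j
  simp [and_comm]

lemma dyadSum_succ (N : ℕ) (x : ℕ → ℕ → ℝ) :
    dyadSum (N + 1) x = dyadSum N x + ∑ i ∈ Finset.range N, x i N := by
  unfold dyadSum
  rw [Finset.sum_range_succ, ← Finset.sum_add_distrib]
  have : Finset.Ioo N (N + 1) = ∅ := by ext; simp
  rw [this, Finset.sum_empty, add_zero]
  refine Finset.sum_congr rfl fun i hi => ?_
  have hi := Finset.mem_range.1 hi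
  have : Finset.Ioo i (N + 1) = insert N (Finset.Ioo i N) := by
    ext; simp; omega
  rw [this, Finset.sum_insert (by simp), add_comm]

lemma dyadSum_add_endpoints (N : ℕ) (x : ℕ → ℝ) :
    dyadSum N (fun i j => x i + x j) = ((N : ℝ) - 1) * ∑ i ∈ Finset.range N, x i := by
  induction N with
  | zero => simp [dyadSum]
  | succ N ih =>
    rw [dyadSum_succ, ih, Finset.sum_range_succ, Finset.sum_add_distrib]
    simp
    ring

lemma numDyads_eq (N : ℕ) : numDyads N = (N : ℝ) * (N - 1) / 2 := by
  unfold numDyads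
  exact Nat.cast_choose_two ℝ N

lemma dyadSum_const (N : ℕ) (c : ℝ) : dyadSum N (fun _ _ => c) = numDyads N * c := by
  have h := dyadSum_add_endpoints N (fun _ => c / 2)
  simp only [add_halves, Finset.sum_const, Finset.card_range, nsmul_eq_mul] at h
  rw [h, numDyads_eq]; ring

lemma card_dyads (N : ℕ) : ((dyads N).card : ℝ) = numDyads N := by
  have := dyadSum_const N 1
  rw [dyadSum_eq_sum_dyads] at this
  simpa using this

/-! ### Integrating out independent variables -/

lemma integral_comp_prodMk_of_indepFun {Ω S T E : Type*} [MeasurableSpace Ω] [MeasurableSpace S]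
    [MeasurableSpace T] [NormedAddCommGroup E] [NormedSpace ℝ E] {μ : Measure Ω}
    [IsProbabilityMeasure μ]
    {Y : Ω → S} {Z : Ω → T} (hind : IndepFun Y Z μ) (hY : Measurable Y) (hZ : Measurable Z)
    {F : S × T → E} (hF : StronglyMeasurable F) {B : ℝ} (hB : ∀ x, ‖F x‖ ≤ B) :
    ∫ ω, F (Y ω, Z ω) ∂μ = ∫ ω, ∫ z, F (Y ω, z) ∂(μ.map Z) ∂μ := by
  have hp : IsProbabilityMeasure (μ.map Z) := Measure.isProbabilityMeasure_map hZ.aemeasurable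
  have hp' : IsProbabilityMeasure (μ.map Y) := Measure.isProbabilityMeasure_map hY.aemeasurable
  have h := (indepFun_iff_map_prod_eq_prod_map_map hY.aemeasurable hZ.aemeasurable).1 hind
  rw [← integral_map (φ := fun ω => (Y ω, Z ω)) (hY.prodMk hZ).aemeasurable
    hF.aestronglyMeasurable, h, integral_prod]
  · rw [integral_map hY.aemeasurable]
    exact (hF.integral_prod_right' (ν := μ.map Z)).aestronglyMeasurable
  · exact Integrable.of_bound hF.aestronglyMeasurable B (ae_of_all _ hB)

/-- Second moment of a sum of pairwise orthogonal random variables. -/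
lemma integral_sq_sum_of_orthogonal {Ω ι : Type*} [MeasurableSpace Ω] {μ : Measure Ω}
    (s : Finset ι) (X : ι → Ω → ℝ)
    (hint : ∀ p ∈ s, ∀ q ∈ s, Integrable (fun ω => X p ω * X q ω) μ)
    (horth : ∀ p ∈ s, ∀ q ∈ s, p ≠ q → ∫ ω, X p ω * X q ω ∂μ = 0) :
    ∫ ω, (∑ p ∈ s, X p ω) ^ 2 ∂μ = ∑ p ∈ s, ∫ ω, X p ω ^ 2 ∂μ := by
  classical
  simp_rw [sq, Finset.sum_mul_sum]
  rw [integral_finsetSum _ fun p hp => integrable_finsetSum _ fun q hq => hint p hp q hq]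
  refine Finset.sum_congr rfl fun p hp => ?_
  rw [integral_finsetSum _ fun q hq => hint p hp q hq]
  rw [Finset.sum_eq_single p]
  · exact fun q hq hqp => horth p hp q hq (Ne.symm hqp)
  · exact fun h => absurd hp h

lemma integral_abs_le_sqrt_integral_sq {Ω : Type*} [MeasurableSpace Ω] {μ : Measure Ω}
    [IsProbabilityMeasure μ] {Y : Ω → ℝ} (hY : MemLp Y 2 μ) :
    ∫ ω, |Y ω| ∂μ ≤ Real.sqrt (∫ ω, Y ω ^ 2 ∂μ) := by
  refine Real.le_sqrt_of_sq_le ?_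
  have h := variance_eq_sub (μ := μ) (X := fun ω => |Y ω|) hY.abs
  have h0 := variance_nonneg (fun ω => |Y ω|) μ
  have e : ∫ ω, ((fun ω => |Y ω|) ^ 2) ω ∂μ = ∫ ω, Y ω ^ 2 ∂μ := by
    simp [Pi.pow_apply, sq_abs]
  rw [e] at h
  linarith

section UStatistics

variable {Ω : Type*} [MeasurableSpace Ω] {μ : Measure Ω} [IsProbabilityMeasure μ]
  {𝔸 : Type*} [MeasurableSpace 𝔸] {A : ℕ → Ω → 𝔸} {P : Measure 𝔸}

omit [IsProbabilityMeasure μ] in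
lemma indepFun_triple (hAi : iIndepFun A μ) (hA : ∀ i, Measurable (A i)) {i j k l : ℕ}
    (hi : i ≠ j) (hk : k ≠ j) (hl : l ≠ j) :
    IndepFun (fun ω => (A i ω, A k ω, A l ω)) (A j) μ := by
  have h := hAi.indepFun_finset {i, k, l} {j} 
    (by simp [Ne.symm hi, Ne.symm hk, Ne.symm hl]) hA
  have hψ : Measurable (fun x : ({j} : Finset ℕ) → 𝔸 => x ⟨j, by simp⟩) := measurable_pi_apply _
  have := h.comp (φ := fun x : ({i, k, l} : Finset ℕ) → 𝔸 =>
      (x ⟨i, by simp⟩, x ⟨k, by simp⟩, x ⟨l, by simp⟩))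
    (ψ := fun x : ({j} : Finset ℕ) → 𝔸 => x ⟨j, by simp⟩)
    (by fun_prop) hψ
  exact this

lemma integral_pair (hAi : iIndepFun A μ) (hA : ∀ i, Measurable (A i))
    (hP : ∀ i, μ.map (A i) = P) {i j : ℕ} (hij : i ≠ j) {F : 𝔸 → 𝔸 → ℝ}
    (hF : Measurable (Function.uncurry F)) {B : ℝ} (hB : ∀ a b, |F a b| ≤ B) :
    ∫ ω, F (A i ω) (A j ω) ∂μ = ∫ a, ∫ b, F a b ∂P ∂P := by
  have hp : IsProbabilityMeasure P := hP 0 ▸ Measure.isProbabilityMeasure_map (hA 0).aemeasurable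
  have h := integral_comp_prodMk_of_indepFun (hAi.indepFun hij) (hA i) (hA j)
    (F := Function.uncurry F) hF.stronglyMeasurable (B := B) (fun x => hB x.1 x.2)
  simp only [Function.uncurry_apply_pair, hP] at h
  rw [h, ← hP i, integral_map (hA i).aemeasurable]
  exact (hF.stronglyMeasurable.integral_prod_right (ν := μ.map (A i))).aestronglyMeasurable

omit [IsProbabilityMeasure μ] in
lemma integral_single (hA : ∀ i, Measurable (A i)) (hP : ∀ i, μ.map (A i) = P) (i : ℕ)
    {F : 𝔸 → ℝ} (hF : Measurable F) : ∫ ω, F (A i ω) ∂μ = ∫ a, F a ∂P := by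
  rw [← hP i, integral_map (hA i).aemeasurable hF.aestronglyMeasurable]

lemma integral_mul_eq_zero_of_degenerate (hAi : iIndepFun A μ) (hA : ∀ i, Measurable (A i))
    (hP : ∀ i, μ.map (A i) = P) {i j k l : ℕ} (hi : i ≠ j) (hk : k ≠ j) (hl : l ≠ j)
    {ζ ψ : 𝔸 → 𝔸 → ℝ} (hζ : Measurable (Function.uncurry ζ)) (hψ : Measurable (Function.uncurry ψ))
    {B B' : ℝ} (hB : ∀ a b, |ζ a b| ≤ B) (hB' : ∀ a b, |ψ a b| ≤ B')
    (h0 : ∀ a, ∫ b, ζ a b ∂P = 0) :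
    ∫ ω, ζ (A i ω) (A j ω) * ψ (A k ω) (A l ω) ∂μ = 0 := by
  have h := integral_comp_prodMk_of_indepFun (indepFun_triple hAi hA hi hk hl)
    (by have := hA i; have := hA k; have := hA l; fun_prop) (hA j)
    (F := fun x : (𝔸 × 𝔸 × 𝔸) × 𝔸 => ζ x.1.1 x.2 * ψ x.1.2.1 x.1.2.2)
    (by
      refine Measurable.stronglyMeasurable (Measurable.mul ?_ ?_)
      · exact hζ.comp (g := Function.uncurry ζ) (f := fun x : (𝔸 × 𝔸 × 𝔸) × 𝔸 => (x.1.1, x.2))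
          (by fun_prop)
      · exact hψ.comp (g := Function.uncurry ψ)
          (f := fun x : (𝔸 × 𝔸 × 𝔸) × 𝔸 => (x.1.2.1, x.1.2.2)) (by fun_prop))
    (B := B * B') (fun x => by
      rw [norm_mul]
      exact mul_le_mul (hB _ _) (hB' _ _) (norm_nonneg _) ((abs_nonneg _).trans (hB x.1.1 x.1.1)))
  rw [h]
  simp [integral_mul_const, hP, h0]

/-- The terms of a degenerate U-statistic are orthogonal: of two different dyads, one has an
endpoint outside the other, and integrating it out gives zero. -/
lemma integral_sq_degenerate_sum_le (hAi : iIndepFun A μ) (hA : ∀ i, Measurable (A i))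
    (hP : ∀ i, μ.map (A i) = P) {ζ : 𝔸 → 𝔸 → ℝ} (hζ : Measurable (Function.uncurry ζ))
    (hsymm : ∀ a b, ζ a b = ζ b a) {B : ℝ} (hB : ∀ a b, |ζ a b| ≤ B)
    (h0 : ∀ a, ∫ b, ζ a b ∂P = 0) (N : ℕ) :
    ∫ ω, (∑ p ∈ dyads N, ζ (A p.1.1 ω) (A p.1.2 ω)) ^ 2 ∂μ ≤ numDyads N * B ^ 2 := by
  have hm : ∀ i j, Measurable (fun ω => ζ (A i ω) (A j ω)) := fun i j =>
    hζ.comp (g := Function.uncurry ζ) ((hA i).prodMk (hA j))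
  have hB0 : ∀ ω : Ω, 0 ≤ B := fun ω => (abs_nonneg _).trans (hB (A 0 ω) (A 0 ω))
  rw [integral_sq_sum_of_orthogonal]
  · rw [← card_dyads, ← nsmul_eq_mul]
    refine Finset.sum_le_card_nsmul _ _ _ fun p _ => ?_
    refine (integral_mono_of_nonneg (ae_of_all _ fun _ => sq_nonneg _) (integrable_const (B ^ 2))
      (ae_of_all _ fun ω => ?_)).trans (by simp)
    exact sq_le_sq.2 ((hB _ _).trans (le_abs_self _))
  · intro p _ q _
    refine Integrable.of_bound ((hm _ _).mul (hm _ _)).aestronglyMeasurable (B * B)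
      (ae_of_all _ fun ω => ?_)
    rw [norm_mul]
    exact mul_le_mul (hB _ _) (hB _ _) (norm_nonneg _) (hB0 ω)
  · rintro ⟨⟨i, j⟩, hij⟩ _ ⟨⟨k, l⟩, hkl⟩ _ hpq
    simp only [ne_eq, Subtype.mk.injEq, Prod.mk.injEq] at hpq hij hkl ⊢
    by_cases hj : k ≠ j ∧ l ≠ j
    · exact integral_mul_eq_zero_of_degenerate hAi hA hP hij.ne hj.1 hj.2 hζ hζ hB hB h0
    · have hi : k ≠ i ∧ l ≠ i := by
        constructor <;> rintro rfl <;> omega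
      simp_rw [hsymm (A i _) (A j _)]
      exact integral_mul_eq_zero_of_degenerate hAi hA hP hij.ne' hi.1 hi.2 hζ hζ hB hB h0

/-- The completely degenerate part `u(a, b) - U(a) - U(b) + ū` in Hoeffding's decomposition of
a symmetric function `u` of two independent variables with law `P`, where `U` is the conditional
mean of `u` given one variable and `ū` the mean of `u`. -/
noncomputable def degeneratePart (P : Measure 𝔸) (u : 𝔸 → 𝔸 → ℝ) (a b : 𝔸) : ℝ :=
  u a b - ∫ c, u a c ∂P - ∫ c, u b c ∂P + ∫ c, ∫ d, u c d ∂P ∂P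

section degeneratePart

variable [IsProbabilityMeasure P] {u : 𝔸 → 𝔸 → ℝ} {B : ℝ}

lemma measurable_integral_right (hu : Measurable (Function.uncurry u)) :
    Measurable (fun a => ∫ c, u a c ∂P) :=
  (hu.stronglyMeasurable.integral_prod_right (ν := P)).measurable

lemma abs_integral_le_of_abs_le {f : 𝔸 → ℝ} (hB : ∀ a, |f a| ≤ B) : |∫ c, f c ∂P| ≤ B := by
  have := norm_integral_le_of_norm_le_const (μ := P) (f := f) (C := B) (ae_of_all _ hB)
  simpa using this

lemma measurable_degeneratePart (hu : Measurable (Function.uncurry u)) :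
    Measurable (Function.uncurry (degeneratePart P u)) := by
  have h := measurable_integral_right (P := P) hu
  unfold degeneratePart
  exact ((hu.sub (h.comp measurable_fst)).sub (h.comp measurable_snd)).add_const _

lemma abs_degeneratePart_le (hB : ∀ a b, |u a b| ≤ B) (a b : 𝔸) :
    |degeneratePart P u a b| ≤ 4 * B := by
  have h1 : ∀ a, |∫ c, u a c ∂P| ≤ B := fun a => abs_integral_le_of_abs_le (hB a)
  have h2 : |∫ c, ∫ d, u c d ∂P ∂P| ≤ B := abs_integral_le_of_abs_le h1
  have := abs_le.1 (hB a b); have := abs_le.1 (h1 a); have := abs_le.1 (h1 b); have := abs_le.1 h2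
  unfold degeneratePart
  rw [abs_le]; constructor <;> linarith

omit [IsProbabilityMeasure P] in
lemma degeneratePart_symm (hsymm : ∀ a b, u a b = u b a) (a b : 𝔸) :
    degeneratePart P u a b = degeneratePart P u b a := by
  unfold degeneratePart
  rw [hsymm a b]; ring

lemma integral_degeneratePart (hu : Measurable (Function.uncurry u)) (hB : ∀ a b, |u a b| ≤ B)
    (a : 𝔸) : ∫ b, degeneratePart P u a b ∂P = 0 := by
  have h := measurable_integral_right (P := P) hu
  have i1 : Integrable (fun b => u a b) P :=
    Integrable.of_bound (hu.comp measurable_prodMk_left).aestronglyMeasurable B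
      (ae_of_all _ fun b => hB a b)
  have i2 : Integrable (fun b => ∫ c, u b c ∂P) P :=
    Integrable.of_bound h.aestronglyMeasurable B
      (ae_of_all _ fun b => abs_integral_le_of_abs_le (hB b))
  have i3 : Integrable (fun b => u a b - ∫ c, u a c ∂P) P := i1.sub (integrable_const _)
  have i4 : Integrable (fun b => u a b - ∫ c, u a c ∂P - ∫ c, u b c ∂P) P := i3.sub i2
  unfold degeneratePart
  rw [integral_add i4 (integrable_const _), integral_sub i3 i2,
    integral_sub i1 (integrable_const _)]
  simp

end degeneratePart

/-- Hoeffding's decomposition of a sum over dyads. -/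
lemma sum_dyads_eq_hoeffding (u : 𝔸 → 𝔸 → ℝ) (x : ℕ → 𝔸) (N : ℕ) :
    ∑ p ∈ dyads N, u (x p.1.1) (x p.1.2)
      = ∑ p ∈ dyads N, degeneratePart P u (x p.1.1) (x p.1.2)
        + ((N : ℝ) - 1) * ∑ i ∈ Finset.range N,
          (∫ c, u (x i) c ∂P - ∫ c, ∫ d, u c d ∂P ∂P) + numDyads N * ∫ c, ∫ d, u c d ∂P ∂P := by
  set m := ∫ c, ∫ d, u c d ∂P ∂P with hm
  have h1 := dyadSum_add_endpoints N (fun i => ∫ c, u (x i) c ∂P - m)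
  have h2 := dyadSum_const N m
  rw [dyadSum_eq_sum_dyads] at h1 h2
  rw [← h1, ← h2, ← Finset.sum_add_distrib, ← Finset.sum_add_distrib]
  refine Finset.sum_congr rfl fun p _ => ?_
  unfold degeneratePart
  rw [← hm]; ring

lemma integral_sq_sum_iid (hAi : iIndepFun A μ) (hA : ∀ i, Measurable (A i))
    (hP : ∀ i, μ.map (A i) = P) {η : 𝔸 → ℝ} (hη : Measurable η) {B : ℝ} (hB : ∀ a, |η a| ≤ B)
    (h0 : ∫ a, η a ∂P = 0) (N : ℕ) :
    ∫ ω, (∑ i ∈ Finset.range N, η (A i ω)) ^ 2 ∂μ = N * ∫ a, η a ^ 2 ∂P := by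
  have hB0 : ∀ ω : Ω, 0 ≤ B := fun ω => (abs_nonneg _).trans (hB (A 0 ω))
  rw [integral_sq_sum_of_orthogonal]
  · simp_rw [integral_single hA hP _ (hη.pow_const 2)]
    simp
  · intro p _ q _
    refine Integrable.of_bound ((hη.comp (hA p)).mul (hη.comp (hA q))).aestronglyMeasurable (B * B)
      (ae_of_all _ fun ω => ?_)
    rw [norm_mul]
    exact mul_le_mul (hB _) (hB _) (norm_nonneg _) (hB0 ω)
  · intro p _ q _ hpq
    have := ((hAi.indepFun hpq).comp hη hη).integral_fun_mul_eq_mul_integral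
      (hη.comp (hA p)).aestronglyMeasurable (hη.comp (hA q)).aestronglyMeasurable
    refine this.trans ?_
    simp only [Function.comp_apply]
    rw [integral_single hA hP _ hη, h0, zero_mul]

/-- Law of large numbers in `L²` for a symmetric U-statistic of order two. -/
lemma integral_sq_sum_sub_mean_le (hAi : iIndepFun A μ) (hA : ∀ i, Measurable (A i))
    (hP : ∀ i, μ.map (A i) = P) {u : 𝔸 → 𝔸 → ℝ} (hu : Measurable (Function.uncurry u))
    (hsymm : ∀ a b, u a b = u b a) {B : ℝ} (hB : ∀ a b, |u a b| ≤ B) (N : ℕ) :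
    ∫ ω, (∑ p ∈ dyads N, u (A p.1.1 ω) (A p.1.2 ω)
      - numDyads N * ∫ c, ∫ d, u c d ∂P ∂P) ^ 2 ∂μ ≤ 24 * B ^ 2 * (N : ℝ) ^ 3 := by
  rcases N.eq_zero_or_pos with rfl | hN
  · have : dyads 0 = ∅ := by simp [dyads, Finset.subtype_eq_empty]
    simp [this, numDyads]
  have hp : IsProbabilityMeasure P := hP 0 ▸ Measure.isProbabilityMeasure_map (hA 0).aemeasurable
  set m := ∫ c, ∫ d, u c d ∂P ∂P with hm
  set U : 𝔸 → ℝ := fun a => ∫ c, u a c ∂P with hU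
  have hUm : Measurable U := measurable_integral_right hu
  have hUB : ∀ a, |U a| ≤ B := fun a => abs_integral_le_of_abs_le (hB a)
  have hmB : |m| ≤ B := abs_integral_le_of_abs_le hUB
  have hηB : ∀ a, |U a - m| ≤ 2 * B := fun a => by
    have := abs_le.1 (hUB a); have := abs_le.1 hmB
    rw [abs_le]; constructor <;> linarith
  have hη0 : ∫ a, (U a - m) ∂P = 0 := by
    rw [integral_sub (Integrable.of_bound hUm.aestronglyMeasurable B (ae_of_all _ hUB))
      (integrable_const _)]
    simp [hm, hU]
  have e1 := integral_sq_degenerate_sum_le hAi hA hP (measurable_degeneratePart (P := P) hu)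
    (degeneratePart_symm hsymm) (abs_degeneratePart_le hB) (integral_degeneratePart hu hB) N
  have e2 := integral_sq_sum_iid hAi hA hP (hUm.sub_const m) hηB hη0 N
  have e3 : ∫ a, (U a - m) ^ 2 ∂P ≤ (2 * B) ^ 2 := by
    refine (integral_mono_of_nonneg (ae_of_all _ fun _ => sq_nonneg _) (integrable_const _)
      (ae_of_all _ fun a => sq_le_sq.2 ((hηB a).trans (le_abs_self _)))).trans (by simp)
  set X : Ω → ℝ := fun ω => ∑ p ∈ dyads N, degeneratePart P u (A p.1.1 ω) (A p.1.2 ω) with hX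
  set Y : Ω → ℝ := fun ω => ∑ i ∈ Finset.range N, (U (A i ω) - m) with hY
  have hXm : Measurable X := Finset.measurable_sum _ fun p _ =>
    (measurable_degeneratePart (P := P) hu).comp (g := Function.uncurry (degeneratePart P u))
      ((hA p.1.1).prodMk (hA p.1.2))
  have hYm : Measurable Y := Finset.measurable_sum _ fun i _ => (hUm.comp (hA i)).sub_const m
  have hXb : ∀ ω, |X ω| ≤ ∑ p ∈ dyads N, 4 * B := fun ω =>
    (Finset.abs_sum_le_sum_abs _ _).trans (Finset.sum_le_sum fun p _ =>
      abs_degeneratePart_le hB _ _)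
  have hYb : ∀ ω, |Y ω| ≤ ∑ i ∈ Finset.range N, 2 * B := fun ω =>
    (Finset.abs_sum_le_sum_abs _ _).trans (Finset.sum_le_sum fun p _ => hηB _)
  have iX : Integrable (fun ω => X ω ^ 2) μ := Integrable.of_bound (by fun_prop) _
    (ae_of_all _ fun ω => by
      rw [norm_pow]; exact pow_le_pow_left₀ (norm_nonneg _) (hXb ω) 2)
  have iY : Integrable (fun ω => Y ω ^ 2) μ := Integrable.of_bound (by fun_prop) _
    (ae_of_all _ fun ω => by
      rw [norm_pow]; exact pow_le_pow_left₀ (norm_nonneg _) (hYb ω) 2)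
  have hN1 : (1 : ℝ) ≤ N := by exact_mod_cast hN
  calc ∫ ω, (∑ p ∈ dyads N, u (A p.1.1 ω) (A p.1.2 ω) - numDyads N * m) ^ 2 ∂μ
      ≤ ∫ ω, (2 * X ω ^ 2 + 2 * ((N : ℝ) - 1) ^ 2 * Y ω ^ 2) ∂μ := by
        refine integral_mono_of_nonneg (ae_of_all _ fun _ => sq_nonneg _)
          ((iX.const_mul 2).add (iY.const_mul _)) (ae_of_all _ fun ω => ?_)
        have e := sum_dyads_eq_hoeffding (P := P) u (fun i => A i ω) N
        simp only
        rw [e, ← hm]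
        change (X ω + ((N : ℝ) - 1) * Y ω + numDyads N * m - numDyads N * m) ^ 2 ≤ _
        nlinarith [sq_nonneg (X ω - ((N : ℝ) - 1) * Y ω)]
    _ = 2 * ∫ ω, X ω ^ 2 ∂μ + 2 * ((N : ℝ) - 1) ^ 2 * ∫ ω, Y ω ^ 2 ∂μ := by
        rw [integral_add (iX.const_mul 2) (iY.const_mul _), integral_const_mul, integral_const_mul]
    _ ≤ 2 * (numDyads N * (4 * B) ^ 2) + 2 * ((N : ℝ) - 1) ^ 2 * (N * (2 * B) ^ 2) := by
        rw [e2]; gcongr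
    _ = B ^ 2 * (8 * N * (N - 1) * (N + 1)) := by rw [numDyads_eq]; ring
    _ ≤ B ^ 2 * (24 * (N : ℝ) ^ 3) := by
        have : 8 * (N : ℝ) * (N - 1) * (N + 1) ≤ 24 * (N : ℝ) ^ 3 := by
          nlinarith [pow_pos (zero_lt_one.trans_le hN1) 3]
        gcongr
    _ = _ := by ring

end UStatistics

/-! ### Conditioning on the attributes -/

namespace Model

variable {Ω : Type*} [MeasurableSpace Ω] {μ : Measure Ω} {𝔸 : Type*} [MeasurableSpace 𝔸]

/-- The common law of the attributes. -/
noncomputable def attrLaw (D : Model μ 𝔸) : Measure 𝔸 := μ.map (D.A 0)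

/-- The common law of the dyad errors. -/
noncomputable def errLaw (D : Model μ 𝔸) : Measure ℝ :=
  volume.withDensity (fun v => ENNReal.ofReal (D.fV v))

lemma map_A (D : Model μ 𝔸) (i : ℕ) : μ.map (D.A i) = D.attrLaw := (D.identDistrib_A i).map_eq

lemma measurable_V_dyad (D : Model μ 𝔸) (p : Dyad) : Measurable (D.V p.1.1 p.1.2) :=
  D.measurable_V _ _ p.2.ne

variable [IsProbabilityMeasure μ]

instance (D : Model μ 𝔸) : IsProbabilityMeasure D.attrLaw :=
  Measure.isProbabilityMeasure_map (D.measurable_A 0).aemeasurable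

instance (D : Model μ 𝔸) : IsProbabilityMeasure D.errLaw := by
  unfold errLaw
  rw [← D.law_V 0 1 zero_ne_one]
  exact Measure.isProbabilityMeasure_map (D.measurable_V 0 1 zero_ne_one).aemeasurable

/-- Given the attributes, the errors are independent with law `D.errLaw`. -/
lemma integral_mul_prod_errors {𝕜 : Type*} [RCLike 𝕜] (D : Model μ 𝔸) (s : Finset Dyad)
    {Φ : (ℕ → 𝔸) → 𝕜} (hΦ : Measurable Φ) {C : ℝ} (hC : ∀ x, ‖Φ x‖ ≤ C)
    {ψ : Dyad → (ℕ → 𝔸) → ℝ → 𝕜} (hψ : ∀ p, Measurable (Function.uncurry (ψ p)))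
    {B : ℝ} (hB : ∀ p x v, ‖ψ p x v‖ ≤ B) :
    ∫ ω, Φ (fun i => D.A i ω) * ∏ p ∈ s, ψ p (fun i => D.A i ω) (D.V p.1.1 p.1.2 ω) ∂μ
      = ∫ ω, Φ (fun i => D.A i ω) * ∏ p ∈ s, ∫ v, ψ p (fun i => D.A i ω) v ∂D.errLaw ∂μ := by
  have hY : Measurable (fun ω i => D.A i ω) := measurable_pi_lambda _ D.measurable_A
  have hZ : Measurable (fun ω (p : Dyad) => D.V p.1.1 p.1.2 ω) :=
    measurable_pi_lambda _ D.measurable_V_dyad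
  have hF : Measurable (fun y : (ℕ → 𝔸) × (Dyad → ℝ) => Φ y.1 * ∏ p ∈ s, ψ p y.1 (y.2 p)) := by
    refine (hΦ.comp measurable_fst).mul (Finset.measurable_prod _ fun p _ => ?_)
    exact (hψ p).comp (f := fun y : (ℕ → 𝔸) × (Dyad → ℝ) => (y.1, y.2 p)) (by fun_prop)
  have h := integral_comp_prodMk_of_indepFun D.indepFun_A_V hY hZ hF.stronglyMeasurable
    (B := C * ∏ p ∈ s, B) (fun y => by
      rw [norm_mul]
      refine mul_le_mul (hC _) ?_ (norm_nonneg _) ((norm_nonneg _).trans (hC y.1))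
      rw [norm_prod]
      exact Finset.prod_le_prod (fun _ _ => norm_nonneg _) fun p _ => hB _ _ _)
  rw [h]
  refine integral_congr_ae (ae_of_all _ fun ω => ?_)
  simp only
  set x : ℕ → 𝔸 := fun i => D.A i ω
  have hx : ∀ p, Measurable (ψ p x) := fun p => (hψ p).comp measurable_prodMk_left
  rw [integral_const_mul]
  congr 1
  rw [integral_map hZ.aemeasurable]
  · have hind := D.iIndepFun_V.precomp (g := ((↑) : s → Dyad)) Subtype.val_injective
    have h2 := hind.integral_fun_prod_comp (f := fun p : s => ψ p x)
      (fun p => (D.measurable_V_dyad p).aemeasurable)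
      (fun p => (hx p).aestronglyMeasurable)
    rw [← Finset.prod_coe_sort s]
    refine Eq.trans (integral_congr_ae (ae_of_all _ fun ω' => ?_)) (h2.trans ?_)
    · exact (Finset.prod_coe_sort s fun p => ψ p x (D.V p.1.1 p.1.2 ω')).symm
    · refine Finset.prod_congr rfl fun p _ => ?_
      have := integral_map (D.measurable_V_dyad p).aemeasurable
        (f := ψ p x) (μ := μ) (hx p).aestronglyMeasurable
      rw [← this, D.law_V _ _ p.1.2.ne]
      rfl
  · refine Measurable.aestronglyMeasurable (Finset.measurable_prod _ fun p _ => ?_)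
    exact (hx p).comp (measurable_pi_apply p)

variable (D : Model μ 𝔸)

/-- A single dyad error may be integrated out against any function of the attributes. -/
lemma integral_mul_error {Φ : (ℕ → 𝔸) → ℝ} (hΦ : Measurable Φ) {C : ℝ} (hC : ∀ x, |Φ x| ≤ C)
    {ξ : 𝔸 → 𝔸 → ℝ → ℝ} (hξ : Measurable (fun x : 𝔸 × 𝔸 × ℝ => ξ x.1 x.2.1 x.2.2))
    {B : ℝ} (hB : ∀ a b v, |ξ a b v| ≤ B) (p : Dyad) :
    ∫ ω, Φ (fun i => D.A i ω) * ξ (D.A p.1.1 ω) (D.A p.1.2 ω) (D.V p.1.1 p.1.2 ω) ∂μ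
      = ∫ ω, Φ (fun i => D.A i ω) * ∫ v, ξ (D.A p.1.1 ω) (D.A p.1.2 ω) v ∂D.errLaw ∂μ := by
  have h := D.integral_mul_prod_errors {p} hΦ hC
    (ψ := fun p x v => ξ (x p.1.1) (x p.1.2) v)
    (fun p => hξ.comp (f := fun y : (ℕ → 𝔸) × ℝ => (y.1 p.1.1, y.1 p.1.2, y.2)) (by fun_prop))
    (fun p x v => hB _ _ _)
  simpa using h

lemma integral_mul_error_error {ξ : 𝔸 → 𝔸 → ℝ → ℝ}
    (hξ : Measurable (fun x : 𝔸 × 𝔸 × ℝ => ξ x.1 x.2.1 x.2.2))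
    {B : ℝ} (hB : ∀ a b v, |ξ a b v| ≤ B) (h0 : ∀ a b, ∫ v, ξ a b v ∂D.errLaw = 0)
    {p q : Dyad} (hpq : p ≠ q) :
    ∫ ω, ξ (D.A p.1.1 ω) (D.A p.1.2 ω) (D.V p.1.1 p.1.2 ω)
      * ξ (D.A q.1.1 ω) (D.A q.1.2 ω) (D.V q.1.1 q.1.2 ω) ∂μ = 0 := by
  classical
  have h := D.integral_mul_prod_errors {p, q} (Φ := fun _ => (1 : ℝ)) measurable_const (C := 1)
    (fun x => by simp)
    (ψ := fun p x v => ξ (x p.1.1) (x p.1.2) v)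
    (fun p => hξ.comp (f := fun y : (ℕ → 𝔸) × ℝ => (y.1 p.1.1, y.1 p.1.2, y.2)) (by fun_prop))
    (fun p x v => hB _ _ _)
  simpa [Finset.prod_pair hpq, h0] using h

/-! ### Linear combinations of dyad errors and attribute effects -/

section Combination

variable {ξ : 𝔸 → 𝔸 → ℝ → ℝ} {η : 𝔸 → ℝ} {B₁ B₂ : ℝ}

/-- The sum `∑_{i < j} ξ(A_i, A_j, V_ij)` over the dyads among `N` nodes. -/
noncomputable def errSum (ξ : 𝔸 → 𝔸 → ℝ → ℝ) (N : ℕ) (ω : Ω) : ℝ :=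
  ∑ p ∈ dyads N, ξ (D.A p.1.1 ω) (D.A p.1.2 ω) (D.V p.1.1 p.1.2 ω)

/-- The sum `∑_i η(A_i)` over `N` nodes. -/
noncomputable def attrSum (η : 𝔸 → ℝ) (N : ℕ) (ω : Ω) : ℝ :=
  ∑ i ∈ Finset.range N, η (D.A i ω)

omit [IsProbabilityMeasure μ] in
lemma measurable_err_term (hξ : Measurable (fun x : 𝔸 × 𝔸 × ℝ => ξ x.1 x.2.1 x.2.2)) (p : Dyad) :
    Measurable fun ω => ξ (D.A p.1.1 ω) (D.A p.1.2 ω) (D.V p.1.1 p.1.2 ω) :=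
  hξ.comp (f := fun ω => (D.A p.1.1 ω, D.A p.1.2 ω, D.V p.1.1 p.1.2 ω))
    ((D.measurable_A _).prodMk ((D.measurable_A _).prodMk (D.measurable_V _ _ p.2.ne)))

omit [IsProbabilityMeasure μ] in
lemma measurable_errSum (hξ : Measurable (fun x : 𝔸 × 𝔸 × ℝ => ξ x.1 x.2.1 x.2.2)) (N : ℕ) :
    Measurable (D.errSum ξ N) :=
  Finset.measurable_sum _ fun p _ => D.measurable_err_term hξ p

omit [IsProbabilityMeasure μ] in
lemma measurable_attrSum (hη : Measurable η) (N : ℕ) : Measurable (D.attrSum η N) :=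
  Finset.measurable_sum _ fun i _ => hη.comp (D.measurable_A i)

omit [IsProbabilityMeasure μ] in
lemma abs_errSum_le (hB₁ : ∀ a b v, |ξ a b v| ≤ B₁) (N : ℕ) (ω : Ω) :
    |D.errSum ξ N ω| ≤ ∑ _p ∈ dyads N, B₁ :=
  (Finset.abs_sum_le_sum_abs _ _).trans (Finset.sum_le_sum fun _ _ => hB₁ _ _ _)

omit [IsProbabilityMeasure μ] in
lemma abs_attrSum_le (hB₂ : ∀ a, |η a| ≤ B₂) (N : ℕ) (ω : Ω) :
    |D.attrSum η N ω| ≤ ∑ _i ∈ Finset.range N, B₂ :=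
  (Finset.abs_sum_le_sum_abs _ _).trans (Finset.sum_le_sum fun _ _ => hB₂ _)

/-- The conditional second moment of a dyad term given its two attributes. It is used for terms
with conditional mean zero, where it is the conditional variance. -/
noncomputable def errVar (ξ : 𝔸 → 𝔸 → ℝ → ℝ) (a b : 𝔸) : ℝ := ∫ v, ξ a b v ^ 2 ∂D.errLaw

lemma measurable_integral_err (hξ : Measurable (fun x : 𝔸 × 𝔸 × ℝ => ξ x.1 x.2.1 x.2.2)) :
    Measurable (Function.uncurry fun a b => ∫ v, ξ a b v ∂D.errLaw) := by
  have : Measurable (Function.uncurry fun (x : 𝔸 × 𝔸) v => ξ x.1 x.2 v) :=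
    hξ.comp (f := fun y : (𝔸 × 𝔸) × ℝ => (y.1.1, y.1.2, y.2)) (by fun_prop)
  exact (this.stronglyMeasurable.integral_prod_right (ν := D.errLaw)).measurable

lemma measurable_errVar (hξ : Measurable (fun x : 𝔸 × 𝔸 × ℝ => ξ x.1 x.2.1 x.2.2)) :
    Measurable (Function.uncurry (D.errVar ξ)) :=
  D.measurable_integral_err (ξ := fun a b v => ξ a b v ^ 2) (hξ.pow_const 2)

omit [IsProbabilityMeasure μ] in
lemma errVar_nonneg (a b : 𝔸) : 0 ≤ D.errVar ξ a b := integral_nonneg fun _ => sq_nonneg _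

omit [IsProbabilityMeasure μ] in
lemma errVar_symm (hsymm : ∀ a b v, ξ a b v = ξ b a v) (a b : 𝔸) :
    D.errVar ξ a b = D.errVar ξ b a := by
  unfold errVar
  simp_rw [hsymm a b]

/-- The mean of `errVar` over two independent attributes. -/
noncomputable def meanErrVar (ξ : 𝔸 → 𝔸 → ℝ → ℝ) : ℝ :=
  ∫ a, ∫ b, D.errVar ξ a b ∂D.attrLaw ∂D.attrLaw

omit [IsProbabilityMeasure μ] in
lemma meanErrVar_nonneg : 0 ≤ D.meanErrVar ξ :=
  integral_nonneg fun _ => integral_nonneg fun _ => D.errVar_nonneg _ _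

lemma integral_errSum_sq (hξ : Measurable (fun x : 𝔸 × 𝔸 × ℝ => ξ x.1 x.2.1 x.2.2))
    (hB₁ : ∀ a b v, |ξ a b v| ≤ B₁) (h0 : ∀ a b, ∫ v, ξ a b v ∂D.errLaw = 0) (N : ℕ) :
    ∫ ω, D.errSum ξ N ω ^ 2 ∂μ = numDyads N * D.meanErrVar ξ := by
  have hsqB : ∀ a b v, |ξ a b v ^ 2| ≤ B₁ ^ 2 := fun a b v => by
    rw [abs_pow]; exact pow_le_pow_left₀ (abs_nonneg _) (hB₁ a b v) 2
  unfold errSum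
  rw [integral_sq_sum_of_orthogonal]
  · have : ∀ p : Dyad,
        ∫ ω, ξ (D.A p.1.1 ω) (D.A p.1.2 ω) (D.V p.1.1 p.1.2 ω) ^ 2 ∂μ = D.meanErrVar ξ := by
      intro p
      have h := D.integral_mul_error (Φ := fun _ => 1) measurable_const (C := 1)
        (fun _ => by simp) (ξ := fun a b v => ξ a b v ^ 2) (hξ.pow_const 2) hsqB p
      simp only [one_mul] at h
      rw [h]
      refine integral_pair D.iIndepFun_A D.measurable_A D.map_A p.2.ne (F := D.errVar ξ)
        (D.measurable_errVar hξ) (B := B₁ ^ 2) fun a b => ?_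
      exact abs_integral_le_of_abs_le (hsqB a b)
    simp_rw [this, Finset.sum_const, nsmul_eq_mul, card_dyads]
  · intro p _ q _
    refine Integrable.of_bound (C := B₁ * B₁) ?_ (ae_of_all _ fun ω => ?_)
    · exact ((D.measurable_err_term hξ p).mul (D.measurable_err_term hξ q)).aestronglyMeasurable
    · rw [norm_mul]
      exact mul_le_mul (hB₁ _ _ _) (hB₁ _ _ _) (norm_nonneg _) ((abs_nonneg _).trans
        (hB₁ (D.A 0 ω) (D.A 0 ω) 0))
  · exact fun p _ q _ hpq => D.integral_mul_error_error hξ hB₁ h0 hpq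

lemma integral_combination_sq (hξ : Measurable (fun x : 𝔸 × 𝔸 × ℝ => ξ x.1 x.2.1 x.2.2))
    (hB₁ : ∀ a b v, |ξ a b v| ≤ B₁) (h0 : ∀ a b, ∫ v, ξ a b v ∂D.errLaw = 0)
    (hη : Measurable η) (hB₂ : ∀ a, |η a| ≤ B₂) (h0' : ∫ a, η a ∂D.attrLaw = 0)
    (c₁ c₂ : ℝ) (N : ℕ) :
    ∫ ω, (c₁ * D.errSum ξ N ω + c₂ * D.attrSum η N ω) ^ 2 ∂μ
      = c₁ ^ 2 * (numDyads N * D.meanErrVar ξ) + c₂ ^ 2 * (N * ∫ a, η a ^ 2 ∂D.attrLaw) := by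
  have hm1 := D.measurable_errSum hξ N
  have hm2 := D.measurable_attrSum hη N
  have hb1 := D.abs_errSum_le hB₁ N
  have hb2 := D.abs_attrSum_le hB₂ N
  have hcross : ∫ ω, D.attrSum η N ω * D.errSum ξ N ω ∂μ = 0 := by
    unfold errSum
    simp_rw [Finset.mul_sum]
    have hΦ : Measurable (fun x : ℕ → 𝔸 => ∑ i ∈ Finset.range N, η (x i)) :=
      Finset.measurable_sum _ fun i _ => hη.comp (measurable_pi_apply i)
    have hΦB : ∀ x : ℕ → 𝔸, |∑ i ∈ Finset.range N, η (x i)| ≤ ∑ _i ∈ Finset.range N, B₂ :=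
      fun x => (Finset.abs_sum_le_sum_abs _ _).trans (Finset.sum_le_sum fun _ _ => hB₂ _)
    rw [integral_finsetSum]
    · refine Finset.sum_eq_zero fun p _ => ?_
      have := D.integral_mul_error hΦ hΦB hξ hB₁ p
      simp only [h0, mul_zero, integral_zero] at this
      exact this
    · intro p _
      refine Integrable.of_bound (C := (∑ _i ∈ Finset.range N, B₂) * B₁)
        (hm2.mul (D.measurable_err_term hξ p)).aestronglyMeasurable (ae_of_all _ fun ω => ?_)
      rw [norm_mul]
      exact mul_le_mul (hb2 ω) (hB₁ _ _ _) (norm_nonneg _) ((abs_nonneg _).trans (hb2 ω))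
  have i1 : Integrable (fun ω => D.errSum ξ N ω ^ 2) μ :=
    Integrable.of_bound (by fun_prop) _ (ae_of_all _ fun ω => by
      rw [norm_pow]; exact pow_le_pow_left₀ (norm_nonneg _) (hb1 ω) 2)
  have i2 : Integrable (fun ω => D.attrSum η N ω ^ 2) μ :=
    Integrable.of_bound (by fun_prop) _ (ae_of_all _ fun ω => by
      rw [norm_pow]; exact pow_le_pow_left₀ (norm_nonneg _) (hb2 ω) 2)
  have i3 : Integrable (fun ω => D.attrSum η N ω * D.errSum ξ N ω) μ :=
    Integrable.of_bound (by fun_prop) _ (ae_of_all _ fun ω => by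
      rw [norm_mul]
      exact mul_le_mul (hb2 ω) (hb1 ω) (norm_nonneg _) ((abs_nonneg _).trans (hb2 ω)))
  have e : ∀ ω, (c₁ * D.errSum ξ N ω + c₂ * D.attrSum η N ω) ^ 2
      = c₁ ^ 2 * D.errSum ξ N ω ^ 2 + c₂ ^ 2 * D.attrSum η N ω ^ 2
        + 2 * c₁ * c₂ * (D.attrSum η N ω * D.errSum ξ N ω) := fun ω => by ring
  have i12 : Integrable (fun ω => c₁ ^ 2 * D.errSum ξ N ω ^ 2 + c₂ ^ 2 * D.attrSum η N ω ^ 2) μ :=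
    (i1.const_mul _).add (i2.const_mul _)
  simp_rw [e]
  rw [integral_add i12 (i3.const_mul _), integral_add (i1.const_mul _) (i2.const_mul _),
    integral_const_mul, integral_const_mul,
    integral_const_mul, hcross, D.integral_errSum_sq hξ hB₁ h0]
  have := integral_sq_sum_iid D.iIndepFun_A D.measurable_A D.map_A hη hB₂ h0' N
  unfold attrSum
  rw [this]
  ring

/-- Non-asymptotic normal approximation. Conditionally on the attributes, `errSum` is a sum of
independent centered terms whose total conditional variance concentrates around its mean, so that
its conditional characteristic function is almost deterministic; `attrSum` is a sum of i.i.d.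
terms. -/
lemma norm_charFun_combination_sub_le
    (hξ : Measurable (fun x : 𝔸 × 𝔸 × ℝ => ξ x.1 x.2.1 x.2.2)) (hsymm : ∀ a b v, ξ a b v = ξ b a v)
    (hB₁ : ∀ a b v, |ξ a b v| ≤ B₁) (h0 : ∀ a b, ∫ v, ξ a b v ∂D.errLaw = 0)
    (hη : Measurable η) (hB₂ : ∀ a, |η a| ≤ B₂) (h0' : ∫ a, η a ∂D.attrLaw = 0)
    {S : ℝ} (hS : ∀ a b, D.errVar ξ a b ≤ S) (hB₁0 : 0 ≤ B₁) (c₁ c₂ t : ℝ) (N : ℕ) :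
    ‖∫ ω, Complex.exp (Complex.I *
          ((t * (c₁ * D.errSum ξ N ω + c₂ * D.attrSum η N ω) : ℝ) : ℂ)) ∂μ
      - (Real.exp (-(t ^ 2 * (c₁ ^ 2 * (numDyads N * D.meanErrVar ξ)
          + c₂ ^ 2 * (N * ∫ a, η a ^ 2 ∂D.attrLaw)) / 2)) : ℂ)‖
      ≤ numDyads N * (4 * |t * c₁| ^ 3 * B₁ * S + (t * c₁) ^ 4 * S ^ 2)
        + (t * c₁) ^ 2 / 2 * Real.sqrt (24 * S ^ 2 * (N : ℝ) ^ 3)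
        + N * (4 * |t * c₂| ^ 3 * B₂ * (∫ a, η a ^ 2 ∂D.attrLaw)
          + (t * c₂) ^ 4 * (∫ a, η a ^ 2 ∂D.attrLaw) ^ 2) := by
  set s₁ := t * c₁ with hs₁
  set s₂ := t * c₂ with hs₂
  set τ := ∫ a, η a ^ 2 ∂D.attrLaw with hτ
  set vbar := D.meanErrVar ξ with hvbar
  have hvbar0 : 0 ≤ vbar := D.meanErrVar_nonneg
  have hτ0 : 0 ≤ τ := integral_nonneg fun _ => sq_nonneg _
  have hn0 : 0 ≤ numDyads N := Nat.cast_nonneg _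
  have hexp : ∀ x : ℝ, ‖Complex.exp (Complex.I * (x : ℂ))‖ = 1 := fun x => by
    rw [mul_comm, Complex.norm_exp_ofReal_mul_I]
  have hexpr : ∀ x : ℝ, 0 ≤ x → ‖(Real.exp (-x) : ℂ)‖ ≤ 1 := fun x hx => by
    rw [Complex.norm_real, Real.norm_eq_abs, abs_of_pos (Real.exp_pos _)]
    exact Real.exp_le_one_iff.2 (by linarith)
  set φ : 𝔸 → 𝔸 → ℂ := fun a b => ∫ v, Complex.exp (Complex.I * ((s₁ * ξ a b v : ℝ) : ℂ)) ∂D.errLaw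
    with hφ
  have hφ1 : ∀ a b, ‖φ a b‖ ≤ 1 := fun a b =>
    (norm_integral_le_of_norm_le_const (ae_of_all _ fun v => (hexp _).le)).trans (by simp)
  set Φ : (ℕ → 𝔸) → ℂ :=
    fun x => Complex.exp (Complex.I * ((s₂ * ∑ i ∈ Finset.range N, η (x i) : ℝ) : ℂ)) with hΦ
  have hsumη : Measurable fun x : ℕ → 𝔸 => ∑ i ∈ Finset.range N, η (x i) :=
    Finset.measurable_sum _ fun i _ => hη.comp (measurable_pi_apply i)
  have hΦm : Measurable Φ := by
    have := hsumη
    fun_prop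
  have hAm : Measurable (fun ω i => D.A i ω) := measurable_pi_lambda _ D.measurable_A
  have hΦA : Measurable (fun ω => Φ (fun i => D.A i ω)) := hΦm.comp hAm
  have hψm : Measurable (fun x : 𝔸 × 𝔸 × ℝ =>
      Complex.exp (Complex.I * ((s₁ * ξ x.1 x.2.1 x.2.2 : ℝ) : ℂ))) := by
    fun_prop
  have hφm : Measurable (Function.uncurry φ) := by
    have : Measurable (Function.uncurry fun (x : 𝔸 × 𝔸) v =>
        Complex.exp (Complex.I * ((s₁ * ξ x.1 x.2 v : ℝ) : ℂ))) :=
      hψm.comp (f := fun y : (𝔸 × 𝔸) × ℝ => (y.1.1, y.1.2, y.2)) (by fun_prop)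
    exact (this.stronglyMeasurable.integral_prod_right (ν := D.errLaw)).measurable
  have hpairm : ∀ p : Dyad, Measurable (fun ω => (D.A p.1.1 ω, D.A p.1.2 ω)) := fun p =>
    (D.measurable_A _).prodMk (D.measurable_A _)
  -- integrate out the errors
  have hE : ∫ ω, Complex.exp (Complex.I *
        ((t * (c₁ * D.errSum ξ N ω + c₂ * D.attrSum η N ω) : ℝ) : ℂ)) ∂μ
      = ∫ ω, Φ (fun i => D.A i ω) * ∏ p ∈ dyads N, φ (D.A p.1.1 ω) (D.A p.1.2 ω) ∂μ := by
    have h := D.integral_mul_prod_errors (dyads N) hΦm (C := 1) (fun x => (hexp _).le)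
      (ψ := fun p x v => Complex.exp (Complex.I * ((s₁ * ξ (x p.1.1) (x p.1.2) v : ℝ) : ℂ)))
      (fun p => hψm.comp (f := fun y : (ℕ → 𝔸) × ℝ => (y.1 p.1.1, y.1 p.1.2, y.2)) (by fun_prop))
      (B := 1) (fun p x v => (hexp _).le)
    rw [← h]
    refine integral_congr_ae (ae_of_all _ fun ω => ?_)
    simp only [hΦ]
    rw [← Complex.exp_sum, ← Complex.exp_add]
    congr 1
    rw [← Finset.mul_sum, ← mul_add, ← Complex.ofReal_sum, ← Complex.ofReal_add,
      ← Finset.mul_sum]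
    congr 2
    unfold errSum attrSum
    rw [hs₁, hs₂]; ring
  set R₀ : ℂ := ∫ ω, Φ (fun i => D.A i ω) *
    ∏ p ∈ dyads N, (Real.exp (-(s₁ ^ 2 * D.errVar ξ (D.A p.1.1 ω) (D.A p.1.2 ω) / 2)) : ℂ) ∂μ
    with hR₀
  set R₁ : ℂ := (∫ ω, Φ (fun i => D.A i ω) ∂μ)
    * (Real.exp (-(s₁ ^ 2 * (numDyads N * vbar) / 2)) : ℂ) with hR₁
  have hvm := D.measurable_errVar hξ
  have hvpm : ∀ p : Dyad, Measurable (fun ω => D.errVar ξ (D.A p.1.1 ω) (D.A p.1.2 ω)) :=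
    fun p => hvm.comp (hpairm p)
  have hφpm : ∀ p : Dyad, Measurable (fun ω => φ (D.A p.1.1 ω) (D.A p.1.2 ω)) :=
    fun p => hφm.comp (hpairm p)
  have hepm : ∀ p : Dyad, Measurable (fun ω =>
      (Real.exp (-(s₁ ^ 2 * D.errVar ξ (D.A p.1.1 ω) (D.A p.1.2 ω) / 2)) : ℂ)) := fun p => by
    have := hvpm p
    fun_prop
  have hep1 : ∀ (p : Dyad) ω,
      ‖(Real.exp (-(s₁ ^ 2 * D.errVar ξ (D.A p.1.1 ω) (D.A p.1.2 ω) / 2)) : ℂ)‖ ≤ 1 :=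
    fun p ω => hexpr _ (by have := D.errVar_nonneg (ξ := ξ) (D.A p.1.1 ω) (D.A p.1.2 ω); positivity)
  have hprod_le : ∀ (f : Dyad → ℂ), (∀ p, ‖f p‖ ≤ 1) → ‖∏ p ∈ dyads N, f p‖ ≤ 1 := fun f hf => by
    rw [norm_prod]
    exact Finset.prod_le_one (fun _ _ => norm_nonneg _) fun p _ => hf p
  have hI₀ : Integrable (fun ω => Φ (fun i => D.A i ω) *
      ∏ p ∈ dyads N, φ (D.A p.1.1 ω) (D.A p.1.2 ω)) μ := by
    refine Integrable.of_bound (C := 1) (hΦA.mul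
      (Finset.measurable_prod _ fun p _ => hφpm p)).aestronglyMeasurable (ae_of_all _ fun ω => ?_)
    rw [norm_mul, hexp, one_mul]
    exact hprod_le _ fun p => hφ1 _ _
  have hI₁ : Integrable (fun ω => Φ (fun i => D.A i ω) * ∏ p ∈ dyads N,
      (Real.exp (-(s₁ ^ 2 * D.errVar ξ (D.A p.1.1 ω) (D.A p.1.2 ω) / 2)) : ℂ)) μ := by
    refine Integrable.of_bound (C := 1) (hΦA.mul
      (Finset.measurable_prod _ fun p _ => hepm p)).aestronglyMeasurable (ae_of_all _ fun ω => ?_)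
    rw [norm_mul, hexp, one_mul]
    exact hprod_le _ fun p => hep1 p _
  have hIΦ : Integrable (fun ω => Φ (fun i => D.A i ω)) μ :=
    Integrable.of_bound (C := 1) hΦA.aestronglyMeasurable (ae_of_all _ fun ω => (hexp _).le)
  -- first step: conditional characteristic functions of the single dyad terms
  have step₀ : ‖(∫ ω, Φ (fun i => D.A i ω) * ∏ p ∈ dyads N, φ (D.A p.1.1 ω) (D.A p.1.2 ω) ∂μ) - R₀‖
      ≤ numDyads N * (4 * |s₁| ^ 3 * B₁ * S + s₁ ^ 4 * S ^ 2) := by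
    rw [hR₀, ← integral_sub hI₀ hI₁]
    refine (norm_integral_le_of_norm_le_const (C := numDyads N *
      (4 * |s₁| ^ 3 * B₁ * S + s₁ ^ 4 * S ^ 2)) (ae_of_all _ fun ω => ?_)).trans (by simp)
    rw [← mul_sub, norm_mul, hexp, one_mul]
    refine (norm_prod_sub_prod_le_sum _ _ _ (fun p _ => hφ1 _ _) fun p _ => hep1 p ω).trans ?_
    rw [← card_dyads, ← nsmul_eq_mul]
    refine Finset.sum_le_card_nsmul _ _ _ fun p _ => ?_
    have hv0 := D.errVar_nonneg (ξ := ξ) (D.A p.1.1 ω) (D.A p.1.2 ω)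
    have hvS := hS (D.A p.1.1 ω) (D.A p.1.2 ω)
    refine (norm_integral_cexp_sub_exp_le D.errLaw (X := ξ (D.A p.1.1 ω) (D.A p.1.2 ω))
      (hξ.comp (f := fun v => (D.A p.1.1 ω, D.A p.1.2 ω, v)) (by fun_prop))
      (hB₁ _ _) (h0 _ _) s₁).trans ?_
    change 4 * |s₁| ^ 3 * B₁ * D.errVar ξ (D.A p.1.1 ω) (D.A p.1.2 ω)
      + s₁ ^ 4 * D.errVar ξ (D.A p.1.1 ω) (D.A p.1.2 ω) ^ 2 ≤ _
    gcongr
  -- second step: concentration of the conditional variance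
  have step₁ : ‖R₀ - R₁‖ ≤ s₁ ^ 2 / 2 * Real.sqrt (24 * S ^ 2 * (N : ℝ) ^ 3) := by
    have hvabs : ∀ a b, |D.errVar ξ a b| ≤ S := fun a b => by
      rw [abs_of_nonneg (D.errVar_nonneg a b)]; exact hS a b
    have hlln := integral_sq_sum_sub_mean_le D.iIndepFun_A D.measurable_A D.map_A hvm
      (D.errVar_symm hsymm) hvabs N
    set Y : Ω → ℝ := fun ω => ∑ p ∈ dyads N, D.errVar ξ (D.A p.1.1 ω) (D.A p.1.2 ω)
      - numDyads N * vbar with hY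
    have hYm : Measurable Y := (Finset.measurable_sum _ fun p _ => hvpm p).sub_const _
    have hYb : ∀ ω, ‖Y ω‖ ≤ ∑ _p ∈ dyads N, S + |numDyads N * vbar| := fun ω =>
      (norm_sub_le _ _).trans (add_le_add ((norm_sum_le _ _).trans
        (Finset.sum_le_sum fun p _ => hvabs _ _)) le_rfl)
    have hYL : MemLp Y 2 μ := MemLp.of_bound hYm.aestronglyMeasurable _ (ae_of_all _ hYb)
    have hYi : Integrable (fun ω => |Y ω|) μ :=
      (Integrable.of_bound hYm.aestronglyMeasurable _ (ae_of_all _ hYb)).abs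
    have hYabs : ∫ ω, |Y ω| ∂μ ≤ Real.sqrt (24 * S ^ 2 * (N : ℝ) ^ 3) :=
      (integral_abs_le_sqrt_integral_sq hYL).trans (Real.sqrt_le_sqrt hlln)
    rw [hR₀, hR₁, ← integral_mul_const, ← integral_sub hI₁ (hIΦ.mul_const _)]
    calc _ ≤ ∫ ω, s₁ ^ 2 / 2 * |Y ω| ∂μ := by
          refine norm_integral_le_of_norm_le (hYi.const_mul _) (ae_of_all _ fun ω => ?_)
          rw [← mul_sub, norm_mul, hexp, one_mul, ← Complex.ofReal_prod, ← Complex.ofReal_sub,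
            Complex.norm_real, ← Real.exp_sum, Finset.sum_neg_distrib]
          refine (abs_exp_neg_sub_exp_neg_le (Finset.sum_nonneg fun p _ => ?_)
            (by positivity)).trans (le_of_eq ?_)
          · have := D.errVar_nonneg (ξ := ξ) (D.A p.1.1 ω) (D.A p.1.2 ω)
            positivity
          · rw [← Finset.sum_div, ← Finset.mul_sum, ← sub_div, ← mul_sub, abs_div, abs_mul,
              abs_of_nonneg (sq_nonneg s₁)]
            simp only [hY, Nat.abs_ofNat]
            ring
      _ = s₁ ^ 2 / 2 * ∫ ω, |Y ω| ∂μ := integral_const_mul _ _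
      _ ≤ _ := by gcongr
  -- third step: the i.i.d. attribute effects
  have step₂ : ‖R₁
      - (Real.exp (-(t ^ 2 * (c₁ ^ 2 * (numDyads N * vbar) + c₂ ^ 2 * (N * τ)) / 2)) : ℂ)‖
      ≤ N * (4 * |s₂| ^ 3 * B₂ * τ + s₂ ^ 4 * τ ^ 2) := by
    have hprod : ∫ ω, Φ (fun i => D.A i ω) ∂μ = ∏ _i ∈ Finset.range N,
        ∫ a, Complex.exp (Complex.I * ((s₂ * η a : ℝ) : ℂ)) ∂D.attrLaw := by
      have hind := D.iIndepFun_A.precomp (g := ((↑) : Finset.range N → ℕ)) Subtype.val_injective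
      have hm : Measurable (fun a => Complex.exp (Complex.I * ((s₂ * η a : ℝ) : ℂ))) := by fun_prop
      have h := hind.integral_fun_prod_comp
        (f := fun _ a => Complex.exp (Complex.I * ((s₂ * η a : ℝ) : ℂ)))
        (fun i => (D.measurable_A i).aemeasurable) (fun _ => hm.aestronglyMeasurable)
      rw [← Finset.prod_coe_sort]
      refine Eq.trans (integral_congr_ae (ae_of_all _ fun ω => ?_)) (h.trans ?_)
      · simp only [hΦ]
        rw [← Complex.exp_sum, ← Finset.mul_sum, ← Complex.ofReal_sum, ← Finset.mul_sum,
          Finset.sum_coe_sort (Finset.range N) (fun i => η (D.A i ω))]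
      · refine Finset.prod_congr rfl fun i _ => ?_
        rw [← D.map_A i, integral_map (D.measurable_A i).aemeasurable hm.aestronglyMeasurable]
    have hsplit : (Real.exp (-(t ^ 2 * (c₁ ^ 2 * (numDyads N * vbar) + c₂ ^ 2 * (N * τ)) / 2)) : ℂ)
        = (∏ _i ∈ Finset.range N, (Real.exp (-(s₂ ^ 2 * τ / 2)) : ℂ))
          * (Real.exp (-(s₁ ^ 2 * (numDyads N * vbar) / 2)) : ℂ) := by
      rw [← Complex.ofReal_prod, ← Complex.ofReal_mul, ← Real.exp_sum, ← Real.exp_add]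
      congr 2
      rw [Finset.sum_const, Finset.card_range, nsmul_eq_mul, hs₁, hs₂]
      ring
    rw [hsplit, hR₁, hprod, ← sub_mul, norm_mul]
    refine (mul_le_of_le_one_right (norm_nonneg _) (hexpr _ (by positivity))).trans ?_
    refine (norm_prod_sub_prod_le_sum _ _ _ (fun p _ => ?_) fun p _ =>
      hexpr _ (by positivity)).trans ?_
    · exact (norm_integral_le_of_norm_le_const (ae_of_all _ fun v => (hexp _).le)).trans (by simp)
    · refine (Finset.sum_le_card_nsmul _ _ _ fun p _ =>
        norm_integral_cexp_sub_exp_le D.attrLaw hη hB₂ h0' s₂).trans (le_of_eq ?_)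
      rw [Finset.card_range, nsmul_eq_mul]
  rw [hE]
  calc _ ≤ _ := norm_sub_le_norm_sub_add_norm_sub _ R₁ _
    _ ≤ _ := add_le_add ((norm_sub_le_norm_sub_add_norm_sub _ R₀ _).trans
      (add_le_add step₀ step₁)) step₂

end Combination

end Model

namespace Model

variable {Ω : Type*} [MeasurableSpace Ω] {μ : Measure Ω} {𝔸 : Type*} [MeasurableSpace 𝔸]
  (D : Model μ 𝔸)

/-! ### Conditional expectations of the kernel terms -/

/-- The kernel term `K_ij` as a function of `(A_i, A_j, V_ij)`. -/
noncomputable def kernFun (K : ℝ → ℝ) (w h : ℝ) (a b : 𝔸) (v : ℝ) : ℝ :=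
  1 / h * K ((w - D.W a b v) / h)

/-- The conditional mean of `K_ij` given `A_i = a` and `A_j = b`. -/
noncomputable def pairMean (K : ℝ → ℝ) (w h : ℝ) (a b : 𝔸) : ℝ :=
  ∫ v, D.kernFun K w h a b v ∂D.errLaw

/-- The conditional mean of `K_ij` given `A_i = a`. -/
noncomputable def nodeMean (K : ℝ → ℝ) (w h : ℝ) (a : 𝔸) : ℝ :=
  ∫ b, D.pairMean K w h a b ∂D.attrLaw

/-- The kernel term minus its conditional mean given the attributes. -/
noncomputable def kernErr (K : ℝ → ℝ) (w h : ℝ) (a b : 𝔸) (v : ℝ) : ℝ :=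
  D.kernFun K w h a b v - D.pairMean K w h a b

/-- The centered conditional mean of a kernel term given one attribute. -/
noncomputable def nodeEffect (K : ℝ → ℝ) (w h : ℝ) (a : 𝔸) : ℝ :=
  D.nodeMean K w h a - ∫ c, D.nodeMean K w h c ∂D.attrLaw

variable {K : ℝ → ℝ} {w h : ℝ} {Kb : ℝ}

lemma kern_eq (i j : ℕ) (ω : Ω) :
    D.kern K w h i j ω = D.kernFun K w h (D.A i ω) (D.A j ω) (D.V i j ω) := rfl

lemma kernFun_symm (a b : 𝔸) (v : ℝ) : D.kernFun K w h a b v = D.kernFun K w h b a v := by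
  unfold kernFun; rw [D.W_symm]

lemma pairMean_symm (a b : 𝔸) : D.pairMean K w h a b = D.pairMean K w h b a := by
  unfold pairMean; simp_rw [D.kernFun_symm a b]

lemma kernErr_symm (a b : 𝔸) (v : ℝ) : D.kernErr K w h a b v = D.kernErr K w h b a v := by
  unfold kernErr; rw [D.kernFun_symm, D.pairMean_symm]

lemma kern_symm (i j : ℕ) : D.kern K w h i j = D.kern K w h j i := by
  funext ω
  rw [kern_eq, kern_eq, D.kernFun_symm, D.V_symm]

lemma measurable_kernFun (hK : Measurable K) :
    Measurable (fun x : 𝔸 × 𝔸 × ℝ => D.kernFun K w h x.1 x.2.1 x.2.2) := by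
  have := D.measurable_W
  unfold kernFun
  fun_prop

lemma abs_kernFun_le (hb : ∀ u, |K u| ≤ Kb) (hh : 0 < h) (a b : 𝔸) (v : ℝ) :
    |D.kernFun K w h a b v| ≤ Kb / h := by
  unfold kernFun
  rw [abs_mul, abs_of_pos (by positivity : 0 < 1 / h), one_div, inv_mul_eq_div]
  gcongr
  exact hb _

lemma measurable_kern (hK : Measurable K) {i j : ℕ} (hij : i ≠ j) : Measurable (D.kern K w h i j) :=
  (D.measurable_kernFun hK).comp (f := fun ω => (D.A i ω, D.A j ω, D.V i j ω))
    ((D.measurable_A _).prodMk ((D.measurable_A _).prodMk (D.measurable_V _ _ hij)))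

/-- The decomposition of the estimation error is an identity of functions: the projections
telescope. -/
lemma fHat_sub_density_eq (N : ℕ) (ω : Ω) : D.fHat K w h N ω - D.density w =
    D.T1 K w h N ω + D.T2 K w h N ω + D.T3 K w h N ω + D.T4 K w h := by
  unfold fHat T2 T1 T4
  simp_rw [dyadSum_eq_sum_dyads]
  rw [Finset.sum_sub_distrib]
  ring

variable [IsProbabilityMeasure μ]

lemma measurable_pairMean (hK : Measurable K) :
    Measurable (Function.uncurry (D.pairMean K w h)) :=
  D.measurable_integral_err (D.measurable_kernFun hK)

lemma abs_pairMean_le (hb : ∀ u, |K u| ≤ Kb) (hh : 0 < h) (a b : 𝔸) :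
    |D.pairMean K w h a b| ≤ Kb / h :=
  abs_integral_le_of_abs_le (D.abs_kernFun_le hb hh a b)

lemma measurable_nodeMean (hK : Measurable K) : Measurable (D.nodeMean K w h) :=
  measurable_integral_right (D.measurable_pairMean hK)

lemma abs_nodeMean_le (hb : ∀ u, |K u| ≤ Kb) (hh : 0 < h) (a : 𝔸) :
    |D.nodeMean K w h a| ≤ Kb / h :=
  abs_integral_le_of_abs_le (D.abs_pairMean_le hb hh a)

lemma integrable_kern (hK : Measurable K) (hb : ∀ u, |K u| ≤ Kb) (hh : 0 < h) {i j : ℕ}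
    (hij : i ≠ j) : Integrable (D.kern K w h i j) μ :=
  Integrable.of_bound (D.measurable_kern hK hij).aestronglyMeasurable _
    (ae_of_all _ fun _ => D.abs_kernFun_le hb hh _ _ _)

/-- The error `V_ij` may be integrated out of `K_ij` against any function of the attributes. -/
lemma integral_mul_kern (hK : Measurable K) (hb : ∀ u, |K u| ≤ Kb) (hh : 0 < h)
    {Φ : (ℕ → 𝔸) → ℝ} (hΦ : Measurable Φ) {C : ℝ} (hC : ∀ x, |Φ x| ≤ C) {i j : ℕ} (hij : i ≠ j) :
    ∫ ω, Φ (fun i => D.A i ω) * D.kern K w h i j ω ∂μ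
      = ∫ ω, Φ (fun i => D.A i ω) * D.pairMean K w h (D.A i ω) (D.A j ω) ∂μ := by
  rcases lt_or_gt_of_ne hij with h' | h'
  · exact D.integral_mul_error hΦ hC (D.measurable_kernFun hK) (D.abs_kernFun_le hb hh) ⟨(i, j), h'⟩
  · rw [kern_symm]
    simp_rw [D.pairMean_symm (D.A i _) (D.A j _)]
    exact D.integral_mul_error hΦ hC (D.measurable_kernFun hK) (D.abs_kernFun_le hb hh) ⟨(j, i), h'⟩

omit [IsProbabilityMeasure μ] in
lemma sigmaA_le (i : ℕ) : D.sigmaA i ≤ ‹MeasurableSpace Ω› := (D.measurable_A i).comap_le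

lemma condKern2_ae_eq (hK : Measurable K) (hb : ∀ u, |K u| ≤ Kb) (hh : 0 < h) {i j : ℕ}
    (hij : i ≠ j) :
    D.condKern2 K w h i j =ᵐ[μ] fun ω => D.pairMean K w h (D.A i ω) (D.A j ω) := by
  have hg := D.measurable_pairMean (w := w) (h := h) hK
  have hpair : Measurable (fun ω => (D.A i ω, D.A j ω)) :=
    (D.measurable_A i).prodMk (D.measurable_A j)
  have hgm : Measurable (fun ω => D.pairMean K w h (D.A i ω) (D.A j ω)) := hg.comp hpair
  have hgi : Integrable (fun ω => D.pairMean K w h (D.A i ω) (D.A j ω)) μ :=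
    Integrable.of_bound hgm.aestronglyMeasurable _
      (ae_of_all _ fun ω => D.abs_pairMean_le hb hh _ _)
  have hcomap : D.sigmaA i ⊔ D.sigmaA j
      = MeasurableSpace.comap (fun ω => (D.A i ω, D.A j ω)) inferInstance :=
    (MeasurableSpace.comap_prodMk _ _).symm
  symm
  refine ae_eq_condExp_of_forall_setIntegral_eq (sup_le (D.sigmaA_le i) (D.sigmaA_le j))
    (D.integrable_kern hK hb hh hij) (fun s _ _ => hgi.integrableOn) (fun s hs _ => ?_) ?_
  · rw [hcomap] at hs
    obtain ⟨B, hB, rfl⟩ := hs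
    rw [← integral_indicator (hpair hB), ← integral_indicator (hpair hB)]
    have hΦ : Measurable (fun x : ℕ → 𝔸 => B.indicator (fun _ => (1 : ℝ)) (x i, x j)) :=
      (measurable_const.indicator hB).comp (f := fun x : ℕ → 𝔸 => (x i, x j)) (by fun_prop)
    have := D.integral_mul_kern (w := w) hK hb hh hΦ (C := 1) (fun x => by
      by_cases hx : (x i, x j) ∈ B <;> simp [hx]) hij
    refine Eq.trans (integral_congr_ae (ae_of_all _ fun ω => ?_)) (this.symm.trans
      (integral_congr_ae (ae_of_all _ fun ω => ?_)))
    all_goals by_cases hx : (D.A i ω, D.A j ω) ∈ B <;> simp [hx, Set.indicator]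
  · rw [hcomap]
    exact (hg.comp (comap_measurable _)).stronglyMeasurable.aestronglyMeasurable

lemma condKern1_ae_eq (hK : Measurable K) (hb : ∀ u, |K u| ≤ Kb) (hh : 0 < h) {i j : ℕ}
    (hij : i ≠ j) :
    D.condKern1 K w h i j =ᵐ[μ] fun ω => D.nodeMean K w h (D.A i ω) := by
  have hg := D.measurable_pairMean (w := w) (h := h) hK
  have hG := D.measurable_nodeMean (w := w) (h := h) hK
  have hgi : Integrable (fun ω => D.nodeMean K w h (D.A i ω)) μ :=
    Integrable.of_bound (hG.comp (D.measurable_A i)).aestronglyMeasurable _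
      (ae_of_all _ fun ω => D.abs_nodeMean_le hb hh _)
  symm
  refine ae_eq_condExp_of_forall_setIntegral_eq (D.sigmaA_le i)
    (D.integrable_kern hK hb hh hij) (fun s _ _ => hgi.integrableOn) (fun s hs _ => ?_) ?_
  · obtain ⟨B, hB, rfl⟩ := hs
    rw [← integral_indicator (D.measurable_A i hB), ← integral_indicator (D.measurable_A i hB)]
    have hind : Measurable (B.indicator (fun _ => (1 : ℝ))) := measurable_const.indicator hB
    have hind1 : ∀ a, |B.indicator (fun _ => (1 : ℝ)) a| ≤ 1 := fun a => by
      by_cases hx : a ∈ B <;> simp [hx]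
    have h1 := D.integral_mul_kern (w := w) hK hb hh
      (Φ := fun x : ℕ → 𝔸 => B.indicator (fun _ => (1 : ℝ)) (x i))
      (hind.comp (measurable_pi_apply i)) (fun x => hind1 _) hij
    have h2 := integral_pair D.iIndepFun_A D.measurable_A D.map_A hij
      (F := fun a b => B.indicator (fun _ => (1 : ℝ)) a * D.pairMean K w h a b)
      ((hind.comp measurable_fst).mul hg) (B := 1 * (Kb / h)) (fun a b => by
        rw [abs_mul]
        exact mul_le_mul (hind1 a) (D.abs_pairMean_le hb hh _ _) (abs_nonneg _) zero_le_one)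
    simp_rw [integral_const_mul] at h2
    have h3 := integral_single D.measurable_A D.map_A i (hind.mul hG)
    have h4 := h1.trans (h2.trans h3.symm)
    refine Eq.trans (integral_congr_ae (ae_of_all _ fun ω => ?_)) (h4.symm.trans
      (integral_congr_ae (ae_of_all _ fun ω => ?_)))
    all_goals by_cases hx : D.A i ω ∈ B <;> simp [hx, Set.indicator]
  · exact (hG.comp (comap_measurable _)).stronglyMeasurable.aestronglyMeasurable

lemma meanKern_eq (hK : Measurable K) (hb : ∀ u, |K u| ≤ Kb) (hh : 0 < h) :
    D.meanKern K w h = ∫ a, D.nodeMean K w h a ∂D.attrLaw := by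
  have h1 := D.integral_mul_kern (w := w) hK hb hh (Φ := fun _ => 1) measurable_const (C := 1)
    (fun _ => by simp) (zero_ne_one : (0 : ℕ) ≠ 1)
  simp only [one_mul] at h1
  exact h1.trans (integral_pair D.iIndepFun_A D.measurable_A D.map_A zero_ne_one
    (D.measurable_pairMean hK) (D.abs_pairMean_le hb hh))

/-! ### The four terms as functions of attributes and errors -/

lemma measurable_kernErr (hK : Measurable K) :
    Measurable (fun x : 𝔸 × 𝔸 × ℝ => D.kernErr K w h x.1 x.2.1 x.2.2) :=
  (D.measurable_kernFun hK).sub ((D.measurable_pairMean hK).comp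
    (f := fun x : 𝔸 × 𝔸 × ℝ => (x.1, x.2.1)) (by fun_prop))

lemma abs_kernErr_le (hb : ∀ u, |K u| ≤ Kb) (hh : 0 < h) (a b : 𝔸) (v : ℝ) :
    |D.kernErr K w h a b v| ≤ 2 * (Kb / h) := by
  have := abs_le.1 (D.abs_kernFun_le (w := w) hb hh a b v)
  have := abs_le.1 (D.abs_pairMean_le (w := w) hb hh a b)
  unfold kernErr
  rw [abs_le]; constructor <;> linarith

omit [IsProbabilityMeasure μ] in
lemma measurable_kernFun_right (hK : Measurable K) (a b : 𝔸) :
    Measurable (D.kernFun K w h a b) :=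
  (D.measurable_kernFun hK).comp (f := fun v => (a, b, v)) (by fun_prop)

lemma integrable_kernFun (hK : Measurable K) (hb : ∀ u, |K u| ≤ Kb) (hh : 0 < h) (a b : 𝔸) :
    Integrable (D.kernFun K w h a b) D.errLaw :=
  Integrable.of_bound (D.measurable_kernFun_right hK a b).aestronglyMeasurable _
    (ae_of_all _ (D.abs_kernFun_le hb hh a b))

lemma integral_kernErr (hK : Measurable K) (hb : ∀ u, |K u| ≤ Kb) (hh : 0 < h) (a b : 𝔸) :
    ∫ v, D.kernErr K w h a b v ∂D.errLaw = 0 := by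
  unfold kernErr
  rw [integral_sub (D.integrable_kernFun hK hb hh a b) (integrable_const _)]
  simp [pairMean]

/-- The conditional variance as second moment minus squared mean. -/
lemma errVar_kernErr (hK : Measurable K) (hb : ∀ u, |K u| ≤ Kb) (hh : 0 < h) (a b : 𝔸) :
    D.errVar (D.kernErr K w h) a b
      = ∫ v, D.kernFun K w h a b v ^ 2 ∂D.errLaw - D.pairMean K w h a b ^ 2 := by
  have i1 := D.integrable_kernFun (w := w) hK hb hh a b
  have i2 : Integrable (fun v => D.kernFun K w h a b v ^ 2) D.errLaw :=
    Integrable.of_bound ((D.measurable_kernFun_right hK a b).pow_const 2).aestronglyMeasurable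
      ((Kb / h) ^ 2) (ae_of_all _ fun v => by
        rw [norm_pow]
        exact pow_le_pow_left₀ (norm_nonneg _) (D.abs_kernFun_le hb hh a b v) 2)
  unfold errVar kernErr
  have e : ∀ v, (D.kernFun K w h a b v - D.pairMean K w h a b) ^ 2
      = D.kernFun K w h a b v ^ 2 - 2 * D.pairMean K w h a b * D.kernFun K w h a b v
        + D.pairMean K w h a b ^ 2 := fun v => by ring
  have i3 : Integrable (fun v => D.kernFun K w h a b v ^ 2
      - 2 * D.pairMean K w h a b * D.kernFun K w h a b v) D.errLaw := i2.sub (i1.const_mul _)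
  simp_rw [e]
  rw [integral_add i3 (integrable_const _), integral_sub i2 (i1.const_mul _), integral_const_mul]
  change _ - 2 * D.pairMean K w h a b * D.pairMean K w h a b + _ = _
  simp
  ring

lemma measurable_nodeEffect (hK : Measurable K) : Measurable (D.nodeEffect K w h) :=
  (D.measurable_nodeMean hK).sub_const _

lemma integral_nodeEffect (hK : Measurable K) (hb : ∀ u, |K u| ≤ Kb) (hh : 0 < h) :
    ∫ a, D.nodeEffect K w h a ∂D.attrLaw = 0 := by
  unfold nodeEffect
  rw [integral_sub (Integrable.of_bound (D.measurable_nodeMean hK).aestronglyMeasurable _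
    (ae_of_all _ (D.abs_nodeMean_le hb hh))) (integrable_const _)]
  simp

lemma T1_ae_eq (hK : Measurable K) (hb : ∀ u, |K u| ≤ Kb) (hh : 0 < h) (N : ℕ) :
    D.T1 K w h N =ᵐ[μ] fun ω => 1 / numDyads N * D.errSum (D.kernErr K w h) N ω := by
  have : ∀ᵐ ω ∂μ, ∀ p : Dyad, D.condKern2 K w h p.1.1 p.1.2 ω
      = D.pairMean K w h (D.A p.1.1 ω) (D.A p.1.2 ω) :=
    ae_all_iff.2 fun p => D.condKern2_ae_eq hK hb hh p.2.ne
  filter_upwards [this] with ω hω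
  unfold T1
  rw [dyadSum_eq_sum_dyads]
  unfold errSum kernErr
  simp_rw [hω, kern_eq]

lemma T3_ae_eq (hK : Measurable K) (hb : ∀ u, |K u| ≤ Kb) (hh : 0 < h) {N : ℕ} (hN : 2 ≤ N) :
    D.T3 K w h N =ᵐ[μ] fun ω => 2 / (N : ℝ) * D.attrSum (D.nodeEffect K w h) N ω := by
  -- the cyclic successor of a node is a different node as soon as `2 ≤ N`
  have hne : ∀ i ∈ Finset.range N, i ≠ (i + 1) % N := fun i hi => by
    have hi := Finset.mem_range.1 hi
    rcases Nat.lt_or_ge (i + 1) N with h1 | h1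
    · rw [Nat.mod_eq_of_lt h1]; omega
    · rw [show i + 1 = N by omega, Nat.mod_self]; omega
  have : ∀ᵐ ω ∂μ, ∀ i ∈ Finset.range N, D.condKern1 K w h i ((i + 1) % N) ω
      = D.nodeMean K w h (D.A i ω) :=
    (ae_ball_iff (Finset.range N).countable_toSet).2 fun i hi =>
      D.condKern1_ae_eq hK hb hh (hne i hi)
  filter_upwards [this] with ω hω
  unfold T3 attrSum nodeEffect
  rw [← D.meanKern_eq hK hb hh]
  congr 1
  exact Finset.sum_congr rfl fun i hi => by rw [hω i hi]

lemma T2_ae_eq (hK : Measurable K) (hb : ∀ u, |K u| ≤ Kb) (hh : 0 < h) {N : ℕ} (hN : 2 ≤ N) :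
    D.T2 K w h N =ᵐ[μ] fun ω => 1 / numDyads N * ∑ p ∈ dyads N,
      degeneratePart D.attrLaw (D.pairMean K w h) (D.A p.1.1 ω) (D.A p.1.2 ω) := by
  have : ∀ᵐ ω ∂μ, ∀ p : Dyad, D.condKern2 K w h p.1.1 p.1.2 ω
      = D.pairMean K w h (D.A p.1.1 ω) (D.A p.1.2 ω) :=
    ae_all_iff.2 fun p => D.condKern2_ae_eq hK hb hh p.2.ne
  filter_upwards [this, D.T3_ae_eq (w := w) hK hb hh hN] with ω hω hω3
  have hN' : (2 : ℝ) ≤ N := by exact_mod_cast hN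
  have hN1 : (N : ℝ) - 1 ≠ 0 := by linarith
  have hN0 : (N : ℝ) ≠ 0 := by linarith
  unfold T2
  rw [dyadSum_eq_sum_dyads, hω3]
  simp_rw [hω]
  rw [sum_dyads_eq_hoeffding (P := D.attrLaw) (D.pairMean K w h) (fun i => D.A i ω) N,
    D.meanKern_eq hK hb hh]
  change 1 / numDyads N * (_ + ((N : ℝ) - 1) * D.attrSum (D.nodeEffect K w h) N ω
    + numDyads N * ∫ a, D.nodeMean K w h a ∂D.attrLaw) - _ = _
  rw [numDyads_eq]
  field_simp
  ring

/-- The variance of `E[K_ij | A_i]`, written as the second moment of `nodeEffect`. -/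
noncomputable def nodeVar (K : ℝ → ℝ) (w h : ℝ) : ℝ :=
  ∫ a, D.nodeEffect K w h a ^ 2 ∂D.attrLaw

omit [IsProbabilityMeasure μ] in
lemma nodeVar_nonneg : 0 ≤ D.nodeVar K w h := integral_nonneg fun _ => sq_nonneg _

lemma abs_nodeEffect_le {C : ℝ} (hC : ∀ a b, |D.pairMean K w h a b| ≤ C) (a : 𝔸) :
    |D.nodeEffect K w h a| ≤ 2 * C := by
  have h1 : ∀ a, |D.nodeMean K w h a| ≤ C := fun a => abs_integral_le_of_abs_le (hC a)
  have := abs_le.1 (h1 a)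
  have := abs_le.1 (abs_integral_le_of_abs_le (P := D.attrLaw) h1)
  unfold nodeEffect
  rw [abs_le]; constructor <;> linarith

lemma sigmaSq_eq (hK : Measurable K) (hb : ∀ u, |K u| ≤ Kb) (hh : 0 < h) {N : ℕ} (hN : 2 ≤ N) :
    D.sigmaSq K w h N
      = D.meanErrVar (D.kernErr K w h) / numDyads N + 4 * D.nodeVar K w h / N := by
  have e : D.sigmaSq K w h N = ∫ ω, (1 / numDyads N * D.errSum (D.kernErr K w h) N ω
      + 2 / (N : ℝ) * D.attrSum (D.nodeEffect K w h) N ω) ^ 2 ∂μ := by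
    refine integral_congr_ae ?_
    filter_upwards [D.T1_ae_eq (w := w) hK hb hh N, D.T3_ae_eq (w := w) hK hb hh hN] with ω h1 h3
    rw [h1, h3]
  rw [e, D.integral_combination_sq (D.measurable_kernErr hK) (D.abs_kernErr_le hb hh)
    (D.integral_kernErr hK hb hh) (D.measurable_nodeEffect hK)
    (D.abs_nodeEffect_le (D.abs_pairMean_le hb hh)) (D.integral_nodeEffect hK hb hh)]
  change _ + _ * (_ * D.nodeVar K w h) = _
  have hN' : (2 : ℝ) ≤ N := by exact_mod_cast hN
  have hN1 : (N : ℝ) - 1 ≠ 0 := by linarith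
  have hN0 : (N : ℝ) ≠ 0 := by linarith
  rw [numDyads_eq]
  field_simp
  ring

lemma integral_T2_sq_le (hK : Measurable K) (hb : ∀ u, |K u| ≤ Kb) (hh : 0 < h) {C : ℝ}
    (hC : ∀ a b, |D.pairMean K w h a b| ≤ C) {N : ℕ} (hN : 2 ≤ N) :
    ∫ ω, D.T2 K w h N ω ^ 2 ∂μ ≤ (4 * C) ^ 2 / numDyads N := by
  have e : ∫ ω, D.T2 K w h N ω ^ 2 ∂μ = ∫ ω, (1 / numDyads N) ^ 2 * (∑ p ∈ dyads N,
      degeneratePart D.attrLaw (D.pairMean K w h) (D.A p.1.1 ω) (D.A p.1.2 ω)) ^ 2 ∂μ := by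
    refine integral_congr_ae ?_
    filter_upwards [D.T2_ae_eq (w := w) hK hb hh hN] with ω h2
    rw [h2, mul_pow]
  have hm := D.measurable_pairMean (w := w) (h := h) hK
  have hn : 0 < numDyads N := by
    have hN' : (2 : ℝ) ≤ N := by exact_mod_cast hN
    rw [numDyads_eq]
    have : 0 < (N : ℝ) - 1 := by linarith
    positivity
  have := integral_sq_degenerate_sum_le D.iIndepFun_A D.measurable_A D.map_A
    (measurable_degeneratePart (P := D.attrLaw) hm) (degeneratePart_symm D.pairMean_symm)
    (abs_degeneratePart_le hC) (integral_degeneratePart hm hC) N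
  rw [e, integral_const_mul]
  calc _ ≤ (1 / numDyads N) ^ 2 * (numDyads N * (4 * C) ^ 2) := by gcongr
    _ = _ := by field_simp

end Model

/-! ### Kernel smoothing of a function with bounded second derivative -/

lemma abs_taylor_one_sub_le {f : ℝ → ℝ} {w δ M : ℝ} (hf : ContDiffOn ℝ 2 f (Metric.ball w δ))
    (hM : ∀ s ∈ Metric.ball w δ, |iteratedDeriv 2 f s| ≤ M) {x : ℝ} (hx : |x| < δ) :
    |f (w + x) - f w - deriv f w * x| ≤ M * x ^ 2 := by
  have hopen : IsOpen (Metric.ball w δ) := Metric.isOpen_ball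
  have hd : ∀ s ∈ Metric.ball w δ, DifferentiableAt ℝ f s := fun s hs =>
    (hf.differentiableOn (by norm_num)).differentiableAt (hopen.mem_nhds hs)
  have hd2 : ∀ s ∈ Metric.ball w δ, DifferentiableAt ℝ (deriv f) s := fun s hs =>
    ((hf.deriv_of_isOpen (m := 1) hopen (by norm_num)).differentiableOn
      (by norm_num)).differentiableAt (hopen.mem_nhds hs)
  have hsub : Metric.closedBall w |x| ⊆ Metric.ball w δ := Metric.closedBall_subset_ball hx
  have hw : w ∈ Metric.closedBall w |x| := Metric.mem_closedBall_self (abs_nonneg _)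
  have hwx : w + x ∈ Metric.closedBall w |x| := by simp
  have h2 : ∀ s ∈ Metric.ball w δ, deriv (deriv f) s = iteratedDeriv 2 f s := fun s _ => by
    rw [iteratedDeriv_succ, iteratedDeriv_one]
  have hM0 : 0 ≤ M := (abs_nonneg _).trans (hM w (hsub hw))
  have hlip : ∀ s ∈ Metric.closedBall w |x|, ‖deriv f s - deriv f w‖ ≤ M * |x| := fun s hs => by
    refine (Convex.norm_image_sub_le_of_norm_deriv_le (C := M) (fun y hy => hd2 y (hsub hy))
      (fun y hy => ?_) (convex_closedBall w |x|) hw hs).trans ?_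
    · rw [h2 y (hsub hy)]; exact hM y (hsub hy)
    · gcongr
      rw [Metric.mem_closedBall, dist_eq_norm] at hs
      exact hs
  have h := Convex.norm_image_sub_le_of_norm_hasDerivWithin_le (C := M * |x|)
    (f := fun s => f s - deriv f w * s) (f' := fun s => deriv f s - deriv f w)
    (s := Metric.closedBall w |x|)
    (fun s hs => by
      have := ((hd s (hsub hs)).hasDerivAt.sub ((hasDerivAt_id s).const_mul (deriv f w)))
      simp only [id, mul_one] at this
      exact this.hasDerivWithinAt)
    hlip (convex_closedBall w |x|) hw hwx
  rw [Real.norm_eq_abs, Real.norm_eq_abs] at h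
  have e : f (w + x) - f w - deriv f w * x
      = f (w + x) - deriv f w * (w + x) - (f w - deriv f w * w) := by ring
  rw [e]
  refine h.trans (le_of_eq ?_)
  rw [add_sub_cancel_left, mul_assoc, ← sq, sq_abs]

/-- A bounded measurable function with compact support is integrable against any function that is
continuous on the support. -/
lemma integrable_mul_of_compactSupport {L g : ℝ → ℝ} (hL : Measurable L) {Lb U : ℝ}
    (hb : ∀ u, |L u| ≤ Lb) (hU : ∀ u, U < |u| → L u = 0)
    (hg : ContinuousOn g (Set.Icc (-U) U)) : Integrable (fun u => L u * g u) := by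
  have hs : Function.support (fun u => L u * g u) ⊆ Set.Icc (-U) U := fun u hu => by
    by_contra hc
    rw [Set.mem_Icc, ← abs_le, not_le] at hc
    simp [hU u hc] at hu
  rw [← integrableOn_iff_integrable_of_support_subset hs]
  refine IntegrableOn.mul_continuousOn ?_ hg isCompact_Icc
  exact Measure.integrableOn_of_bounded (M := Lb) (by simp) hL.aestronglyMeasurable
    (ae_of_all _ hb)

/-- The first-order term of the expansion vanishes because the weight `L` is symmetric. -/
lemma abs_integral_smoothing_sub_le {f : ℝ → ℝ} {w δ M : ℝ}
    (hf : ContDiffOn ℝ 2 f (Metric.ball w δ))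
    (hM : ∀ s ∈ Metric.ball w δ, |iteratedDeriv 2 f s| ≤ M)
    {L : ℝ → ℝ} (hL : Measurable L) {Lb U : ℝ} (hb : ∀ u, |L u| ≤ Lb)
    (hU : ∀ u, U < |u| → L u = 0) (hsymm : ∀ u, L (-u) = L u) {h : ℝ} (hh : 0 < h)
    (hhU : h * U < δ) :
    |(∫ u, L u * f (w - h * u)) - f w * ∫ u, L u| ≤ M * (∫ u, |L u| * u ^ 2) * h ^ 2 := by
  have hball : ∀ u ∈ Set.Icc (-U) U, |-(h * u)| < δ := fun u hu => by
    rw [abs_neg, abs_mul, abs_of_pos hh]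
    exact (mul_le_mul_of_nonneg_left (abs_le.2 hu) hh.le).trans_lt hhU
  have hfc : ContinuousOn (fun u => f (w - h * u)) (Set.Icc (-U) U) := by
    refine hf.continuousOn.comp (f := fun u => w - h * u) (by fun_prop) fun u hu => ?_
    have := hball u hu
    simpa [Real.dist_eq] using this
  have i0 : Integrable (fun u => L u * f (w - h * u)) :=
    integrable_mul_of_compactSupport hL hb hU hfc
  have i1 : Integrable (fun u => L u * f w) :=
    integrable_mul_of_compactSupport hL hb hU continuousOn_const
  have i2 : Integrable (fun u => L u * u) :=
    integrable_mul_of_compactSupport hL hb hU continuousOn_id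
  have i3 : Integrable (fun u => |L u| * u ^ 2) :=
    integrable_mul_of_compactSupport (L := fun u => |L u|) (by fun_prop) (Lb := Lb) (U := U)
      (fun u => by rw [abs_abs]; exact hb u) (fun u hu => by simp [hU u hu]) (by fun_prop)
  -- the linear term integrates to zero, `L` being even
  have hodd : ∫ u, L u * u = 0 := by
    have := integral_neg_eq_self (fun u => L u * u) volume
    simp only [hsymm, mul_neg, integral_neg] at this
    linarith
  have e : (∫ u, L u * f (w - h * u)) - f w * ∫ u, L u
      = ∫ u, (L u * f (w - h * u) - L u * f w + deriv f w * h * (L u * u)) := by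
    have i01 : Integrable (fun u => L u * f (w - h * u) - L u * f w) := i0.sub i1
    rw [integral_add i01 (i2.const_mul _), integral_sub i0 i1, integral_const_mul, hodd,
      integral_mul_const]
    ring
  rw [e]
  calc _ ≤ ∫ u, M * h ^ 2 * (|L u| * u ^ 2) := by
        refine norm_integral_le_of_norm_le (f := fun u =>
          L u * f (w - h * u) - L u * f w + deriv f w * h * (L u * u)) (i3.const_mul _)
          (ae_of_all _ fun u => ?_)
        by_cases hu : U < |u|
        · simp [hU u hu]
        · have ht := abs_taylor_one_sub_le hf hM (hball u (abs_le.1 (not_lt.1 hu)))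
          have e : L u * f (w - h * u) - L u * f w + deriv f w * h * (L u * u)
              = L u * (f (w + -(h * u)) - f w - deriv f w * -(h * u)) := by
            rw [← sub_eq_add_neg]; ring
          rw [e, norm_mul]
          refine (mul_le_mul_of_nonneg_left ht (norm_nonneg _)).trans (le_of_eq ?_)
          rw [Real.norm_eq_abs]; ring
    _ = _ := by rw [integral_const_mul]; ring

lemma integral_kernel_eq (L f : ℝ → ℝ) (w : ℝ) {h : ℝ} (hh : 0 < h) :
    ∫ s, 1 / h * L ((w - s) / h) * f s = ∫ u, L u * f (w - h * u) := by
  have h1 := Measure.integral_comp_mul_left (fun x => L (x / h) * f (w - x)) h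
  have h2 := integral_sub_left_eq_self (fun x => L (x / h) * f (w - x)) volume w
  simp only [mul_div_cancel_left₀ _ hh.ne', sub_sub_cancel] at h1 h2
  rw [h1, ← h2, abs_of_pos (inv_pos.2 hh), smul_eq_mul, ← integral_const_mul]
  refine integral_congr_ae (ae_of_all _ fun s => ?_)
  simp only [one_div]; ring

namespace Model

variable {Ω : Type*} [MeasurableSpace Ω] {μ : Measure Ω} {𝔸 : Type*} [MeasurableSpace 𝔸]
  (D : Model μ 𝔸)

/-! ### Bias and variance expansions -/

/-- `D.densityAA a b` is the density of the law of `W(a, b, V)`. -/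
lemma integral_comp_W (a b : 𝔸) (φ : ℝ → ℝ) :
    ∫ v, φ (D.W a b v) ∂D.errLaw = ∫ s, φ s * D.densityAA a b s := by
  have hinj := (D.strictMono_W a b).injective
  have hd : ∀ v, HasDerivAt (D.W a b) (deriv (D.W a b) v) v := fun v =>
    ((D.contDiff_W a b).differentiable (by norm_num)).differentiableAt.hasDerivAt
  have hdens : ∀ v, D.densityAA a b (D.W a b v) = D.fV v * |deriv (D.W a b) v|⁻¹ := fun v => by
    unfold densityAA
    rw [Set.indicator_of_mem (Set.mem_range_self v), Function.leftInverse_invFun hinj]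
  have h := integral_image_eq_integral_abs_deriv_smul (f := D.W a b) MeasurableSet.univ
    (fun v _ => (hd v).hasDerivWithinAt) hinj.injOn (fun s => φ s * D.densityAA a b s)
  rw [setIntegral_univ, Set.image_univ] at h
  have hzero : ∀ s, s ∉ Set.range (D.W a b) → φ s * D.densityAA a b s = 0 := fun s hs => by
    unfold densityAA
    rw [Set.indicator_of_notMem hs, mul_zero]
  rw [setIntegral_eq_integral_of_forall_compl_eq_zero hzero] at h
  rw [h]
  unfold errLaw
  rw [integral_withDensity_eq_integral_toReal_smul (by have := D.measurable_fV; fun_prop)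
    (ae_of_all _ fun _ => ENNReal.ofReal_lt_top)]
  refine integral_congr_ae (ae_of_all _ fun v => ?_)
  have hne : |deriv (D.W a b) v| ≠ 0 := abs_ne_zero.2 (D.deriv_W_ne_zero a b v)
  simp only [hdens, ENNReal.toReal_ofReal (D.fV_nonneg v), smul_eq_mul]
  field_simp

/-- Kernel-weighted means of `W(a, b, V)` approximate the conditional density, uniformly in the
attributes. -/
lemma abs_integral_kernel_sub_le {w δ M : ℝ} {a b : 𝔸}
    (hf : ContDiffOn ℝ 2 (D.densityAA a b) (Metric.ball w δ))
    (hM : ∀ s ∈ Metric.ball w δ, |iteratedDeriv 2 (D.densityAA a b) s| ≤ M)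
    {L : ℝ → ℝ} (hL : Measurable L) {Lb U : ℝ} (hb : ∀ u, |L u| ≤ Lb)
    (hU : ∀ u, U < |u| → L u = 0) (hsymm : ∀ u, L (-u) = L u) {h : ℝ} (hh : 0 < h)
    (hhU : h * U < δ) :
    |∫ v, 1 / h * L ((w - D.W a b v) / h) ∂D.errLaw - D.densityAA a b w * ∫ u, L u|
      ≤ M * (∫ u, |L u| * u ^ 2) * h ^ 2 := by
  rw [D.integral_comp_W a b (fun s => 1 / h * L ((w - s) / h)), integral_kernel_eq _ _ _ hh]
  exact abs_integral_smoothing_sub_le hf hM hL hb hU hsymm hh hhU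

/-- Expansions, uniform in the attributes, of the conditional mean and the conditional second
moment of a kernel term for small bandwidths. -/
lemma exists_pair_expansion {K : ℝ → ℝ} (hK : IsKernel K) {w : ℝ} (hw : D.SmoothAt w) :
    ∃ C h₀ : ℝ, 0 < C ∧ 0 < h₀ ∧ h₀ ≤ 1 ∧ (∀ a b, |D.densityAA a b w| ≤ C) ∧
      ∀ h, 0 < h → h < h₀ → ∀ a b,
        |D.pairMean K w h a b - D.densityAA a b w| ≤ C * h ^ 2 ∧
        |h * ∫ v, D.kernFun K w h a b v ^ 2 ∂D.errLaw - D.densityAA a b w * ∫ u, K u ^ 2|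
          ≤ C * h ^ 2 := by
  obtain ⟨δ, hδ, M, hM⟩ := hw
  obtain ⟨Kb, hKb⟩ := hK.bounded
  obtain ⟨U, hU⟩ := hK.support
  have hK2b : ∀ u, |K u ^ 2| ≤ Kb ^ 2 := fun u => by
    rw [abs_pow]; exact pow_le_pow_left₀ (abs_nonneg _) (hKb u) 2
  have hwb : w ∈ Metric.ball w δ := Metric.mem_ball_self hδ
  -- the constants of the second-order expansion for the weights `K` and `K ^ 2`
  set C₁ := M * ∫ u, |K u| * u ^ 2 with hC₁
  set C₂ := M * ∫ u, |K u ^ 2| * u ^ 2 with hC₂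
  refine ⟨|M| + |C₁| + |C₂| + 1, min 1 (δ / (|U| + 1)), by positivity, by positivity,
    min_le_left _ _, fun a b => ?_, fun h hh hh0 a b => ?_⟩
  · have := ((hM a b).2 w hwb).1
    have := le_abs_self M
    have := abs_nonneg C₁; have := abs_nonneg C₂
    linarith
  · have hhU : h * U < δ := by
      have h1 : h * (|U| + 1) < δ :=
        (lt_div_iff₀ (by positivity)).1 (hh0.trans_le (min_le_right _ _))
      nlinarith [le_abs_self U]
    have hM2 : ∀ s ∈ Metric.ball w δ, |iteratedDeriv 2 (D.densityAA a b) s| ≤ M := fun s hs =>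
      ((hM a b).2 s hs).2
    have e1 := D.abs_integral_kernel_sub_le (hM a b).1 hM2 hK.measurable hKb hU hK.symm hh hhU
    have e2 := D.abs_integral_kernel_sub_le (L := fun u => K u ^ 2) (hM a b).1 hM2
      (hK.measurable.pow_const 2) hK2b (fun u hu => by simp [hU u hu])
      (fun u => by rw [hK.symm]) hh hhU
    rw [hK.integral_eq_one, mul_one] at e1
    constructor
    · refine e1.trans ?_
      gcongr
      have := le_abs_self C₁; have := abs_nonneg M; have := abs_nonneg C₂
      linarith
    · have e3 : h * ∫ v, D.kernFun K w h a b v ^ 2 ∂D.errLaw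
          = ∫ v, 1 / h * K ((w - D.W a b v) / h) ^ 2 ∂D.errLaw := by
        rw [← integral_const_mul]
        refine integral_congr_ae (ae_of_all _ fun v => ?_)
        unfold kernFun
        simp only
        field_simp
      rw [e3]
      refine e2.trans ?_
      gcongr
      have := le_abs_self C₂; have := abs_nonneg M; have := abs_nonneg C₁
      linarith

variable [IsProbabilityMeasure μ]

/-- The conditional density is a pointwise limit of the measurable conditional means of the
kernel terms. -/
lemma measurable_densityAA {K : ℝ → ℝ} (hK : IsKernel K) {w : ℝ} (hw : D.SmoothAt w) :
    Measurable (Function.uncurry fun a b => D.densityAA a b w) := by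
  obtain ⟨C, h₀, hC, hh₀, -, -, hexp⟩ := D.exists_pair_expansion hK hw
  set h : ℕ → ℝ := fun k => h₀ * (1 / ((k : ℝ) + 2)) with hh
  have hpos : ∀ k, 0 < h k := fun k => by positivity
  have hlt : ∀ k, h k < h₀ := fun k => by
    have : 1 / ((k : ℝ) + 2) < 1 := by
      rw [div_lt_one (by positivity)]
      linarith [k.cast_nonneg (α := ℝ)]
    exact mul_lt_of_lt_one_right hh₀ this
  have hlim : Tendsto h atTop (𝓝 0) := by
    have h1 : Tendsto (fun k : ℕ => 1 / ((k : ℝ) + 2)) atTop (𝓝 0) := by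
      have := (tendsto_natCast_atTop_atTop (R := ℝ)).atTop_add (tendsto_const_nhds (x := (2 : ℝ)))
      exact tendsto_const_nhds.div_atTop this
    simpa only [mul_zero] using h1.const_mul h₀
  refine measurable_of_tendsto_metrizable
    (f := fun k => Function.uncurry (D.pairMean K w (h k)))
    (fun k => D.measurable_pairMean hK.measurable) (tendsto_pi_nhds.2 fun x => ?_)
  have h2 : Tendsto (fun k => C * h k ^ 2) atTop (𝓝 0) := by
    simpa using (hlim.pow 2).const_mul C
  rw [tendsto_iff_norm_sub_tendsto_zero]
  exact squeeze_zero (fun _ => norm_nonneg _)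
    (fun k => (hexp (h k) (hpos k) (hlt k) x.1 x.2).1) h2

lemma density_eq {K : ℝ → ℝ} (hK : IsKernel K) {w : ℝ} (hw : D.SmoothAt w) :
    D.density w = ∫ a, ∫ b, D.densityAA a b w ∂D.attrLaw ∂D.attrLaw := by
  obtain ⟨C, -, -, -, -, hB, -⟩ := D.exists_pair_expansion hK hw
  exact integral_pair D.iIndepFun_A D.measurable_A D.map_A zero_ne_one
    (D.measurable_densityAA hK hw) hB

lemma densityA_eq {K : ℝ → ℝ} (hK : IsKernel K) {w : ℝ} (hw : D.SmoothAt w) (a : 𝔸) :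
    D.densityA w a = ∫ b, D.densityAA a b w ∂D.attrLaw :=
  integral_single D.measurable_A D.map_A 1 (F := fun b => D.densityAA a b w)
    ((D.measurable_densityAA hK hw).comp measurable_prodMk_left)

lemma measurable_densityA {K : ℝ → ℝ} (hK : IsKernel K) {w : ℝ} (hw : D.SmoothAt w) :
    Measurable (D.densityA w) := by
  have : D.densityA w = fun a => ∫ b, D.densityAA a b w ∂D.attrLaw :=
    funext fun a => D.densityA_eq hK hw a
  rw [this]
  exact measurable_integral_right (D.measurable_densityAA hK hw)

lemma Omega1_eq {K : ℝ → ℝ} (hK : IsKernel K) {w : ℝ} (hw : D.SmoothAt w) :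
    D.Omega1 w
      = ∫ a, (D.densityA w a - ∫ c, D.densityA w c ∂D.attrLaw) ^ 2 ∂D.attrLaw := by
  have hm := D.measurable_densityA hK hw
  unfold Omega1
  rw [variance_eq_integral (X := fun ω => D.densityA w (D.A 0 ω))
    (hm.comp (D.measurable_A 0)).aemeasurable,
    integral_single D.measurable_A D.map_A 0 hm]
  exact integral_single D.measurable_A D.map_A 0
    (F := fun a => (D.densityA w a - ∫ c, D.densityA w c ∂D.attrLaw) ^ 2)
    ((hm.sub_const _).pow_const 2)

lemma abs_integral_sub_integral_le {S : Type*} [MeasurableSpace S] {P : Measure S}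
    [IsProbabilityMeasure P] {f g : S → ℝ} (hf : Integrable f P) (hg : Integrable g P) {ε : ℝ}
    (h : ∀ a, |f a - g a| ≤ ε) : |∫ a, f a ∂P - ∫ a, g a ∂P| ≤ ε := by
  rw [← integral_sub hf hg]
  exact abs_integral_le_of_abs_le h

/-- The expansions of all first and second moments needed for the decomposition. -/
lemma exists_moment_expansion {K : ℝ → ℝ} (hK : IsKernel K) {w : ℝ} (hw : D.SmoothAt w) :
    ∃ C h₀ : ℝ, 0 < C ∧ 0 < h₀ ∧ h₀ ≤ 1 ∧ ∀ h, 0 < h → h < h₀ →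
      (∀ a b, |D.pairMean K w h a b| ≤ C) ∧
      (∀ a b, D.errVar (D.kernErr K w h) a b ≤ C / h) ∧
      |h * D.meanErrVar (D.kernErr K w h) - D.Omega2 K w| ≤ C * h ∧
      |D.nodeVar K w h - D.Omega1 w| ≤ C * h ^ 2 ∧
      |D.T4 K w h| ≤ C * h ^ 2 := by
  obtain ⟨C, h₀, hC, hh₀, hh₁, hB, hexp⟩ := D.exists_pair_expansion hK hw
  obtain ⟨Kb, hKb⟩ := hK.bounded
  have hKm := hK.measurable
  set R := ∫ u, K u ^ 2 with hR
  have hR0 : 0 ≤ R := integral_nonneg fun _ => sq_nonneg _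
  have hfm := D.measurable_densityAA hK hw
  refine ⟨2 * C + C * R + C + (C + (2 * C) ^ 2) + 16 * C ^ 2 + C, h₀, by positivity, hh₀, hh₁,
    fun h hh hhh => ?_⟩
  have hh1 : h ≤ 1 := hhh.le.trans hh₁
  have hsq : h ^ 2 ≤ h := by nlinarith
  have hpm : ∀ a b, |D.pairMean K w h a b| ≤ 2 * C := fun a b => by
    have h1 := abs_le.1 (hexp h hh hhh a b).1
    have h2 := abs_le.1 (hB a b)
    have h3 : C * h ^ 2 ≤ C := mul_le_of_le_one_right hC.le (hsq.trans hh1)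
    rw [abs_le]; constructor <;> linarith
  have hpmm := D.measurable_pairMean (w := w) (h := h) hKm
  -- the conditional variance given a pair of attributes
  have hvar : ∀ a b, |h * D.errVar (D.kernErr K w h) a b - D.densityAA a b w * R|
      ≤ (C + (2 * C) ^ 2) * h := fun a b => by
    rw [D.errVar_kernErr hKm hKb hh]
    have h1 := abs_le.1 (hexp h hh hhh a b).2
    have h2 : D.pairMean K w h a b ^ 2 ≤ (2 * C) ^ 2 :=
      sq_le_sq.2 ((hpm a b).trans (le_abs_self _))
    have h3 : C * h ^ 2 ≤ C * h := mul_le_mul_of_nonneg_left hsq hC.le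
    have h4 : h * D.pairMean K w h a b ^ 2 ≤ h * (2 * C) ^ 2 := by gcongr
    have h5 : 0 ≤ h * D.pairMean K w h a b ^ 2 := by positivity
    have h6 : 0 ≤ h * (2 * C) ^ 2 := by positivity
    rw [abs_le]; constructor <;> nlinarith
  have hvm := D.measurable_errVar (D.measurable_kernErr (w := w) (h := h) hKm)
  have hvb : ∀ a b,
      |h * D.errVar (D.kernErr K w h) a b| ≤ C * R + (C + (2 * C) ^ 2) := fun a b => by
    have h1 := abs_le.1 (hvar a b)
    have h2 : |D.densityAA a b w * R| ≤ C * R := by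
      rw [abs_mul, abs_of_nonneg hR0]; gcongr; exact hB a b
    have h2 := abs_le.1 h2
    have h3 : (C + (2 * C) ^ 2) * h ≤ C + (2 * C) ^ 2 :=
      mul_le_of_le_one_right (by positivity) hh1
    rw [abs_le]; constructor <;> linarith
  have hfR : ∀ a b, |D.densityAA a b w * R| ≤ C * R := fun a b => by
    rw [abs_mul, abs_of_nonneg hR0]; gcongr; exact hB a b
  have hint1 : ∀ {f : 𝔸 → 𝔸 → ℝ} {B : ℝ}, Measurable (Function.uncurry f) → (∀ a b, |f a b| ≤ B) →
      ∀ a, Integrable (f a) D.attrLaw := fun hf hb a =>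
    Integrable.of_bound (hf.comp measurable_prodMk_left).aestronglyMeasurable _
      (ae_of_all _ (hb a))
  have hint2 : ∀ {f : 𝔸 → 𝔸 → ℝ} {B : ℝ}, Measurable (Function.uncurry f) → (∀ a b, |f a b| ≤ B) →
      Integrable (fun a => ∫ b, f a b ∂D.attrLaw) D.attrLaw := fun hf hb =>
    Integrable.of_bound (measurable_integral_right hf).aestronglyMeasurable _
      (ae_of_all _ fun a => abs_integral_le_of_abs_le (hb a))
  have hint3 : ∀ {f g : 𝔸 → 𝔸 → ℝ} {B B' ε : ℝ}, Measurable (Function.uncurry f) →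
      Measurable (Function.uncurry g) → (∀ a b, |f a b| ≤ B) → (∀ a b, |g a b| ≤ B') →
      (∀ a b, |f a b - g a b| ≤ ε) →
      |∫ a, ∫ b, f a b ∂D.attrLaw ∂D.attrLaw - ∫ a, ∫ b, g a b ∂D.attrLaw ∂D.attrLaw| ≤ ε :=
    fun hf hg hb hb' h => abs_integral_sub_integral_le (hint2 hf hb) (hint2 hg hb')
      fun a => abs_integral_sub_integral_le (hint1 hf hb a) (hint1 hg hb' a) (h a)
  have hc1 : 0 ≤ C * R := by positivity
  have hc2 : 0 ≤ C ^ 2 := by positivity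
  have hmean := hint3 hpmm hfm hpm hB fun a b => (hexp h hh hhh a b).1
  refine ⟨fun a b => (hpm a b).trans (by nlinarith), fun a b => ?_, ?_, ?_, ?_⟩
  · rw [le_div_iff₀ hh, mul_comm]
    have := (abs_le.1 (hvb a b)).2
    nlinarith
  · have h1 := hint3 (f := fun a b => h * D.errVar (D.kernErr K w h) a b)
      (g := fun a b => D.densityAA a b w * R) (hvm.const_mul h) (hfm.mul_const R) hvb hfR hvar
    simp_rw [integral_const_mul, integral_mul_const] at h1
    rw [← D.density_eq hK hw] at h1
    exact h1.trans (mul_le_mul_of_nonneg_right (by nlinarith) hh.le)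
  · have hGm := D.measurable_nodeMean (w := w) (h := h) hKm
    have hFm := D.measurable_densityA hK hw
    have hGF : ∀ a, |D.nodeMean K w h a - D.densityA w a| ≤ C * h ^ 2 := fun a => by
      rw [D.densityA_eq hK hw]
      exact abs_integral_sub_integral_le (hint1 hpmm hpm a) (hint1 hfm hB a)
        fun b => (hexp h hh hhh a b).1
    have hFb : ∀ a, |D.densityA w a| ≤ C := fun a => by
      rw [D.densityA_eq hK hw]; exact abs_integral_le_of_abs_le (hB a)
    have hGb : ∀ a, |D.nodeMean K w h a| ≤ 2 * C := fun a => abs_integral_le_of_abs_le (hpm a)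
    have hm : |∫ a, D.nodeMean K w h a ∂D.attrLaw - ∫ a, D.densityA w a ∂D.attrLaw| ≤ C * h ^ 2 :=
      abs_integral_sub_integral_le
        (Integrable.of_bound hGm.aestronglyMeasurable _ (ae_of_all _ hGb))
        (Integrable.of_bound hFm.aestronglyMeasurable _ (ae_of_all _ hFb)) hGF
    have hηb := D.abs_nodeEffect_le (K := K) (w := w) (h := h) hpm
    have hηm := D.measurable_nodeEffect (w := w) (h := h) hKm
    set mF := ∫ a, D.densityA w a ∂D.attrLaw with hmF
    have hmFb : |mF| ≤ C := abs_integral_le_of_abs_le hFb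
    have hζb : ∀ a, |D.densityA w a - mF| ≤ 2 * C := fun a => by
      have := abs_le.1 (hFb a); have := abs_le.1 hmFb
      rw [abs_le]; constructor <;> linarith
    rw [D.Omega1_eq hK hw]
    refine (abs_integral_sub_integral_le (ε := 16 * C ^ 2 * h ^ 2)
      (Integrable.of_bound (C := (2 * (2 * C)) ^ 2) (hηm.pow_const 2).aestronglyMeasurable
        (ae_of_all _ fun a => ?_))
      (Integrable.of_bound (C := (2 * C) ^ 2) ((hFm.sub_const _).pow_const 2).aestronglyMeasurable
        (ae_of_all _ fun a => ?_)) fun a => ?_).trans ?_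
    · rw [norm_pow]; exact pow_le_pow_left₀ (norm_nonneg _) (hηb a) 2
    · rw [norm_pow]; exact pow_le_pow_left₀ (norm_nonneg _) (hζb a) 2
    · have hd : |D.nodeEffect K w h a - (D.densityA w a - mF)| ≤ 2 * C * h ^ 2 := by
        have := abs_le.1 (hGF a); have := abs_le.1 hm
        unfold nodeEffect
        rw [abs_le]; constructor <;> linarith
      have hs : |D.nodeEffect K w h a + (D.densityA w a - mF)| ≤ 8 * C := by
        have := abs_le.1 (hηb a); have := abs_le.1 (hζb a)
        rw [abs_le]; constructor <;> linarith
      rw [sq_sub_sq, abs_mul]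
      calc _ ≤ 8 * C * (2 * C * h ^ 2) := by gcongr
        _ = _ := by ring
    · gcongr
      nlinarith
  · unfold T4
    rw [D.meanKern_eq hKm hKb hh, D.density_eq hK hw]
    refine hmean.trans ?_
    gcongr
    nlinarith

end Model

/-! ### Convergence criteria -/

/-- Convergence of characteristic functions to that of a centered normal law. -/
lemma tendstoNormal_of_tendsto_integral_cexp {Ω : Type*} [MeasurableSpace Ω] {μ : Measure Ω}
    [IsProbabilityMeasure μ] {X : ℕ → Ω → ℝ} (hX : ∀ N, Measurable (X N)) {v : ℝ} (hv : 0 ≤ v)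
    (h : ∀ t : ℝ, Tendsto (fun N => ∫ ω, Complex.exp (Complex.I * ((t * X N ω : ℝ) : ℂ)) ∂μ) atTop
      (𝓝 (Real.exp (-(t ^ 2 * v / 2)) : ℂ))) :
    TendstoNormal μ X v where
  forall_aemeasurable N := (hX N).aemeasurable
  aemeasurable_limit := aemeasurable_id
  tendsto := by
    refine ProbabilityMeasure.tendsto_iff_tendsto_charFun.2 fun t => ?_
    have e1 : ∀ N, charFun (μ.map (X N)) t
        = ∫ ω, Complex.exp (Complex.I * ((t * X N ω : ℝ) : ℂ)) ∂μ := fun N => by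
      rw [charFun_apply_real, integral_map (hX N).aemeasurable (by fun_prop)]
      refine integral_congr_ae (ae_of_all _ fun ω => ?_)
      simp only
      congr 1
      push_cast; ring
    have e2 : charFun ((gaussianReal 0 v.toNNReal).map id) t
        = (Real.exp (-(t ^ 2 * v / 2)) : ℂ) := by
      rw [Measure.map_id, charFun_gaussianReal, Complex.ofReal_exp]
      congr 1
      have : ((v.toNNReal : ℝ) : ℂ) = (v : ℂ) := by rw [Real.coe_toNNReal v hv]
      push_cast
      rw [this]
      ring
    simp only [ProbabilityMeasure.coe_mk]
    rw [e2]
    simp_rw [e1]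
    exact h t

lemma tendstoInMeasure_zero_of_integral_sq {Ω : Type*} [MeasurableSpace Ω] {μ : Measure Ω}
    [IsProbabilityMeasure μ] {X : ℕ → Ω → ℝ} (hX : ∀ N, Measurable (X N))
    (hL : ∀ᶠ N in atTop, MemLp (X N) 2 μ)
    (h : Tendsto (fun N => ∫ ω, X N ω ^ 2 ∂μ) atTop (𝓝 0)) :
    TendstoInMeasure μ X atTop (fun _ => 0) := by
  refine tendstoInMeasure_of_tendsto_eLpNorm (p := 1) one_ne_zero
    (fun N => (hX N).aestronglyMeasurable) aestronglyMeasurable_const ?_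
  have h1 : Tendsto (fun N => ENNReal.ofReal (Real.sqrt (∫ ω, X N ω ^ 2 ∂μ))) atTop (𝓝 0) := by
    have := ENNReal.tendsto_ofReal (h.sqrt)
    simpa using this
  refine tendsto_of_tendsto_of_tendsto_of_le_of_le' tendsto_const_nhds h1
    (Eventually.of_forall fun _ => zero_le) ?_
  filter_upwards [hL] with N hN
  have hi : Integrable (X N) μ := hN.integrable (by norm_num)
  have e : X N - (fun _ => 0) = X N := by funext; simp
  rw [e, eLpNorm_one_eq_lintegral_enorm, ← ofReal_integral_norm_eq_lintegral_enorm hi]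
  exact ENNReal.ofReal_le_ofReal (integral_abs_le_sqrt_integral_sq hN)

lemma TendstoNormal.add_negligible {Ω : Type*} [MeasurableSpace Ω] {μ : Measure Ω}
    [IsProbabilityMeasure μ] {X Y : ℕ → Ω → ℝ} {v : ℝ} {b : ℕ → ℝ} (hX : TendstoNormal μ X v)
    (hY : ∀ N, Measurable (Y N)) (hY0 : TendstoInMeasure μ Y atTop (fun _ => 0))
    (hb : Tendsto b atTop (𝓝 0)) : TendstoNormal μ (fun N ω => X N ω + Y N ω + b N) v := by
  have h1 := TendstoInDistribution.add_of_tendstoInMeasure_const hX hY0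
    (fun N => (hY N).aemeasurable)
  have hb' : TendstoInMeasure μ (fun N (_ : Ω) => b N) atTop (fun _ => 0) :=
    tendstoInMeasure_of_tendsto_ae (fun _ => aestronglyMeasurable_const) (ae_of_all _ fun _ => hb)
  have h2 := TendstoInDistribution.add_of_tendstoInMeasure_const h1 hb'
    (fun N => aemeasurable_const)
  refine TendstoInDistribution.congr (fun N => ?_) ?_ h2
  · exact ae_of_all _ fun ω => rfl
  · exact ae_of_all _ fun ω => by simp

lemma numDyads_pos {N : ℕ} (hN : 2 ≤ N) : 0 < numDyads N := by
  have hN' : (2 : ℝ) ≤ N := by exact_mod_cast hN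
  rw [numDyads_eq]
  have : 0 < (N : ℝ) - 1 := by linarith
  positivity

lemma numDyads_ge {N : ℕ} (hN : 2 ≤ N) : (N : ℝ) ^ 2 / 4 ≤ numDyads N := by
  have hN' : (2 : ℝ) ≤ N := by exact_mod_cast hN
  rw [numDyads_eq]
  nlinarith

lemma tendsto_numDyads_atTop : Tendsto numDyads atTop atTop := by
  have h : Tendsto (fun N : ℕ => (N : ℝ) / 2) atTop atTop :=
    (tendsto_natCast_atTop_atTop).atTop_div_const (by norm_num)
  refine tendsto_atTop_mono' _ ?_ h
  filter_upwards [eventually_ge_atTop 2] with N hN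
  have hN' : (2 : ℝ) ≤ N := by exact_mod_cast hN
  have := numDyads_ge hN
  nlinarith

lemma tendsto_numDyads_mul_bandwidth {h : ℕ → ℝ}
    (h_lower : ∃ C > 0, ∀ᶠ N : ℕ in atTop, C ≤ N * h N) :
    Tendsto (fun N => numDyads N * h N) atTop atTop := by
  obtain ⟨C, hC, hN⟩ := h_lower
  have h1 : Tendsto (fun N : ℕ => C / 4 * (N : ℝ)) atTop atTop :=
    (tendsto_natCast_atTop_atTop).const_mul_atTop (by positivity)
  refine tendsto_atTop_mono' _ ?_ h1
  filter_upwards [hN, eventually_ge_atTop 2] with N hN h2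
  have hN' : (2 : ℝ) ≤ N := by exact_mod_cast h2
  rw [numDyads_eq]
  calc C / 4 * N ≤ C * (((N : ℝ) - 1) / 2) := by nlinarith
    _ ≤ N * h N * (((N : ℝ) - 1) / 2) := by
      have : 0 ≤ ((N : ℝ) - 1) / 2 := by linarith
      gcongr
    _ = _ := by ring

/-! ### The error of the normal approximation -/

/-- The bound of `norm_charFun_combination_sub_le`, for the coefficients `a / n` and `2 a / N` with
`a ^ 2 ≤ C' n h`, where `a ^ 2 τ / N ≤ B`. Here `x` stands for `N`; the terms on the right are small
as soon as `n h`, `n` and `N` are large and `h` is small. -/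
lemma charFun_error_le {t a C C' Kb h τ B n x : ℝ} (hC : 0 ≤ C) (hC' : 0 ≤ C') (hKb : 0 ≤ Kb)
    (hh : 0 < h) (hτ : 0 ≤ τ) (hx : 2 ≤ x) (hn : n = x * (x - 1) / 2)
    (ha : a ^ 2 ≤ C' * (n * h)) (hB : a ^ 2 * τ / x ≤ B) :
    n * (4 * |t * (a / n)| ^ 3 * (2 * (Kb / h)) * (C / h) + (t * (a / n)) ^ 4 * (C / h) ^ 2)
      + (t * (a / n)) ^ 2 / 2 * Real.sqrt (24 * (C / h) ^ 2 * x ^ 3)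
      + x * (4 * |t * (2 * a / x)| ^ 3 * (2 * C) * τ + (t * (2 * a / x)) ^ 4 * τ ^ 2)
    ≤ 8 * |t| ^ 3 * Kb * C * Real.sqrt C' ^ 3 * (1 / Real.sqrt (n * h))
      + t ^ 4 * C ^ 2 * C' ^ 2 * (1 / n) + 10 * t ^ 2 * C' * C * (1 / Real.sqrt x)
      + 64 * |t| ^ 3 * C * B * Real.sqrt C' * Real.sqrt h + 16 * t ^ 4 * B ^ 2 * (1 / x) := by
  have hx0 : 0 < x := by linarith
  have hx1 : 0 < x - 1 := by linarith
  have hn0 : 0 < n := by rw [hn]; positivity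
  have hnx : x ^ 2 / 4 ≤ n := by rw [hn]; nlinarith
  have hnx' : n ≤ x ^ 2 := by rw [hn]; nlinarith
  set y := Real.sqrt (n * h) with hy
  have hnh : 0 < n * h := by positivity
  have hy0 : 0 < y := Real.sqrt_pos.2 hnh
  have hy2 : y ^ 2 = n * h := Real.sq_sqrt hnh.le
  set c := Real.sqrt C' with hc
  have hc0 : 0 ≤ c := Real.sqrt_nonneg _
  have hc2 : c ^ 2 = C' := Real.sq_sqrt hC'
  have habs : |a| ≤ c * y := by
    refine abs_le_of_sq_le_sq ?_ (by positivity)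
    rw [mul_pow, hc2, hy2]; exact ha
  have hr0 : 0 < Real.sqrt x := Real.sqrt_pos.2 hx0
  have hr2 : Real.sqrt x ^ 2 = x := Real.sq_sqrt hx0.le
  have hB0 : 0 ≤ B := le_trans (by positivity) hB
  have t1 : n * (4 * |t * (a / n)| ^ 3 * (2 * (Kb / h)) * (C / h))
      ≤ 8 * |t| ^ 3 * Kb * C * c ^ 3 * (1 / y) := by
    have e : n * (4 * |t * (a / n)| ^ 3 * (2 * (Kb / h)) * (C / h))
        = 8 * |t| ^ 3 * Kb * C * (|a| ^ 3 / (n * h) ^ 2) := by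
      rw [abs_mul, abs_div, abs_of_pos hn0]
      field_simp
      ring
    have e2 : |a| ^ 3 / (n * h) ^ 2 ≤ c ^ 3 * (1 / y) := by
      rw [← hy2]
      calc |a| ^ 3 / (y ^ 2) ^ 2 ≤ (c * y) ^ 3 / (y ^ 2) ^ 2 := by gcongr
        _ = c ^ 3 * (1 / y) := by field_simp
    rw [e, mul_assoc _ (c ^ 3)]
    gcongr
  have t2 : n * ((t * (a / n)) ^ 4 * (C / h) ^ 2) ≤ t ^ 4 * C ^ 2 * C' ^ 2 * (1 / n) := by
    have e : n * ((t * (a / n)) ^ 4 * (C / h) ^ 2)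
        = t ^ 4 * C ^ 2 * ((a ^ 2) ^ 2 / (n * h) ^ 2) * (1 / n) := by
      field_simp
    have e2 : (a ^ 2) ^ 2 / (n * h) ^ 2 ≤ C' ^ 2 := by
      rw [div_le_iff₀ (by positivity), ← mul_pow]
      gcongr
    rw [e]
    gcongr
  have t3 : (t * (a / n)) ^ 2 / 2 * Real.sqrt (24 * (C / h) ^ 2 * x ^ 3)
      ≤ 10 * t ^ 2 * C' * C * (1 / Real.sqrt x) := by
    have e1 : Real.sqrt (24 * (C / h) ^ 2 * x ^ 3) ≤ 5 * (C / h) * x * Real.sqrt x := by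
      refine Real.sqrt_le_iff.2 ⟨by positivity, ?_⟩
      have : (5 * (C / h) * x * Real.sqrt x) ^ 2 = 25 * (C / h) ^ 2 * x ^ 3 := by
        rw [mul_pow, hr2]; ring
      rw [this]
      gcongr
      norm_num
    calc _ ≤ (t * (a / n)) ^ 2 / 2 * (5 * (C / h) * x * Real.sqrt x) := by gcongr
      _ = t ^ 2 * (a ^ 2) / n ^ 2 / 2 * (5 * (C / h) * x * Real.sqrt x) := by ring
      _ ≤ t ^ 2 * (C' * (n * h)) / n ^ 2 / 2 * (5 * (C / h) * x * Real.sqrt x) := by gcongr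
      _ = 5 / 2 * t ^ 2 * C' * C * (x * Real.sqrt x / n) := by field_simp
      _ ≤ 5 / 2 * t ^ 2 * C' * C * (4 * (1 / Real.sqrt x)) := by
        gcongr
        rw [div_le_iff₀ hn0, mul_one_div, div_mul_eq_mul_div, le_div_iff₀ hr0]
        nlinarith
      _ = _ := by ring
  have t4 : x * (4 * |t * (2 * a / x)| ^ 3 * (2 * C) * τ)
      ≤ 64 * |t| ^ 3 * C * B * c * Real.sqrt h := by
    have e : x * (4 * |t * (2 * a / x)| ^ 3 * (2 * C) * τ)
        = 64 * |t| ^ 3 * C * (a ^ 2 * τ / x) * (|a| / x) := by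
      rw [abs_mul, abs_div, abs_mul, abs_of_pos hx0, ← sq_abs a]
      simp only [Nat.abs_ofNat]
      field_simp
      ring
    have e2 : |a| / x ≤ c * Real.sqrt h := by
      rw [div_le_iff₀ hx0]
      refine habs.trans ?_
      rw [mul_assoc]
      gcongr
      refine Real.sqrt_le_iff.2 ⟨by positivity, ?_⟩
      rw [mul_pow, Real.sq_sqrt hh.le, mul_comm]
      gcongr
    rw [e, mul_assoc _ c]
    gcongr
  have t5 : x * ((t * (2 * a / x)) ^ 4 * τ ^ 2) ≤ 16 * t ^ 4 * B ^ 2 * (1 / x) := by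
    have e : x * ((t * (2 * a / x)) ^ 4 * τ ^ 2) = 16 * t ^ 4 * (a ^ 2 * τ / x) ^ 2 * (1 / x) := by
      field_simp
      ring
    rw [e]
    gcongr
  rw [mul_add, mul_add]
  linarith

namespace Model

variable {Ω : Type*} [MeasurableSpace Ω] {μ : Measure Ω} {𝔸 : Type*} [MeasurableSpace 𝔸]
  (D : Model μ 𝔸) {K : ℝ → ℝ} {w : ℝ} {h : ℕ → ℝ}

/-! ### Asymptotics along a sequence of bandwidths -/

lemma measurable_condKern1 (b : ℝ) (i j : ℕ) : Measurable (D.condKern1 K w b i j) :=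
  (stronglyMeasurable_condExp.mono (D.sigmaA_le i)).measurable

lemma measurable_condKern2 (b : ℝ) (i j : ℕ) : Measurable (D.condKern2 K w b i j) :=
  (stronglyMeasurable_condExp.mono (sup_le (D.sigmaA_le i) (D.sigmaA_le j))).measurable

lemma measurable_T1 (hK : Measurable K) (b : ℝ) (N : ℕ) : Measurable (D.T1 K w b N) := by
  unfold T1
  simp_rw [dyadSum_eq_sum_dyads]
  exact (Finset.measurable_sum _ fun p _ => (D.measurable_kern hK p.2.ne).sub
    (D.measurable_condKern2 b _ _)).const_mul _

lemma measurable_T3 (b : ℝ) (N : ℕ) : Measurable (D.T3 K w b N) :=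
  (Finset.measurable_sum _ fun i _ => (D.measurable_condKern1 b i _).sub_const _).const_mul _

lemma measurable_T2 (b : ℝ) (N : ℕ) : Measurable (D.T2 K w b N) := by
  have h3 := D.measurable_T3 (K := K) (w := w) b N
  unfold T2
  simp_rw [dyadSum_eq_sum_dyads]
  exact ((Finset.measurable_sum _ fun p _ => D.measurable_condKern2 b _ _).const_mul _).sub
    (h3.const_add _)

lemma sigmaSq_nonneg (b : ℝ) (N : ℕ) : 0 ≤ D.sigmaSq K w b N := integral_nonneg fun _ => sq_nonneg _

variable [IsProbabilityMeasure μ]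

lemma memLp_T2 (hK : IsKernel K) {b : ℝ} (hb : 0 < b) {N : ℕ} (hN : 2 ≤ N) :
    MemLp (D.T2 K w b N) 2 μ := by
  obtain ⟨Kb, hKb⟩ := hK.bounded
  refine MemLp.of_bound (D.measurable_T2 b N).aestronglyMeasurable
    (‖1 / numDyads N‖ * ∑ _p ∈ dyads N, 4 * (Kb / b)) ?_
  filter_upwards [D.T2_ae_eq (w := w) hK.measurable hKb hb hN] with ω hω
  rw [hω, norm_mul]
  gcongr
  exact (norm_sum_le _ _).trans (Finset.sum_le_sum fun p _ =>
    abs_degeneratePart_le (D.abs_pairMean_le hKb hb) _ _)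

/-- The moment expansions hold along any sequence of bandwidths that tends to zero. -/
lemma eventually_moment_expansion (hK : IsKernel K) (hw : D.SmoothAt w) (h_pos : ∀ N, 0 < h N)
    (h_lim : Tendsto h atTop (𝓝 0)) :
    ∃ C, 0 < C ∧ ∀ᶠ N in atTop, 2 ≤ N ∧ h N ≤ 1 ∧
      (∀ a b, |D.pairMean K w (h N) a b| ≤ C) ∧
      (∀ a b, D.errVar (D.kernErr K w (h N)) a b ≤ C / h N) ∧
      |h N * D.meanErrVar (D.kernErr K w (h N)) - D.Omega2 K w| ≤ C * h N ∧
      |D.nodeVar K w (h N) - D.Omega1 w| ≤ C * h N ^ 2 ∧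
      |D.T4 K w (h N)| ≤ C * h N ^ 2 := by
  obtain ⟨C, h₀, hC, hh₀, hh₁, hexp⟩ := D.exists_moment_expansion hK hw
  refine ⟨C, hC, ?_⟩
  filter_upwards [h_lim.eventually_lt_const hh₀, eventually_ge_atTop 2] with N hN h2
  exact ⟨h2, hN.le.trans hh₁, hexp (h N) (h_pos N) hN⟩

lemma sq_mul_sigmaSq_eq (hK : IsKernel K) {b : ℝ} (hb : 0 < b) {N : ℕ} (hN : 2 ≤ N) (a : ℝ) :
    a ^ 2 * D.sigmaSq K w b N
      = (a / numDyads N) ^ 2 * (numDyads N * D.meanErrVar (D.kernErr K w b))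
        + (2 * a / N) ^ 2 * (N * D.nodeVar K w b) := by
  obtain ⟨Kb, hKb⟩ := hK.bounded
  rw [D.sigmaSq_eq hK.measurable hKb hb hN]
  have hn := numDyads_pos hN
  have hN0 : (0 : ℝ) < N := by exact_mod_cast (by omega : 0 < N)
  field_simp
  ring

lemma tendsto_bandwidth_mul_meanErrVar (hK : IsKernel K) (hw : D.SmoothAt w)
    (h_pos : ∀ N, 0 < h N) (h_lim : Tendsto h atTop (𝓝 0)) :
    Tendsto (fun N => h N * D.meanErrVar (D.kernErr K w (h N))) atTop (𝓝 (D.Omega2 K w)) := by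
  obtain ⟨C, -, hexp⟩ := D.eventually_moment_expansion hK hw h_pos h_lim
  rw [tendsto_iff_norm_sub_tendsto_zero]
  refine squeeze_zero' (Eventually.of_forall fun _ => norm_nonneg _)
    (hexp.mono fun N hN => hN.2.2.2.2.1) ?_
  simpa using h_lim.const_mul C

lemma tendsto_nodeVar (hK : IsKernel K) (hw : D.SmoothAt w)
    (h_pos : ∀ N, 0 < h N) (h_lim : Tendsto h atTop (𝓝 0)) :
    Tendsto (fun N => D.nodeVar K w (h N)) atTop (𝓝 (D.Omega1 w)) := by
  obtain ⟨C, -, hexp⟩ := D.eventually_moment_expansion hK hw h_pos h_lim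
  rw [tendsto_iff_norm_sub_tendsto_zero]
  refine squeeze_zero' (Eventually.of_forall fun _ => norm_nonneg _)
    (hexp.mono fun N hN => hN.2.2.2.2.2.1) ?_
  simpa using (h_lim.pow 2).const_mul C

/-- Central limit theorem for the two leading terms under any normalization `a` of order at most
`√(n h)` that stabilizes the variance; the limit variance may be zero. -/
lemma tendstoNormal_leading (hK : IsKernel K) (hw : D.SmoothAt w) (h_pos : ∀ N, 0 < h N)
    (h_lim : Tendsto h atTop (𝓝 0)) (h_lower : ∃ C > 0, ∀ᶠ N : ℕ in atTop, C ≤ N * h N)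
    {a : ℕ → ℝ} {C' : ℝ} (ha : ∀ᶠ N in atTop, a N ^ 2 ≤ C' * (numDyads N * h N)) {v : ℝ}
    (hv : Tendsto (fun N => a N ^ 2 * D.sigmaSq K w (h N) N) atTop (𝓝 v)) :
    TendstoNormal μ (fun N ω => a N * (D.T1 K w (h N) N ω + D.T3 K w (h N) N ω)) v := by
  obtain ⟨C, hC, hexp⟩ := D.eventually_moment_expansion hK hw h_pos h_lim
  obtain ⟨Kb, hKb⟩ := hK.bounded
  have hKm := hK.measurable
  have hKb0 : 0 ≤ Kb := (abs_nonneg _).trans (hKb 0)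
  have hv0 : 0 ≤ v := ge_of_tendsto' hv fun N => mul_nonneg (sq_nonneg _) (D.sigmaSq_nonneg _ _)
  -- forced by `ha`, since `n h` is positive
  have hC'0 : 0 ≤ C' := by
    obtain ⟨N, h1, h2, -⟩ := (ha.and hexp).exists
    exact nonneg_of_mul_nonneg_left ((sq_nonneg _).trans h1) (mul_pos (numDyads_pos h2) (h_pos N))
  refine tendstoNormal_of_tendsto_integral_cexp (fun N => ((D.measurable_T1 hKm _ N).add
    (D.measurable_T3 _ N)).const_mul _) hv0 fun t => ?_
  have hexpv : Tendsto (fun N => (Real.exp (-(t ^ 2 * (a N ^ 2 * D.sigmaSq K w (h N) N) / 2)) : ℂ))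
      atTop (𝓝 (Real.exp (-(t ^ 2 * v / 2)) : ℂ)) :=
    (Complex.continuous_ofReal.tendsto _).comp ((Real.continuous_exp.tendsto _).comp
      (((hv.const_mul (t ^ 2)).div_const 2).neg))
  set ε : ℕ → ℝ := fun N =>
    8 * |t| ^ 3 * Kb * C * Real.sqrt C' ^ 3 * (1 / Real.sqrt (numDyads N * h N))
      + t ^ 4 * C ^ 2 * C' ^ 2 * (1 / numDyads N) + 10 * t ^ 2 * C' * C * (1 / Real.sqrt N)
      + 64 * |t| ^ 3 * C * (v + 1) * Real.sqrt C' * Real.sqrt (h N)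
      + 16 * t ^ 4 * (v + 1) ^ 2 * (1 / N) with hε
  have hε0 : Tendsto ε atTop (𝓝 0) := by
    have l1 : Tendsto (fun N => 1 / Real.sqrt (numDyads N * h N)) atTop (𝓝 0) :=
      tendsto_const_nhds.div_atTop
        (Real.tendsto_sqrt_atTop.comp (tendsto_numDyads_mul_bandwidth h_lower))
    have l2 : Tendsto (fun N => 1 / numDyads N) atTop (𝓝 0) :=
      tendsto_const_nhds.div_atTop tendsto_numDyads_atTop
    have l3 : Tendsto (fun N : ℕ => 1 / Real.sqrt N) atTop (𝓝 0) :=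
      tendsto_const_nhds.div_atTop (Real.tendsto_sqrt_atTop.comp tendsto_natCast_atTop_atTop)
    have l4 : Tendsto (fun N => Real.sqrt (h N)) atTop (𝓝 0) := by simpa using h_lim.sqrt
    have l5 : Tendsto (fun N : ℕ => 1 / (N : ℝ)) atTop (𝓝 0) :=
      tendsto_const_nhds.div_atTop tendsto_natCast_atTop_atTop
    have := ((((l1.const_mul (8 * |t| ^ 3 * Kb * C * Real.sqrt C' ^ 3)).add
      (l2.const_mul (t ^ 4 * C ^ 2 * C' ^ 2))).add (l3.const_mul (10 * t ^ 2 * C' * C))).add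
      (l4.const_mul (64 * |t| ^ 3 * C * (v + 1) * Real.sqrt C'))).add
      (l5.const_mul (16 * t ^ 4 * (v + 1) ^ 2))
    simpa only [mul_zero, add_zero] using this
  have hdiff : Tendsto (fun N => (∫ ω, Complex.exp (Complex.I *
        ((t * (a N * (D.T1 K w (h N) N ω + D.T3 K w (h N) N ω)) : ℝ) : ℂ)) ∂μ)
      - (Real.exp (-(t ^ 2 * (a N ^ 2 * D.sigmaSq K w (h N) N) / 2)) : ℂ)) atTop (𝓝 0) := by
    refine squeeze_zero_norm' ?_ hε0
    filter_upwards [ha, hexp, hv.eventually_lt_const (lt_add_one v)] with N haN hN hvN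
    obtain ⟨h2, -, hpm, hS, -, -, -⟩ := hN
    have hh := h_pos N
    have hN' : (2 : ℝ) ≤ N := by exact_mod_cast h2
    have hN0 : (0 : ℝ) < N := by linarith
    have hvar := D.sq_mul_sigmaSq_eq (w := w) hK hh h2 (a N)
    have hτ0 : 0 ≤ D.nodeVar K w (h N) := D.nodeVar_nonneg
    have hB : a N ^ 2 * D.nodeVar K w (h N) / N ≤ v + 1 := by
      have h1 : 0 ≤ (a N / numDyads N) ^ 2 *
          (numDyads N * D.meanErrVar (D.kernErr K w (h N))) :=
        mul_nonneg (sq_nonneg _) (mul_nonneg (numDyads_pos h2).le D.meanErrVar_nonneg)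
      have h3 : (2 * a N / N) ^ 2 * (N * D.nodeVar K w (h N))
          = 4 * (a N ^ 2 * D.nodeVar K w (h N) / N) := by
        field_simp
        ring
      have h4 : 0 ≤ a N ^ 2 * D.nodeVar K w (h N) / N := by positivity
      linarith
    have hbound := D.norm_charFun_combination_sub_le (D.measurable_kernErr (w := w) hKm)
      D.kernErr_symm
      (D.abs_kernErr_le hKb hh) (D.integral_kernErr hKm hKb hh) (D.measurable_nodeEffect hKm)
      (D.abs_nodeEffect_le hpm) (D.integral_nodeEffect hKm hKb hh) hS (by positivity)
      (a N / numDyads N) (2 * a N / N) t N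
    rw [hvar]
    have e : ∫ ω, Complex.exp (Complex.I *
          ((t * (a N * (D.T1 K w (h N) N ω + D.T3 K w (h N) N ω)) : ℝ) : ℂ)) ∂μ
        = ∫ ω, Complex.exp (Complex.I *
          ((t * (a N / numDyads N * D.errSum (D.kernErr K w (h N)) N ω
            + 2 * a N / N * D.attrSum (D.nodeEffect K w (h N)) N ω) : ℝ) : ℂ)) ∂μ := by
      refine integral_congr_ae ?_
      filter_upwards [D.T1_ae_eq (w := w) hKm hKb hh N, D.T3_ae_eq (w := w) hKm hKb hh h2]
        with ω e1 e3
      rw [e1, e3]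
      congr 3
      ring
    rw [e]
    exact hbound.trans (charFun_error_le hC.le hC'0 hKb0 hh hτ0 hN' (numDyads_eq N) haN hB)
  have := hdiff.add hexpv
  simpa using this

lemma tendstoInMeasure_T2 (hK : IsKernel K) (hw : D.SmoothAt w) (h_pos : ∀ N, 0 < h N)
    (h_lim : Tendsto h atTop (𝓝 0)) {a : ℕ → ℝ} {C' : ℝ}
    (ha : ∀ᶠ N in atTop, a N ^ 2 ≤ C' * (numDyads N * h N)) :
    TendstoInMeasure μ (fun N ω => a N * D.T2 K w (h N) N ω) atTop (fun _ => 0) := by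
  obtain ⟨C, hC, hexp⟩ := D.eventually_moment_expansion hK hw h_pos h_lim
  obtain ⟨Kb, hKb⟩ := hK.bounded
  refine tendstoInMeasure_zero_of_integral_sq (fun N => (D.measurable_T2 _ N).const_mul _)
    ((eventually_ge_atTop 2).mono fun N hN => (D.memLp_T2 hK (h_pos N) hN).const_mul _) ?_
  have hlim : Tendsto (fun N => C' * (4 * C) ^ 2 * h N) atTop (𝓝 0) := by
    simpa using h_lim.const_mul (C' * (4 * C) ^ 2)
  refine squeeze_zero' (Eventually.of_forall fun _ => integral_nonneg fun _ => sq_nonneg _) ?_ hlim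
  filter_upwards [ha, hexp] with N haN hN
  have hn := numDyads_pos hN.1
  simp_rw [mul_pow]
  rw [integral_const_mul]
  calc _ ≤ C' * (numDyads N * h N) * ((4 * C) ^ 2 / numDyads N) :=
        mul_le_mul haN (D.integral_T2_sq_le hK.measurable hKb (h_pos N) hN.2.2.1 hN.1)
          (integral_nonneg fun _ => sq_nonneg _) ((sq_nonneg _).trans haN)
    _ = _ := by field_simp

/-- Central limit theorem for the estimator, under a normalization for which moreover the bias is
negligible. -/
lemma tendstoNormal_estimator (hK : IsKernel K) (hw : D.SmoothAt w) (h_pos : ∀ N, 0 < h N)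
    (h_lim : Tendsto h atTop (𝓝 0)) (h_lower : ∃ C > 0, ∀ᶠ N : ℕ in atTop, C ≤ N * h N)
    {a : ℕ → ℝ} {C' : ℝ} (ha : ∀ᶠ N in atTop, a N ^ 2 ≤ C' * (numDyads N * h N)) {v : ℝ}
    (hv : Tendsto (fun N => a N ^ 2 * D.sigmaSq K w (h N) N) atTop (𝓝 v))
    (hbias : Tendsto (fun N => a N * D.T4 K w (h N)) atTop (𝓝 0)) :
    TendstoNormal μ (fun N ω => a N * (D.fHat K w (h N) N ω - D.density w)) v := by
  have h1 := (D.tendstoNormal_leading hK hw h_pos h_lim h_lower ha hv).add_negligible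
    (fun N => (D.measurable_T2 _ N).const_mul _) (D.tendstoInMeasure_T2 hK hw h_pos h_lim ha) hbias
  refine TendstoInDistribution.congr (fun N => ae_of_all _ fun ω => ?_)
    (ae_of_all _ fun _ => rfl) h1
  simp only
  rw [D.fHat_sub_density_eq]
  ring

lemma tendsto_mul_T4 (hK : IsKernel K) (hw : D.SmoothAt w) (h_pos : ∀ N, 0 < h N)
    (h_lim : Tendsto h atTop (𝓝 0)) {a : ℕ → ℝ}
    (ha : Tendsto (fun N => a N ^ 2 * h N ^ 4) atTop (𝓝 0)) :
    Tendsto (fun N => a N * D.T4 K w (h N)) atTop (𝓝 0) := by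
  obtain ⟨C, hC, hexp⟩ := D.eventually_moment_expansion hK hw h_pos h_lim
  have h1 : Tendsto (fun N => C * Real.sqrt (a N ^ 2 * h N ^ 4)) atTop (𝓝 0) := by
    simpa using ha.sqrt.const_mul C
  refine squeeze_zero_norm' (hexp.mono fun N hN => ?_) h1
  have e : Real.sqrt (a N ^ 2 * h N ^ 4) = |a N| * h N ^ 2 := by
    rw [show a N ^ 2 * h N ^ 4 = (a N * h N ^ 2) ^ 2 by ring, Real.sqrt_sq_eq_abs, abs_mul,
      abs_of_nonneg (sq_nonneg (h N))]
  rw [e, norm_mul, Real.norm_eq_abs, Real.norm_eq_abs]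
  calc |a N| * |D.T4 K w (h N)| ≤ |a N| * (C * h N ^ 2) := by gcongr; exact hN.2.2.2.2.2.2
    _ = _ := by ring

lemma sigmaSq_expansion_isBigO (hK : IsKernel K) (hw : D.SmoothAt w) (h_pos : ∀ N, 0 < h N)
    (h_lim : Tendsto h atTop (𝓝 0)) :
    (fun N : ℕ => D.sigmaSq K w (h N) N - (D.Omega2 K w / (numDyads N * h N) + 4 * D.Omega1 w / N))
      =O[atTop] (fun N : ℕ => 1 / numDyads N + h N ^ 2 / N) := by
  obtain ⟨C, hC, hexp⟩ := D.eventually_moment_expansion hK hw h_pos h_lim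
  obtain ⟨Kb, hKb⟩ := hK.bounded
  refine IsBigO.of_bound (4 * C) (hexp.mono fun N hN => ?_)
  obtain ⟨h2, -, -, -, hE, hV, -⟩ := hN
  have hn := numDyads_pos h2
  have hh := h_pos N
  have hN0 : (0 : ℝ) < N := by exact_mod_cast (by omega : 0 < N)
  rw [D.sigmaSq_eq hK.measurable hKb hh h2]
  have e : D.meanErrVar (D.kernErr K w (h N)) / numDyads N + 4 * D.nodeVar K w (h N) / N
      - (D.Omega2 K w / (numDyads N * h N) + 4 * D.Omega1 w / N)
      = (h N * D.meanErrVar (D.kernErr K w (h N)) - D.Omega2 K w) / (numDyads N * h N)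
        + 4 * (D.nodeVar K w (h N) - D.Omega1 w) / N := by
    field_simp
    ring
  rw [e, Real.norm_eq_abs, Real.norm_eq_abs,
    abs_of_nonneg (a := 1 / numDyads N + h N ^ 2 / N) (by positivity)]
  calc _ ≤ C * h N / (numDyads N * h N) + 4 * (C * h N ^ 2) / N := by
        refine (abs_add_le _ _).trans (add_le_add ?_ ?_)
        · rw [abs_div, abs_of_pos (mul_pos hn hh)]
          gcongr
        · rw [abs_div, abs_mul, abs_of_pos hN0, Nat.abs_ofNat]
          gcongr
    _ = C * (1 / numDyads N) + 4 * C * (h N ^ 2 / N) := by field_simp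
    _ ≤ 4 * C * (1 / numDyads N) + 4 * C * (h N ^ 2 / N) := by
        have : 0 ≤ C * (1 / numDyads N) := by positivity
        linarith
    _ = _ := by ring

lemma numDyads_mul_sigmaSq_eq (hK : IsKernel K) {b : ℝ} (hb : 0 < b) {N : ℕ} (hN : 2 ≤ N) :
    numDyads N * b * D.sigmaSq K w b N
      = b * D.meanErrVar (D.kernErr K w b) + 2 * ((N : ℝ) - 1) * b * D.nodeVar K w b := by
  obtain ⟨Kb, hKb⟩ := hK.bounded
  rw [D.sigmaSq_eq hK.measurable hKb hb hN]
  have hN' : (2 : ℝ) ≤ N := by exact_mod_cast hN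
  have hN1 : (N : ℝ) - 1 ≠ 0 := by linarith
  have hN0 : (N : ℝ) ≠ 0 := by linarith
  rw [numDyads_eq]
  field_simp
  ring

lemma natCast_mul_sigmaSq_eq (hK : IsKernel K) {b : ℝ} (hb : 0 < b) {N : ℕ} (hN : 2 ≤ N) :
    N * D.sigmaSq K w b N
      = 2 * (b * D.meanErrVar (D.kernErr K w b)) * (N * b - b)⁻¹ + 4 * D.nodeVar K w b := by
  obtain ⟨Kb, hKb⟩ := hK.bounded
  rw [D.sigmaSq_eq hK.measurable hKb hb hN]
  have hN' : (2 : ℝ) ≤ N := by exact_mod_cast hN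
  have hN1 : (N : ℝ) - 1 ≠ 0 := by linarith
  have hN0 : (N : ℝ) ≠ 0 := by linarith
  have e : (N : ℝ) * b - b = (N - 1) * b := by ring
  rw [numDyads_eq, e]
  field_simp

/-- The variance of the leading terms is at least of the order `1 / (n h)`: if `Ω₁ > 0` because of
the attribute effects, whose contribution `≍ 1 / N` is at least that large when `N h ≥ C₀`, and if
`Ω₂ > 0` because of the dyad errors. -/
lemma exists_sigmaSq_lower_bound (hK : IsKernel K) (hw : D.SmoothAt w) (h_pos : ∀ N, 0 < h N)
    (h_lim : Tendsto h atTop (𝓝 0)) (h_lower : ∃ C > 0, ∀ᶠ N : ℕ in atTop, C ≤ N * h N)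
    (hΩ : 0 < D.Omega1 w ∨ 0 < D.Omega2 K w) :
    ∃ c > 0, ∀ᶠ N in atTop, c ≤ numDyads N * h N * D.sigmaSq K w (h N) N := by
  rcases hΩ with hΩ | hΩ
  · obtain ⟨C₀, hC₀, hN0⟩ := h_lower
    refine ⟨C₀ * (D.Omega1 w / 2), by positivity, ?_⟩
    filter_upwards [(D.tendsto_nodeVar hK hw h_pos h_lim).eventually_const_lt (half_lt_self hΩ),
      eventually_ge_atTop 2, hN0] with N h1 h2 h3
    have hN' : (2 : ℝ) ≤ N := by exact_mod_cast h2
    have hh := h_pos N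
    rw [D.numDyads_mul_sigmaSq_eq hK hh h2]
    have h4 : 0 ≤ h N * D.meanErrVar (D.kernErr K w (h N)) :=
      mul_nonneg hh.le D.meanErrVar_nonneg
    have h5 : C₀ ≤ 2 * ((N : ℝ) - 1) * h N := by nlinarith
    have h6 : C₀ * (D.Omega1 w / 2) ≤ 2 * ((N : ℝ) - 1) * h N * D.nodeVar K w (h N) :=
      mul_le_mul h5 h1.le (by positivity) (hC₀.le.trans h5)
    linarith
  · refine ⟨D.Omega2 K w / 2, by positivity, ?_⟩
    filter_upwards [(D.tendsto_bandwidth_mul_meanErrVar hK hw h_pos h_lim).eventually_const_lt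
      (half_lt_self hΩ), eventually_ge_atTop 2] with N h1 h2
    have hN' : (2 : ℝ) ≤ N := by exact_mod_cast h2
    have hh := h_pos N
    rw [D.numDyads_mul_sigmaSq_eq hK hh h2]
    have h4 : 0 ≤ 2 * ((N : ℝ) - 1) * h N * D.nodeVar K w (h N) :=
      mul_nonneg (mul_nonneg (by linarith) hh.le) D.nodeVar_nonneg
    linarith

/-- Under the lower bound on the variance, `1 / σ_N` is an admissible normalization. -/
lemma standardization_admissible (hK : IsKernel K) (hw : D.SmoothAt w) (h_pos : ∀ N, 0 < h N)
    (h_lim : Tendsto h atTop (𝓝 0)) (h_lower : ∃ C > 0, ∀ᶠ N : ℕ in atTop, C ≤ N * h N)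
    (hΩ : 0 < D.Omega1 w ∨ 0 < D.Omega2 K w) :
    (∃ C', ∀ᶠ N in atTop, (1 / D.sigma K w (h N) N) ^ 2 ≤ C' * (numDyads N * h N)) ∧
      Tendsto (fun N => (1 / D.sigma K w (h N) N) ^ 2 * D.sigmaSq K w (h N) N) atTop (𝓝 1) := by
  obtain ⟨c, hc, hlow⟩ := D.exists_sigmaSq_lower_bound hK hw h_pos h_lim h_lower hΩ
  have hpos : ∀ᶠ N in atTop, 0 < D.sigmaSq K w (h N) N := by
    filter_upwards [hlow, eventually_ge_atTop 2] with N hN h2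
    exact pos_of_mul_pos_right (hc.trans_le hN) (mul_pos (numDyads_pos h2) (h_pos N)).le
  have hsq : ∀ N, D.sigma K w (h N) N ^ 2 = D.sigmaSq K w (h N) N := fun N =>
    Real.sq_sqrt (D.sigmaSq_nonneg _ _)
  constructor
  · refine ⟨1 / c, ?_⟩
    filter_upwards [hlow, hpos] with N hN hp
    rw [div_pow, hsq, one_pow, div_le_iff₀ hp, mul_assoc, one_div, inv_mul_eq_div,
      le_div_iff₀ hc, one_mul]
    exact hN
  · refine tendsto_const_nhds.congr' ?_
    filter_upwards [hpos] with N hp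
    rw [div_pow, hsq, one_pow, one_div, inv_mul_cancel₀ hp.ne']

/-! ### Normalizations and limit variances -/

lemma integral_T2_sq_isBigO (hK : IsKernel K) (hw : D.SmoothAt w) (h_pos : ∀ N, 0 < h N)
    (h_lim : Tendsto h atTop (𝓝 0)) :
    (fun N : ℕ => ∫ ω, D.T2 K w (h N) N ω ^ 2 ∂μ) =O[atTop] (fun N : ℕ => 1 / numDyads N) := by
  obtain ⟨C, hC, hexp⟩ := D.eventually_moment_expansion hK hw h_pos h_lim
  obtain ⟨Kb, hKb⟩ := hK.bounded
  refine IsBigO.of_bound ((4 * C) ^ 2) (hexp.mono fun N hN => ?_)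
  have hn := numDyads_pos hN.1
  rw [Real.norm_of_nonneg (integral_nonneg fun _ => sq_nonneg _),
    Real.norm_of_nonneg (by positivity), mul_one_div]
  exact D.integral_T2_sq_le hK.measurable hKb (h_pos N) hN.2.2.1 hN.1

lemma T4_isBigO (hK : IsKernel K) (hw : D.SmoothAt w) (h_pos : ∀ N, 0 < h N)
    (h_lim : Tendsto h atTop (𝓝 0)) :
    (fun N : ℕ => D.T4 K w (h N)) =O[atTop] (fun N : ℕ => h N ^ 2) := by
  obtain ⟨C, hC, hexp⟩ := D.eventually_moment_expansion hK hw h_pos h_lim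
  refine IsBigO.of_bound C (hexp.mono fun N hN => ?_)
  rw [Real.norm_of_nonneg (sq_nonneg (h N))]
  exact hN.2.2.2.2.2.2

lemma natCast_sub_one_mul_pos {b : ℝ} (hb : 0 < b) {N : ℕ} (hN : 2 ≤ N) : 0 < (N : ℝ) * b - b := by
  have hN' : (2 : ℝ) ≤ N := by exact_mod_cast hN
  nlinarith

/-- The bias is negligible after standardization: if `Ω₁ > 0` then `σ_N²` is at least of the order
`1 / N`, and if `Ω₂ > 0` at least of the order `1 / (n h)`. -/
lemma tendsto_standardized_T4 (hK : IsKernel K) (hw : D.SmoothAt w) (h_pos : ∀ N, 0 < h N)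
    (h_lim : Tendsto h atTop (𝓝 0)) (h_lower : ∃ C > 0, ∀ᶠ N : ℕ in atTop, C ≤ N * h N)
    (h_upper : Tendsto (fun N : ℕ => N * h N ^ 4) atTop (𝓝 0))
    (hΩ : 0 < D.Omega1 w ∨
      (0 < D.Omega2 K w ∧ Tendsto (fun N : ℕ => numDyads N * h N ^ 5) atTop (𝓝 0))) :
    Tendsto (fun N => 1 / D.sigma K w (h N) N * D.T4 K w (h N)) atTop (𝓝 0) := by
  refine D.tendsto_mul_T4 hK hw h_pos h_lim ?_
  have hnonneg : ∀ N, 0 ≤ (1 / D.sigma K w (h N) N) ^ 2 * h N ^ 4 := fun N =>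
    mul_nonneg (sq_nonneg _) (pow_nonneg (h_pos N).le 4)
  rcases hΩ with hΩ | ⟨hΩ, hn5⟩
  · have hlim : Tendsto (fun N : ℕ => 1 / (2 * D.Omega1 w) * (N * h N ^ 4)) atTop (𝓝 0) := by
      simpa using h_upper.const_mul (1 / (2 * D.Omega1 w))
    refine squeeze_zero' (Eventually.of_forall hnonneg) ?_ hlim
    filter_upwards [(D.tendsto_nodeVar hK hw h_pos h_lim).eventually_const_lt (half_lt_self hΩ),
      eventually_ge_atTop 2] with N h1 h2
    have hh := h_pos N
    have hN0 : (0 : ℝ) < N := by exact_mod_cast (by omega : 0 < N)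
    have hσ := D.natCast_mul_sigmaSq_eq (w := w) hK hh h2
    have h3 : 0 ≤ 2 * (h N * D.meanErrVar (D.kernErr K w (h N))) * (N * h N - h N)⁻¹ :=
      mul_nonneg (mul_nonneg zero_le_two (mul_nonneg hh.le D.meanErrVar_nonneg))
        (inv_nonneg.2 (natCast_sub_one_mul_pos hh h2).le)
    have h4 : 2 * D.Omega1 w ≤ N * D.sigmaSq K w (h N) N := by linarith
    have h5 : 0 < D.sigmaSq K w (h N) N :=
      pos_of_mul_pos_right ((mul_pos two_pos hΩ).trans_le h4) hN0.le
    have h6 : (1 / D.sigma K w (h N) N) ^ 2 ≤ 1 / (2 * D.Omega1 w) * N := by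
      rw [div_pow, one_pow, sigma, Real.sq_sqrt h5.le, div_le_iff₀ h5, mul_assoc, one_div,
        inv_mul_eq_div, le_div_iff₀ (by positivity), one_mul]
      exact h4
    rw [← mul_assoc]
    gcongr
  · obtain ⟨⟨C', hC'⟩, -⟩ :=
      D.standardization_admissible hK hw h_pos h_lim h_lower (Or.inr hΩ)
    have hlim : Tendsto (fun N : ℕ => C' * (numDyads N * h N ^ 5)) atTop (𝓝 0) := by
      simpa using hn5.const_mul C'
    refine squeeze_zero' (Eventually.of_forall hnonneg) (hC'.mono fun N hN => ?_) hlim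
    have hh := h_pos N
    calc _ ≤ C' * (numDyads N * h N) * h N ^ 4 := by gcongr
      _ = _ := by ring

lemma tendsto_natCast_mul_sigmaSq (hK : IsKernel K) (hw : D.SmoothAt w) (h_pos : ∀ N, 0 < h N)
    (h_lim : Tendsto h atTop (𝓝 0)) {c : ℝ}
    (hc : Tendsto (fun N : ℕ => (N * h N - h N)⁻¹) atTop (𝓝 c)) :
    Tendsto (fun N : ℕ => N * D.sigmaSq K w (h N) N) atTop
      (𝓝 (4 * D.Omega1 w + 2 * c * D.Omega2 K w)) := by
  have h1 := (((D.tendsto_bandwidth_mul_meanErrVar hK hw h_pos h_lim).const_mul 2).mul hc).add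
    ((D.tendsto_nodeVar hK hw h_pos h_lim).const_mul 4)
  have e : 2 * D.Omega2 K w * c + 4 * D.Omega1 w = 4 * D.Omega1 w + 2 * c * D.Omega2 K w := by ring
  rw [e] at h1
  refine h1.congr' ?_
  filter_upwards [eventually_ge_atTop 2] with N h2
  exact (D.natCast_mul_sigmaSq_eq hK (h_pos N) h2).symm

/-- Central limit theorem for the estimator at the rate `√N`. -/
lemma tendstoNormal_sqrt_natCast (hK : IsKernel K) (hw : D.SmoothAt w) (h_pos : ∀ N, 0 < h N)
    (h_lim : Tendsto h atTop (𝓝 0)) (h_lower : ∃ C > 0, ∀ᶠ N : ℕ in atTop, C ≤ N * h N)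
    (h_upper : Tendsto (fun N : ℕ => N * h N ^ 4) atTop (𝓝 0)) {v : ℝ}
    (hv : Tendsto (fun N : ℕ => N * D.sigmaSq K w (h N) N) atTop (𝓝 v)) :
    TendstoNormal μ (fun (N : ℕ) ω => Real.sqrt N * (D.fHat K w (h N) N ω - D.density w)) v := by
  have hsq : ∀ N : ℕ, Real.sqrt N ^ 2 = N := fun N => Real.sq_sqrt N.cast_nonneg
  obtain ⟨C₀, hC₀, hlow⟩ := id h_lower
  refine D.tendstoNormal_estimator hK hw h_pos h_lim h_lower (C' := 4 / C₀) ?_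
    (by simpa only [hsq] using hv)
    (D.tendsto_mul_T4 hK hw h_pos h_lim (by simpa only [hsq] using h_upper))
  filter_upwards [hlow, eventually_ge_atTop 2] with N h1 h2
  have hh := h_pos N
  rw [hsq, div_mul_eq_mul_div, le_div_iff₀ hC₀]
  calc (N : ℝ) * C₀ ≤ N * (N * h N) := by gcongr
    _ = 4 * ((N : ℝ) ^ 2 / 4 * h N) := by ring
    _ ≤ 4 * (numDyads N * h N) := by
      have := numDyads_ge h2
      gcongr

/-- If `Ω₁ = 0`, the variance of `E[K_ij | A_i]` is `O(h²)`, so the attribute effects contribute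
`O(N h³)`, and `(N h³)² ≤ 4 n h⁵`. -/
lemma tendsto_numDyads_mul_sigmaSq (hK : IsKernel K) (hw : D.SmoothAt w) (h_pos : ∀ N, 0 < h N)
    (h_lim : Tendsto h atTop (𝓝 0)) (hΩ : D.Omega1 w = 0)
    (hn5 : Tendsto (fun N : ℕ => numDyads N * h N ^ 5) atTop (𝓝 0)) :
    Tendsto (fun N => numDyads N * h N * D.sigmaSq K w (h N) N) atTop (𝓝 (D.Omega2 K w)) := by
  obtain ⟨C, hC, hexp⟩ := D.eventually_moment_expansion hK hw h_pos h_lim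
  have hlim : Tendsto (fun N : ℕ => 2 * C * Real.sqrt (4 * (numDyads N * h N ^ 5))) atTop
      (𝓝 0) := by
    simpa using (hn5.const_mul 4).sqrt.const_mul (2 * C)
  have hrest : Tendsto (fun N : ℕ => 2 * ((N : ℝ) - 1) * h N * D.nodeVar K w (h N)) atTop
      (𝓝 0) := by
    refine squeeze_zero' ?_ ?_ hlim
    · filter_upwards [eventually_ge_atTop 2] with N h2
      have hN' : (2 : ℝ) ≤ N := by exact_mod_cast h2
      exact mul_nonneg (mul_nonneg (by linarith) (h_pos N).le) D.nodeVar_nonneg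
    · filter_upwards [hexp] with N hN
      obtain ⟨h2, hh1, -, -, -, hV, -⟩ := hN
      have hN' : (2 : ℝ) ≤ N := by exact_mod_cast h2
      have hh := h_pos N
      rw [hΩ, sub_zero, abs_of_nonneg D.nodeVar_nonneg] at hV
      have h3 : N * h N ^ 3 ≤ Real.sqrt (4 * (numDyads N * h N ^ 5)) := by
        refine Real.le_sqrt_of_sq_le ?_
        calc (N * h N ^ 3) ^ 2 = (N : ℝ) ^ 2 * (h N ^ 5 * h N) := by ring
          _ ≤ (N : ℝ) ^ 2 * (h N ^ 5 * 1) := by gcongr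
          _ = 4 * ((N : ℝ) ^ 2 / 4 * h N ^ 5) := by ring
          _ ≤ _ := by
            have := numDyads_ge h2
            gcongr
      calc 2 * ((N : ℝ) - 1) * h N * D.nodeVar K w (h N)
          ≤ 2 * (N : ℝ) * h N * (C * h N ^ 2) := by
            have h4 : (N : ℝ) - 1 ≤ N := by linarith
            have h5 : 0 ≤ (N : ℝ) - 1 := by linarith
            have := D.nodeVar_nonneg (K := K) (w := w) (h := h N)
            gcongr
        _ = 2 * C * (N * h N ^ 3) := by ring
        _ ≤ _ := by gcongr
  have h1 := (D.tendsto_bandwidth_mul_meanErrVar hK hw h_pos h_lim).add hrest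
  rw [add_zero] at h1
  refine h1.congr' ?_
  filter_upwards [eventually_ge_atTop 2] with N h2
  exact (D.numDyads_mul_sigmaSq_eq hK (h_pos N) h2).symm

/-- Central limit theorem for the estimator at the rate `√(n h)` in the degenerate case. -/
lemma tendstoNormal_sqrt_numDyads (hK : IsKernel K) (hw : D.SmoothAt w) (h_pos : ∀ N, 0 < h N)
    (h_lim : Tendsto h atTop (𝓝 0)) (h_lower : ∃ C > 0, ∀ᶠ N : ℕ in atTop, C ≤ N * h N)
    (hΩ : D.Omega1 w = 0) (hn5 : Tendsto (fun N : ℕ => numDyads N * h N ^ 5) atTop (𝓝 0)) :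
    TendstoNormal μ (fun (N : ℕ) ω =>
      Real.sqrt (numDyads N * h N) * (D.fHat K w (h N) N ω - D.density w)) (D.Omega2 K w) := by
  have hsq : ∀ N : ℕ, Real.sqrt (numDyads N * h N) ^ 2 = numDyads N * h N := fun N =>
    Real.sq_sqrt (mul_nonneg (Nat.cast_nonneg _) (h_pos N).le)
  refine D.tendstoNormal_estimator hK hw h_pos h_lim h_lower (C' := 1)
    (Eventually.of_forall fun N => by rw [hsq, one_mul])
    (by simpa only [hsq] using D.tendsto_numDyads_mul_sigmaSq hK hw h_pos h_lim hΩ hn5)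
    (D.tendsto_mul_T4 hK hw h_pos h_lim ?_)
  simp only [hsq]
  exact hn5.congr fun N => by ring

end Model

end DyadicKDE

theorem mainTheorem2 {Ω : Type*} [MeasurableSpace Ω] (μ : Measure Ω) [IsProbabilityMeasure μ]
    {𝔸 : Type*} [MeasurableSpace 𝔸] (D : DyadicKDE.Model μ 𝔸)
    (K : ℝ → ℝ) (hK : DyadicKDE.IsKernel K) (w : ℝ) (hw : D.SmoothAt w)
    (h : ℕ → ℝ) (h_pos : ∀ N, 0 < h N) (h_lim : Tendsto h atTop (𝓝 0))
    (h_lower : ∃ C > 0, ∀ᶠ N : ℕ in atTop, C ≤ N * h N)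
    (h_upper : Tendsto (fun N : ℕ => N * h N ^ 4) atTop (𝓝 0)) :
    -- the four-term decomposition
    (∀ N ω, D.fHat K w (h N) N ω - D.density w =
      D.T1 K w (h N) N ω + D.T2 K w (h N) N ω + D.T3 K w (h N) N ω + D.T4 K w (h N)) ∧
    -- expansion of the variance
    (fun N : ℕ => D.sigmaSq K w (h N) N -
        (D.Omega2 K w / (DyadicKDE.numDyads N * h N) + 4 * D.Omega1 w / N))
      =O[atTop] (fun N : ℕ => 1 / DyadicKDE.numDyads N + h N ^ 2 / N) ∧
    -- orders of magnitude of the second and fourth terms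
    (fun N : ℕ => ∫ ω, D.T2 K w (h N) N ω ^ 2 ∂μ)
      =O[atTop] (fun N : ℕ => 1 / DyadicKDE.numDyads N) ∧
    (fun N : ℕ => D.T4 K w (h N)) =O[atTop] (fun N : ℕ => h N ^ 2) ∧
    -- central limit theorem for the leading terms, negligibility of the second term
    (0 < D.Omega1 w ∨ 0 < D.Omega2 K w →
      DyadicKDE.TendstoNormal μ (fun (N : ℕ) ω =>
        (D.T1 K w (h N) N ω + D.T3 K w (h N) N ω) / D.sigma K w (h N) N) 1 ∧
      TendstoInMeasure μ (fun (N : ℕ) ω => D.T2 K w (h N) N ω / D.sigma K w (h N) N) atTop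
        (fun _ => 0)) ∧
    -- negligibility of the bias, central limit theorem for the standardized estimator
    (0 < D.Omega1 w ∨
        (0 < D.Omega2 K w ∧
          Tendsto (fun N : ℕ => DyadicKDE.numDyads N * h N ^ 5) atTop (𝓝 0)) →
      Tendsto (fun N : ℕ => D.T4 K w (h N) / D.sigma K w (h N) N) atTop (𝓝 0) ∧
      DyadicKDE.TendstoNormal μ (fun (N : ℕ) ω =>
        (D.fHat K w (h N) N ω - D.density w) / D.sigma K w (h N) N) 1) ∧
    -- the nondegenerate case
    (Tendsto (fun N : ℕ => N * h N) atTop atTop → 0 < D.Omega1 w →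
      Tendsto (fun N : ℕ => N * D.sigmaSq K w (h N) N) atTop (𝓝 (4 * D.Omega1 w)) ∧
      DyadicKDE.TendstoNormal μ (fun (N : ℕ) ω =>
        Real.sqrt N * (D.fHat K w (h N) N ω - D.density w)) (4 * D.Omega1 w)) ∧
    -- the knife-edge case
    (∀ C > 0, Tendsto (fun N : ℕ => N * h N) atTop (𝓝 C) →
      Tendsto (fun N : ℕ => N * D.sigmaSq K w (h N) N) atTop
        (𝓝 (4 * D.Omega1 w + 2 * C⁻¹ * D.Omega2 K w)) ∧
      DyadicKDE.TendstoNormal μ (fun (N : ℕ) ω =>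
        Real.sqrt N * (D.fHat K w (h N) N ω - D.density w))
        (4 * D.Omega1 w + 2 * C⁻¹ * D.Omega2 K w)) ∧
    -- the degenerate case
    (D.Omega1 w = 0 →
      Tendsto (fun N : ℕ => DyadicKDE.numDyads N * h N ^ 5) atTop (𝓝 0) →
      DyadicKDE.TendstoNormal μ (fun (N : ℕ) ω =>
        Real.sqrt (DyadicKDE.numDyads N * h N) * (D.fHat K w (h N) N ω - D.density w))
        (D.Omega2 K w)) := by
  refine ⟨fun N ω => D.fHat_sub_density_eq N ω, D.sigmaSq_expansion_isBigO hK hw h_pos h_lim,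
    D.integral_T2_sq_isBigO hK hw h_pos h_lim, D.T4_isBigO hK hw h_pos h_lim, fun hΩ => ?_,
    fun hΩ => ?_, fun hNh hΩ => ?_, fun C hC hNh => ?_, fun hΩ hn5 =>
    D.tendstoNormal_sqrt_numDyads hK hw h_pos h_lim h_lower hΩ hn5⟩
  · obtain ⟨⟨C', hC'⟩, hv⟩ := D.standardization_admissible hK hw h_pos h_lim h_lower hΩ
    have h1 := D.tendstoNormal_leading hK hw h_pos h_lim h_lower hC' hv
    have h2 := D.tendstoInMeasure_T2 hK hw h_pos h_lim hC'
    simp only [one_div_mul_eq_div] at h1 h2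
    exact ⟨h1, h2⟩
  · obtain ⟨⟨C', hC'⟩, hv⟩ := D.standardization_admissible hK hw h_pos h_lim h_lower
      (hΩ.imp_right And.left)
    have h1 := D.tendsto_standardized_T4 hK hw h_pos h_lim h_lower h_upper hΩ
    have h2 := D.tendstoNormal_estimator hK hw h_pos h_lim h_lower hC' hv h1
    simp only [one_div_mul_eq_div] at h1 h2
    exact ⟨h1, h2⟩
  · have hc : Tendsto (fun N : ℕ => (N * h N - h N)⁻¹) atTop (𝓝 0) := by
      refine tendsto_inv_atTop_zero.comp ?_
      simpa only [sub_eq_add_neg] using hNh.atTop_add h_lim.neg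
    have hv := D.tendsto_natCast_mul_sigmaSq hK hw h_pos h_lim hc
    rw [mul_zero, zero_mul, add_zero] at hv
    exact ⟨hv, D.tendstoNormal_sqrt_natCast hK hw h_pos h_lim h_lower h_upper hv⟩
  · have hc : Tendsto (fun N : ℕ => (N * h N - h N)⁻¹) atTop (𝓝 C⁻¹) := by
      have h1 := hNh.sub h_lim
      rw [sub_zero] at h1
      exact h1.inv₀ hC.ne'
    have hv := D.tendsto_natCast_mul_sigmaSq hK hw h_pos h_lim hc
    exact ⟨hv, D.tendstoNormal_sqrt_natCast hK hw h_pos h_lim h_lower h_upper hv⟩
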